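/- Let $R$ be a commutative Noetherian ring with $1$ and let $I\subseteq R$ be an ideal; write $I[X]$ for the extension of $I$ to $R[X]$, and, for $f\in R[X]$, write $I[X]_f$ for the extension of $I[X]$ to the localization $R[X]_f$ and $\alpha_f$ for the image over $R[X]_f$ of a matrix $\alpha$ over $R[X]$. For a commutative ring $A$ and an ideal $J$ of $A$, let $\mathrm{SL}_n(A,J)$ be the group of matrices in $\mathrm{SL}_n(A)$ congruent to the identity modulo $J$. Let $\mathrm{E}_n(A)$ be the group generated by the elementary matrices $e_{ij}(\lambda)=\mathrm{I}_n+\lambda E_{ij}$ ($i\ne j$, $\lambda\in A$), and let $\mathrm{E}_n(A,J)$ be the group generated by the matrices $\gamma e_{ij}(a)\gamma^{-1}$ with $\gamma\in \mathrm{E}_n(A)$, $i\neq j$, $a\in J$. Let $\chi_m$ be the block diagonal matrix with $m$ diagonal blocks $\begin{pmatrix}0&1\\-1&0\end{pmatrix}$, and let $\mathrm{Sp}_{2m}(A,J)$ be the group of $\alpha\in\mathrm{GL}_{2m}(A)$ with $\alpha^T\chi_m\alpha=\chi_m$ that are congruent to the identity modulo $J$. Let $\sigma$ be the permutation of $\{1,\dots,2m\}$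 exchanging $2i-1$ and $2i$ for $1\le i\le m$; for $i\ne j$ and $\lambda\in A$ put $se_{ij}(\lambda)=\mathrm{I}_{2m}+\lambda E_{ij}$ if $i=\sigma(j)$, and $se_{ij}(\lambda)=\mathrm{I}_{2m}+\lambda E_{ij}-(-1)^{i+j}\lambda E_{\sigma(j)\sigma(i)}$ if $i\neq\sigma(j)$. Let $\mathrm{ESp}_{2m}(A)$ be the group generated by all $se_{ij}(\lambda)$, and let $\mathrm{ESp}_{2m}(A,J)$ be the group generated by the matrices $\gamma\, se_{ij}(a)\gamma^{-1}$ with $\gamma\in\mathrm{ESp}_{2m}(A)$, $i\ne j$, $a\in J$. (Linear case.) Let $n\geq 1$ with $n\neq 2$, and let $\alpha\in \mathrm{SL}_n(R[X],I[X])$. If there is a monic polynomial $f\in R[X]$ with $\alpha_f\in \mathrm{E}_n(R[X]_f,I[X]_f)$, then $\alpha\in \mathrm{E}_n(R[X],I[X])$. (Symplectic case.) Let $n=2m\geq 4$, and let $\alpha\in \mathrm{Sp}_{2m}(R[X],I[X])$. If there is a monic polynomial $f\in R[X]$ with $\alpha_f\in \mathrm{ESp}_{2m}(R[X]_f,I[X]_f)$,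 then $\alpha\in \mathrm{ESp}_{2m}(R[X],I[X])$. -/

import Mathlib

open scoped Polynomial

namespace RelativeElementary

/-- The congruence subgroup `GL_n(R, I)`: the kernel of `GL_n(R) → GL_n(R / I)`. -/
def relGL (n : ℕ) (R : Type*) [CommRing R] (I : Ideal R) : Subgroup (GL (Fin n) R) :=
  (Matrix.GeneralLinearGroup.map (n := Fin n) (Ideal.Quotient.mk I)).ker

/-- The relative special linear group `SL_n(R, I)`. -/
def relSL (n : ℕ) (R : Type*) [CommRing R] (I : Ideal R) : Subgroup (GL (Fin n) R) :=
  relGL n R I ⊓ (Matrix.GeneralLinearGroup.det (n := Fin n) (R := R)).ker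

/-- The elementary matrix `e_{ij}(a)`, `i ≠ j`, as an element of `GL_n(R)`. -/
def elem {n : ℕ} {R : Type*} [CommRing R] (i j : Fin n) (h : i ≠ j) (a : R) : GL (Fin n) R where
  val := Matrix.transvection i j a
  inv := Matrix.transvection i j (-a)
  val_inv := by rw [Matrix.transvection_mul_transvection_same _ _ h]; simp
  inv_val := by rw [Matrix.transvection_mul_transvection_same _ _ h]; simp

/-- The elementary group `E_n(R)`. -/
def E (n : ℕ) (R : Type*) [CommRing R] : Subgroup (GL (Fin n) R) :=
  Subgroup.closure {g | ∃ (i j : Fin n) (h : i ≠ j) (a : R), g = elem i j h a}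

/-- The relative elementary group `E_n(R, I)`, generated by the `E_n(R)`-conjugates of the
elementary matrices with off-diagonal entry in `I`. -/
def relE (n : ℕ) (R : Type*) [CommRing R] (I : Ideal R) : Subgroup (GL (Fin n) R) :=
  Subgroup.closure {g | ∃ α ∈ E n R, ∃ (i j : Fin n) (h : i ≠ j), ∃ a ∈ I,
    g = α * elem i j h a * α⁻¹}

/-- The permutation of the index set exchanging the members of each pair
`{0, 1}, {2, 3}, …` (that is `2i ↔ 2i - 1` if indices start at `1`). -/
def swap {m : ℕ} (i : Fin (2 * m)) : Fin (2 * m) :=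
  if h : (i : ℕ) % 2 = 0 then ⟨i + 1, by omega⟩ else ⟨i - 1, by omega⟩

/-- The standard alternating matrix `χ_m`, the block diagonal matrix with `m` diagonal blocks
`(0, 1; -1, 0)`. -/
def chi (m : ℕ) (R : Type*) [CommRing R] : Matrix (Fin (2 * m)) (Fin (2 * m)) R :=
  Matrix.of fun i j => if j = swap i then (-1) ^ (i : ℕ) else 0

/-- The symplectic group `Sp_{2m}(R)`. -/
def Sp (m : ℕ) (R : Type*) [CommRing R] : Subgroup (GL (Fin (2 * m)) R) where
  carrier := {α | α.val.transpose * chi m R * α.val = chi m R}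
  one_mem' := by
    change (1 : Matrix (Fin (2 * m)) (Fin (2 * m)) R).transpose * chi m R * 1 = chi m R
    simp
  mul_mem' := by
    intro a b ha hb
    change a.val.transpose * chi m R * a.val = chi m R at ha
    change b.val.transpose * chi m R * b.val = chi m R at hb
    change (a.val * b.val).transpose * chi m R * (a.val * b.val) = chi m R
    calc _ = b.val.transpose * (a.val.transpose * chi m R * a.val) * b.val := by
            simp only [Matrix.transpose_mul, Matrix.mul_assoc]
      _ = _ := by rw [ha, hb]
  inv_mem' := by
    intro a ha
    change a.val.transpose * chi m R * a.val = chi m R at ha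
    change a.inv.transpose * chi m R * a.inv = chi m R
    have h2 : a.inv.transpose * a.val.transpose = 1 := by
      rw [← Matrix.transpose_mul, a.val_inv, Matrix.transpose_one]
    calc _ = a.inv.transpose * (a.val.transpose * chi m R * a.val) * a.inv := by rw [ha]
      _ = (a.inv.transpose * a.val.transpose) * chi m R * (a.val * a.inv) := by
            simp only [Matrix.mul_assoc]
      _ = chi m R := by rw [h2, a.val_inv, Matrix.one_mul, Matrix.mul_one]

/-- The relative symplectic group `Sp_{2m}(R, I)`. -/
def relSp (m : ℕ) (R : Type*) [CommRing R] (I : Ideal R) : Subgroup (GL (Fin (2 * m)) R) :=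
  relGL (2 * m) R I ⊓ Sp m R

/-- The matrix underlying the elementary symplectic generator `se_{ij}(a)`. -/
def symElemMatrix {m : ℕ} {R : Type*} [CommRing R] (i j : Fin (2 * m)) (a : R) :
    Matrix (Fin (2 * m)) (Fin (2 * m)) R :=
  if i = swap j then 1 + Matrix.single i j a
  else 1 + Matrix.single i j a
    - Matrix.single (swap j) (swap i) ((-1) ^ ((i : ℕ) + (j : ℕ)) * a)

theorem swap_ne {m : ℕ} (i : Fin (2 * m)) : swap i ≠ i := by
  intro h
  have h1 := congrArg Fin.val h
  unfold swap at h1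
  split_ifs at h1 with h2
  · exact absurd h1 (Nat.succ_ne_self _)
  · change (i : ℕ) - 1 = i at h1
    omega

theorem swap_val {m : ℕ} (i : Fin (2 * m)) :
    (swap i : ℕ) = if (i : ℕ) % 2 = 0 then (i : ℕ) + 1 else (i : ℕ) - 1 := by
  unfold swap
  split_ifs <;> rfl

theorem swap_swap {m : ℕ} (i : Fin (2 * m)) : swap (swap i) = i := by
  apply Fin.ext
  rw [swap_val, swap_val]
  split_ifs <;> omega

theorem symElemMatrix_mul_neg {m : ℕ} {R : Type*} [CommRing R] (i j : Fin (2 * m)) (h : i ≠ j)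
    (a : R) : symElemMatrix i j a * symElemMatrix i j (-a) = 1 := by
  have h1 : swap i ≠ swap j := fun e => h (by rw [← swap_swap i, e, swap_swap])
  have h2 := swap_ne i
  have h3 := swap_ne j
  unfold symElemMatrix
  split_ifs
  · simp [mul_add, add_mul, Matrix.single_mul_single_of_ne, h.symm, ← Matrix.single_add,
      add_assoc]
  · simp [mul_add, add_mul, mul_sub, sub_mul, Matrix.single_mul_single_of_ne, h.symm, h1, h2,
      h3.symm]
    rw [← Matrix.single_neg, ← Matrix.single_neg]
    abel

/-- The elementary symplectic generator `se_{ij}(a)`, `i ≠ j`, as an element of `GL_{2m}(R)`. -/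
def symElem {m : ℕ} {R : Type*} [CommRing R] (i j : Fin (2 * m)) (h : i ≠ j) (a : R) :
    GL (Fin (2 * m)) R where
  val := symElemMatrix i j a
  inv := symElemMatrix i j (-a)
  val_inv := symElemMatrix_mul_neg i j h a
  inv_val := by simpa using symElemMatrix_mul_neg i j h (-a)

/-- The elementary symplectic group `ESp_{2m}(R)`. -/
def ESp (m : ℕ) (R : Type*) [CommRing R] : Subgroup (GL (Fin (2 * m)) R) :=
  Subgroup.closure {g | ∃ (i j : Fin (2 * m)) (h : i ≠ j) (a : R), g = symElem i j h a}

/-- The relative elementary symplectic group `ESp_{2m}(R, I)`, generated by the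
`ESp_{2m}(R)`-conjugates of the elementary symplectic generators with parameter in `I`. -/
def relESp (m : ℕ) (R : Type*) [CommRing R] (I : Ideal R) : Subgroup (GL (Fin (2 * m)) R) :=
  Subgroup.closure {g | ∃ α ∈ ESp m R, ∃ (i j : Fin (2 * m)) (h : i ≠ j), ∃ a ∈ I,
    g = α * symElem i j h a * α⁻¹}

/-- The extended ideal `I[X]` of `R[X]`. -/
noncomputable abbrev polyIdeal {R : Type*} [CommRing R] (I : Ideal R) : Ideal R[X] :=
  I.map (Polynomial.C : R →+* R[X])

/-- The extended ideal `I[X]_f` of the localization `R[X]_f`. -/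
noncomputable abbrev polyIdealAway {R : Type*} [CommRing R] (I : Ideal R) (f : R[X]) :
    Ideal (Localization.Away f) :=
  (polyIdeal I).map (algebraMap R[X] (Localization.Away f))

/-- The image `α_f` in `GL_n(R[X]_f)` of `α ∈ GL_n(R[X])`. -/
noncomputable abbrev locAway {n : ℕ} {R : Type*} [CommRing R] (f : R[X]) (α : GL (Fin n) R[X]) :
    GL (Fin n) (Localization.Away f) :=
  Matrix.GeneralLinearGroup.map (algebraMap R[X] (Localization.Away f)) α

end RelativeElementary

namespace RelativeElementary

universe u

/-! The relative statement is an absolute one over another ring. Let D be the ring of pairs in R × R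
that are congruent modulo I. A matrix α ≡ 1 modulo I[X] amounts to the pair (1, α) over D[X]; a
relative elementary matrix over R[X]_f lifts to an elementary matrix over a localization of D[X]
(`RootElements.exists_lift_relE`); and if the pair (1, α) is elementary over D[X], then α is
relative elementary (`RootElements.excision`). So everything rests on
`ElementarySystem.mem_E_of_locMonic`: a matrix over A[X] that becomes elementary once the monic
polynomials are inverted is elementary.

This is Horrocks' theorem on the projective line with charts A[T] and A[T⁻¹], where X = T⁻¹.
Quillen's local-global principle (`ElementarySystem.mul_constTerm_inv_mem_E_of_local`) reduces it,
up to the constant term, to a local ring A with maximal ideal m and residue field k. Since k[X] is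
Euclidean, one may assume α ≡ 1 modulo m[X]. After inverting the monic polynomials, the quotient by
m is the field k(X), and a Bruhat decomposition modulo m shows that α is relative elementary for m
there (`BruhatData.E_inf_relGL_le`). Monic polynomials in T⁻¹ become units once T and the
polynomials in T with constant coefficient 1 are inverted. Over that ring α(T⁻¹) splits as g·b, with
g relative elementary over A[T,T⁻¹] and b regular at T = 0
(`ElementarySystem.exists_split_locBoth`), so g⁻¹α(T⁻¹) is a matrix over A[T] (`exists_glue`). As m
is the Jacobson radical, g = k(T⁻¹)h(T) with k relative elementary
(`ElementarySystem.exists_factorization'`). Then k⁻¹α is polynomial in T⁻¹ and in T, hence constant,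
and constants over a local ring are elementary. Over a general A the constant term α(0) is treated
by the same splitting and glueing.

The factorization over A[T,T⁻¹] holds because the set of products (matrix in T)·(matrix in T⁻¹) is
stable under conjugation by elementary matrices. Conjugation by a root element with parameter cT or
cT⁻¹ turns into conjugation by a constant one after twisting with a diagonal matrix with entries T
and 1. The twist respects each factor up to its constant term, and constant terms are handled by an
LDU decomposition; higher powers of T come from commutator relations.

Both families of groups enter only through the axioms of `ElementarySystem`. The essential input is
that transvections are elementary: 1 + v wᵗ with w unimodular and w·v = 0 for n ≥ 3
(`linear_matMem`, `matMem_of_koszul`), and the symplectic transvections for m ≥ 2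
(`matMem_sympTrans`). -/

theorem mem_relGL {N : ℕ} {B : Type*} [CommRing B] {J : Ideal B} {g : GL (Fin N) B} :
    g ∈ relGL N B J ↔ ∀ a b, g.1 a b - (1 : Matrix (Fin N) (Fin N) B) a b ∈ J := by
  rw [relGL, MonoidHom.mem_ker, Units.ext_iff, ← Matrix.ext_iff]
  refine forall₂_congr fun a b => ?_
  rw [← Ideal.Quotient.eq]
  rcases eq_or_ne a b with rfl | h <;> simp [*]

theorem glMap_injective {N : ℕ} {B C : Type*} [CommRing B] [CommRing C] {φ : B →+* C}
    (hφ : Function.Injective φ) :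
    Function.Injective (Matrix.GeneralLinearGroup.map (n := Fin N) φ) := by
  intro g h e
  ext a b
  exact hφ (by simpa using congrArg (fun k : GL (Fin N) C => k.1 a b) e)

/-! ### Root elements, relative elementary groups, excision. -/

/-- A family of root elements `x a b c`, natural in the ring and additive in the parameter. -/
structure RootElements (N : ℕ) where
  x : ∀ {B : Type u} [CommRing B] (a b : Fin N), a ≠ b → B → GL (Fin N) B
  x_add : ∀ {B : Type u} [CommRing B] (a b : Fin N) (h : a ≠ b) (c d : B),
    x a b h (c + d) = x a b h c * x a b h d
  x_map : ∀ {B C : Type u} [CommRing B] [CommRing C] (φ : B →+* C) (a b : Fin N) (h : a ≠ b)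
    (c : B), Matrix.GeneralLinearGroup.map φ (x a b h c) = x a b h (φ c)

namespace RootElements

variable {N : ℕ} (S : RootElements.{u} N)

/-- The group generated by the root elements. -/
def E (B : Type u) [CommRing B] : Subgroup (GL (Fin N) B) :=
  Subgroup.closure {g | ∃ (a b : Fin N) (h : a ≠ b) (c : B), g = S.x a b h c}

/-- The relative elementary group. -/
def relE (B : Type u) [CommRing B] (J : Ideal B) : Subgroup (GL (Fin N) B) :=
  Subgroup.closure {g | ∃ α ∈ S.E B, ∃ (a b : Fin N) (h : a ≠ b), ∃ c ∈ J,
    g = α * S.x a b h c * α⁻¹}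

variable {B C : Type u} [CommRing B] [CommRing C]

theorem x_zero (a b : Fin N) (h : a ≠ b) : S.x a b h (0 : B) = 1 := by
  have := S.x_add a b h (0 : B) 0
  rw [add_zero] at this
  exact left_eq_mul.mp this

theorem x_neg (a b : Fin N) (h : a ≠ b) (c : B) : S.x a b h (-c) = (S.x a b h c)⁻¹ := by
  rw [eq_inv_iff_mul_eq_one, ← x_add, neg_add_cancel, x_zero]

theorem x_mem_E (a b : Fin N) (h : a ≠ b) (c : B) : S.x a b h c ∈ S.E B :=
  Subgroup.subset_closure ⟨a, b, h, c, rfl⟩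

theorem conj_mem_relE {J : Ideal B} {α : GL (Fin N) B} (hα : α ∈ S.E B) (a b : Fin N) (h : a ≠ b)
    {c : B} (hc : c ∈ J) : α * S.x a b h c * α⁻¹ ∈ S.relE B J :=
  Subgroup.subset_closure ⟨α, hα, a, b, h, c, hc, rfl⟩

theorem x_mem_relE {J : Ideal B} (a b : Fin N) (h : a ≠ b) {c : B} (hc : c ∈ J) :
    S.x a b h c ∈ S.relE B J := by
  simpa using S.conj_mem_relE (one_mem _) a b h hc

theorem relE_le_E (J : Ideal B) : S.relE B J ≤ S.E B := by
  rw [relE, Subgroup.closure_le]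
  rintro _ ⟨α, hα, a, b, h, c, -, rfl⟩
  exact mul_mem (mul_mem hα (S.x_mem_E a b h c)) (inv_mem hα)

theorem relE_top : S.relE B ⊤ = S.E B := by
  refine le_antisymm (S.relE_le_E ⊤) ?_
  rw [E, Subgroup.closure_le]
  rintro _ ⟨a, b, h, c, rfl⟩
  exact S.x_mem_relE a b h trivial

/-- A subgroup containing all root elements contains the elementary group. -/
theorem E_le {H : Subgroup (GL (Fin N) B)} (hH : ∀ a b h c, S.x a b h c ∈ H) : S.E B ≤ H := by
  rw [E, Subgroup.closure_le]
  rintro _ ⟨a, b, h, c, rfl⟩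
  exact hH a b h c

theorem relE_conj {J : Ideal B} {γ g : GL (Fin N) B} (hγ : γ ∈ S.E B) (hg : g ∈ S.relE B J) :
    γ * g * γ⁻¹ ∈ S.relE B J := by
  have : S.relE B J ≤ (S.relE B J).comap (MulAut.conj γ).toMonoidHom := by
    conv_lhs => rw [relE]
    rw [Subgroup.closure_le]
    rintro _ ⟨α, hα, a, b, h, c, hc, rfl⟩
    simpa [mul_assoc] using S.conj_mem_relE (mul_mem hγ hα) a b h hc
  simpa using this hg

theorem relE_conj' {J : Ideal B} {γ g : GL (Fin N) B} (hγ : γ ∈ S.E B) (hg : g ∈ S.relE B J) :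
    γ⁻¹ * g * γ ∈ S.relE B J := by
  simpa using S.relE_conj (inv_mem hγ) hg

theorem map_mem_E (φ : B →+* C) {g : GL (Fin N) B} (hg : g ∈ S.E B) :
    Matrix.GeneralLinearGroup.map φ g ∈ S.E C := by
  have : S.E B ≤ (S.E C).comap (Matrix.GeneralLinearGroup.map φ) :=
    S.E_le fun a b h c => by simpa [S.x_map] using S.x_mem_E a b h (φ c)
  exact this hg

theorem map_mem_relE (φ : B →+* C) {J : Ideal B} {J' : Ideal C} (hJ : ∀ c ∈ J, φ c ∈ J')
    {g : GL (Fin N) B} (hg : g ∈ S.relE B J) :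
    Matrix.GeneralLinearGroup.map φ g ∈ S.relE C J' := by
  have : S.relE B J ≤ (S.relE C J').comap (Matrix.GeneralLinearGroup.map φ) := by
    conv_lhs => rw [relE]
    rw [Subgroup.closure_le]
    rintro _ ⟨α, hα, a, b, h, c, hc, rfl⟩
    simpa [S.x_map] using S.conj_mem_relE (S.map_mem_E φ hα) a b h (hJ c hc)
  exact this hg

theorem relE_le_relGL (J : Ideal B) : S.relE B J ≤ relGL N B J := by
  rw [relE, Subgroup.closure_le]
  rintro _ ⟨α, hα, a, b, h, c, hc, rfl⟩
  have : Matrix.GeneralLinearGroup.map (Ideal.Quotient.mk J) (S.x a b h c) = 1 := by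
    rw [S.x_map, Ideal.Quotient.eq_zero_iff_mem.mpr hc, S.x_zero]
  change _ ∈ MonoidHom.ker _
  rw [MonoidHom.mem_ker, map_mul, map_mul, this]
  simp

/-- The elementary group lifts along surjections. -/
theorem exists_lift_E {φ : B →+* C} (hφ : Function.Surjective φ) {g : GL (Fin N) C}
    (hg : g ∈ S.E C) : ∃ g' ∈ S.E B, Matrix.GeneralLinearGroup.map φ g' = g := by
  have : S.E C ≤ (S.E B).map (Matrix.GeneralLinearGroup.map φ) := S.E_le fun a b h c => by
    obtain ⟨c, rfl⟩ := hφ c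
    exact ⟨_, S.x_mem_E a b h c, S.x_map φ a b h c⟩
  exact this hg

/-- If two homomorphisms agree modulo `J`, the images of an elementary matrix differ by a
relative elementary matrix. -/
theorem excision {D : Type u} [CommRing D] {p₁ p₂ : D →+* B} {J : Ideal B}
    (hJ : ∀ e, p₂ e - p₁ e ∈ J) {d : GL (Fin N) D} (hd : d ∈ S.E D) :
    (Matrix.GeneralLinearGroup.map p₁ d)⁻¹ * Matrix.GeneralLinearGroup.map p₂ d ∈ S.relE B J := by
  have hx : ∀ a b h e, (Matrix.GeneralLinearGroup.map p₁ (S.x a b h e))⁻¹ *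
      Matrix.GeneralLinearGroup.map p₂ (S.x a b h e) ∈ S.relE B J := fun a b h e => by
    rw [S.x_map, S.x_map, ← S.x_neg, ← S.x_add, neg_add_eq_sub]
    exact S.x_mem_relE a b h (hJ e)
  induction hd using Subgroup.closure_induction with
  | mem _ hg => obtain ⟨a, b, h, c, rfl⟩ := hg; exact hx a b h c
  | one => simp
  | mul g g' hg hg' ih ih' =>
    -- With indices for the two images, (gg')₁⁻¹(gg')₂ = g'₁⁻¹(g₁⁻¹g₂)g'₁ · g'₁⁻¹g'₂, and the
    -- relative group is normal in the elementary group.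
    have := mul_mem (S.relE_conj' (S.map_mem_E p₁ hg') ih) ih'
    simpa [mul_assoc] using this
  | inv g hg ih =>
    have := S.relE_conj (S.map_mem_E p₁ hg) (inv_mem ih)
    simpa [mul_assoc] using this

/-- Relative elementary matrices lift to elementary matrices over a double of the ring. -/
theorem exists_lift_relE {D : Type u} [CommRing D] {p₁ p₂ : D →+* B} {s : B →+* D}
    (h₂ : p₂.comp s = RingHom.id B) {J : Ideal B}
    (hJ : ∀ c ∈ J, ∃ e, p₁ e = 0 ∧ p₂ e = c) {k : GL (Fin N) B} (hk : k ∈ S.relE B J) :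
    ∃ d ∈ S.E D, Matrix.GeneralLinearGroup.map p₁ d = 1 ∧
      Matrix.GeneralLinearGroup.map p₂ d = k := by
  have hs : ∀ (p : D →+* B), p.comp s = RingHom.id B → ∀ γ : GL (Fin N) B,
      Matrix.GeneralLinearGroup.map p (Matrix.GeneralLinearGroup.map s γ) = γ := by
    intro p hp γ
    exact congrArg (fun f => Matrix.GeneralLinearGroup.map f γ) hp
  induction hk using Subgroup.closure_induction with
  | mem _ hg =>
    obtain ⟨α, hα, a, b, h, c, hc, rfl⟩ := hg
    obtain ⟨e, he1, he2⟩ := hJ c hc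
    have hα' := S.map_mem_E s hα
    -- The conjugating matrix is lifted diagonally by `s`, the parameter `c` to an element such as
    -- (0, c), so that the first image is trivial.
    refine ⟨_, mul_mem (mul_mem hα' (S.x_mem_E a b h e)) (inv_mem hα'), ?_, ?_⟩
    · simp [S.x_map, he1, S.x_zero]
    · rw [map_mul, map_mul, map_inv, hs _ h₂, S.x_map, he2]
  | one => exact ⟨1, one_mem _, by simp, by simp⟩
  | mul g g' _ _ ih ih' =>
    obtain ⟨d, hd, h1, h2⟩ := ih
    obtain ⟨d', hd', h1', h2'⟩ := ih'
    exact ⟨d * d', mul_mem hd hd', by simp [h1, h1'], by simp [h2, h2']⟩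
  | inv g _ ih =>
    obtain ⟨d, hd, h1, h2⟩ := ih
    exact ⟨d⁻¹, inv_mem hd, by simp [h1], by simp [h2]⟩

end RootElements

/-! ### Row and column operations, LDU decomposition. -/

/-- A group of invertible matrices, natural in the ring, with a family of root elements which act
as elementary row and column operations. The involution `σ` describes the additional row
and column that a root element changes. -/
structure ElementaryGroup (N : ℕ) extends RootElements.{u} N where
  σ : Fin N → Fin N
  σ_σ : ∀ a, σ (σ a) = a
  G : ∀ (B : Type u) [CommRing B], Subgroup (GL (Fin N) B)
  x_mem_G : ∀ {B : Type u} [CommRing B] (a b : Fin N) (h : a ≠ b) (c : B), x a b h c ∈ G B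
  map_mem_G : ∀ {B C : Type u} [CommRing B] [CommRing C] (φ : B →+* C) {g : GL (Fin N) B},
    g ∈ G B → Matrix.GeneralLinearGroup.map φ g ∈ G C
  -- Applied to the two projections of a double ring, and with `φ = ψ` to an injective homomorphism.
  mem_G_of_map : ∀ {B C D : Type u} [CommRing B] [CommRing C] [CommRing D] (φ : B →+* C)
    (ψ : B →+* D) (_ : ∀ b, φ b = 0 → ψ b = 0 → b = 0) {g : GL (Fin N) B},
    Matrix.GeneralLinearGroup.map φ g ∈ G C → Matrix.GeneralLinearGroup.map ψ g ∈ G D → g ∈ G B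
  x_row : ∀ {B : Type u} [CommRing B] (a b : Fin N) (h : a ≠ b) (c : B) (l : Fin N),
    (x a b h c).1 a l = (1 : Matrix (Fin N) (Fin N) B) a l + if l = b then c else 0
  -- The condition on `σ b` is void when `σ b = b`, so `σ = id` gives the linear case: only row `a`
  -- changes.
  x_row_ne : ∀ {B : Type u} [CommRing B] (a b : Fin N) (h : a ≠ b) (c : B) (k l : Fin N),
    k ≠ a → (σ b ≠ b → k ≠ σ b) → (x a b h c).1 k l = (1 : Matrix (Fin N) (Fin N) B) k l
  x_col : ∀ {B : Type u} [CommRing B] (a b : Fin N) (h : a ≠ b) (c : B) (k : Fin N),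
    (x a b h c).1 k b = (1 : Matrix (Fin N) (Fin N) B) k b + if k = a then c else 0
  x_col_ne : ∀ {B : Type u} [CommRing B] (a b : Fin N) (h : a ≠ b) (c : B) (k l : Fin N),
    l ≠ b → (σ a ≠ a → l ≠ σ a) → (x a b h c).1 k l = (1 : Matrix (Fin N) (Fin N) B) k l
  -- In the symplectic case the invariant form carries the vanishing from index `i` to its partner
  -- `σ i`; for `σ = id` the condition only repeats the hypotheses.
  G_clear : ∀ {B : Type u} [CommRing B] {g : GL (Fin N) B}, g ∈ G B → ∀ i : Fin N,
    (∀ l, l ≠ i → g.1 i l = 0) → (∀ k, k ≠ i → g.1 k i = 0) →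
    ∀ k, k ≠ σ i → g.1 (σ i) k = 0 ∧ g.1 k (σ i) = 0
  diag_mem : ∀ {B : Type u} [CommRing B] (J : Ideal B) {g : GL (Fin N) B}, g ∈ G B →
    (∀ a b, a ≠ b → g.1 a b = 0) → g ∈ relGL N B J → g ∈ toRootElements.relE B J

namespace ElementaryGroup

variable {N : ℕ} (S : ElementaryGroup.{u} N) {B C : Type u} [CommRing B] [CommRing C]

theorem E_le_G : S.E B ≤ S.G B := S.E_le S.x_mem_G

section Operations

variable (a b : Fin N) (h : a ≠ b) (c : B) (g : GL (Fin N) B)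

theorem x_mul_row (l : Fin N) : (S.x a b h c * g).1 a l = g.1 a l + c * g.1 b l := by
  rw [Units.val_mul, Matrix.mul_apply]
  simp [S.x_row, add_mul, Finset.sum_add_distrib, Matrix.one_apply]

theorem x_mul_row_ne {k : Fin N} (hk : k ≠ a) (hk' : S.σ b ≠ b → k ≠ S.σ b) (l : Fin N) :
    (S.x a b h c * g).1 k l = g.1 k l := by
  rw [Units.val_mul, Matrix.mul_apply]
  simp [S.x_row_ne a b h c k _ hk hk', Matrix.one_apply]

theorem mul_x_col (k : Fin N) : (g * S.x a b h c).1 k b = g.1 k b + c * g.1 k a := by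
  rw [Units.val_mul, Matrix.mul_apply]
  simp [S.x_col, mul_add, Finset.sum_add_distrib, Matrix.one_apply, mul_comm c]

theorem mul_x_col_ne {l : Fin N} (hl : l ≠ b) (hl' : S.σ a ≠ a → l ≠ S.σ a) (k : Fin N) :
    (g * S.x a b h c).1 k l = g.1 k l := by
  rw [Units.val_mul, Matrix.mul_apply]
  simp [S.x_col_ne a b h c _ l hl hl', Matrix.one_apply]

end Operations

/-- The rows and columns with index in `T` have no entry off the diagonal. -/
def SDiag (T : Finset (Fin N)) (g : GL (Fin N) B) : Prop :=
  ∀ a b, a ≠ b → a ∈ T ∨ b ∈ T → g.1 a b = 0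

/-- The set `T` is stable under the involution. -/
def Stable (T : Finset (Fin N)) : Prop := ∀ a, S.σ a ∈ T → a ∈ T

variable {S}

theorem Stable.σ_notMem {T : Finset (Fin N)} (hT : S.Stable T) {a : Fin N} (ha : a ∉ T) :
    S.σ a ∉ T := fun h => ha (hT a h)

theorem Stable.insert {T : Finset (Fin N)} (hT : S.Stable T) (i : Fin N) :
    S.Stable (insert i (insert (S.σ i) T)) := by
  intro a ha
  simp only [Finset.mem_insert] at ha ⊢
  rcases ha with h | h | h
  · right; left; rw [← h, S.σ_σ]
  · left; rw [← S.σ_σ a, h, S.σ_σ]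
  · exact Or.inr (Or.inr (hT a h))

/-- Stability of `T` keeps the second row and column that the root element changes, those of `σ b`
and `σ a`, outside `T` as well. -/
theorem SDiag.x_mul {T : Finset (Fin N)} (hT : S.Stable T) {g : GL (Fin N) B} (hg : SDiag T g)
    {a b : Fin N} (h : a ≠ b) (ha : a ∉ T) (hb : b ∉ T) (c : B) : SDiag T (S.x a b h c * g) := by
  intro p q hpq hT'
  by_cases hp : p ∈ T
  · rw [S.x_mul_row_ne a b h c g (fun e => ha (e ▸ hp)) (fun _ e => hT.σ_notMem hb (e ▸ hp))]
    exact hg p q hpq (Or.inl hp)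
  · have hq := hT'.resolve_left hp
    rw [Units.val_mul, Matrix.mul_apply]
    refine Finset.sum_eq_zero fun k _ => ?_
    rcases eq_or_ne k q with rfl | hk
    · rw [S.x_col_ne a b h c p k (fun e => hb (e ▸ hq)) (fun _ e => hT.σ_notMem ha (e ▸ hq)),
        Matrix.one_apply_ne hpq, zero_mul]
    · rw [hg k q hk (Or.inr hq), mul_zero]

theorem SDiag.mul_x {T : Finset (Fin N)} (hT : S.Stable T) {g : GL (Fin N) B} (hg : SDiag T g)
    {a b : Fin N} (h : a ≠ b) (ha : a ∉ T) (hb : b ∉ T) (c : B) : SDiag T (g * S.x a b h c) := by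
  intro p q hpq hT'
  by_cases hq : q ∈ T
  · rw [S.mul_x_col_ne a b h c g (fun e => hb (e ▸ hq)) (fun _ e => hT.σ_notMem ha (e ▸ hq))]
    exact hg p q hpq (Or.inr hq)
  · have hp := hT'.resolve_right hq
    rw [Units.val_mul, Matrix.mul_apply]
    refine Finset.sum_eq_zero fun k _ => ?_
    rcases eq_or_ne p k with rfl | hk
    · rw [S.x_row_ne a b h c p q (fun e => ha (e ▸ hp)) (fun _ e => hT.σ_notMem hb (e ▸ hp)),
        Matrix.one_apply_ne hpq, mul_zero]
    · rw [hg p k hk (Or.inl hp), zero_mul]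

variable (S)

/-- The group generated by the root elements with index in `P` and parameter in `J`. -/
def genBy (P : Fin N → Fin N → Prop) (J : Ideal B) : Subgroup (GL (Fin N) B) :=
  Subgroup.closure {g | ∃ (a b : Fin N) (h : a ≠ b), P a b ∧ ∃ c ∈ J, g = S.x a b h c}

variable {S}

theorem x_mem_genBy {P : Fin N → Fin N → Prop} {J : Ideal B} {a b : Fin N} (h : a ≠ b)
    (hP : P a b) {c : B} (hc : c ∈ J) : S.x a b h c ∈ S.genBy P J :=
  Subgroup.subset_closure ⟨a, b, h, hP, c, hc, rfl⟩

theorem genBy_le {P : Fin N → Fin N → Prop} {J : Ideal B} {H : Subgroup (GL (Fin N) B)}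
    (hH : ∀ a b h, P a b → ∀ c ∈ J, S.x a b h c ∈ H) : S.genBy P J ≤ H := by
  rw [genBy, Subgroup.closure_le]
  rintro _ ⟨a, b, h, hP, c, hc, rfl⟩
  exact hH a b h hP c hc

theorem genBy_le_relE (P : Fin N → Fin N → Prop) (J : Ideal B) : S.genBy P J ≤ S.relE B J :=
  genBy_le fun a b h _ _ hc => S.x_mem_relE a b h hc

theorem genBy_le_relGL (P : Fin N → Fin N → Prop) (J : Ideal B) : S.genBy P J ≤ relGL N B J :=
  (genBy_le_relE P J).trans (S.relE_le_relGL J)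

theorem genBy_le_G (P : Fin N → Fin N → Prop) (J : Ideal B) : S.genBy P J ≤ S.G B :=
  genBy_le fun a b h _ _ _ => S.x_mem_G a b h _

theorem entry_mem {J : Ideal B} {g : GL (Fin N) B} (hg : g ∈ relGL N B J) {a b : Fin N}
    (h : a ≠ b) : g.1 a b ∈ J := by
  simpa [Matrix.one_apply_ne h] using mem_relGL.mp hg a b

/-- Clearing a column with a unit pivot. -/
theorem exists_clear_column {T : Finset (Fin N)} (hT : S.Stable T) {J : Ideal B}
    {g : GL (Fin N) B} (hJ : g ∈ relGL N B J) (hg : SDiag T g) {i : Fin N} (hi : i ∉ T)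
    (hu : IsUnit (g.1 i i)) {P : Fin N → Fin N → Prop} (hP : ∀ l, l ∉ T → P l i) :
    ∃ κ ∈ S.genBy P J, SDiag T (κ * g) ∧ (∀ k, k ≠ i → (κ * g).1 k i = 0) ∧
      (κ * g).1 i i = g.1 i i := by
  obtain ⟨v, hv⟩ := hu.exists_left_inv
  have key : ∀ F : Finset (Fin N), (∀ l ∈ F, l ∉ T ∧ l ≠ i ∧ l ≠ S.σ i) →
      ∃ κ ∈ S.genBy P J, SDiag T (κ * g) ∧ (∀ k ∈ F, (κ * g).1 k i = 0) ∧
      (κ * g).1 i i = g.1 i i := by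
    intro F
    induction F using Finset.induction_on with
    | empty => exact fun _ => ⟨1, one_mem _, by simpa using hg, by simp, by simp⟩
    | insert l F hlF ih =>
      intro hF
      obtain ⟨κ, hκ, h1, h2, h3⟩ := ih fun l hl => hF l (Finset.mem_insert_of_mem hl)
      obtain ⟨hlT, hli, hlσ⟩ := hF l (Finset.mem_insert_self l F)
      have hc : -((κ * g).1 l i * v) ∈ J :=
        neg_mem (J.mul_mem_right _ (entry_mem (mul_mem (genBy_le_relGL P J hκ) hJ) hli))
      refine ⟨S.x l i hli (-((κ * g).1 l i * v)) * κ,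
        mul_mem (x_mem_genBy hli (hP l hlT) hc) hκ, ?_, ?_, ?_⟩
      · rw [mul_assoc]; exact h1.x_mul hT hli hlT hi _
      · intro k hk
        rw [mul_assoc]
        rcases Finset.mem_insert.mp hk with rfl | hk
        · rw [S.x_mul_row, h3]; linear_combination -(κ * g).1 k i * hv
        · rw [S.x_mul_row_ne _ _ _ _ _ (fun e : k = l => hlF (e ▸ hk))
            (fun _ => (hF k (Finset.mem_insert_of_mem hk)).2.2)]
          exact h2 k hk
      · rw [mul_assoc, S.x_mul_row_ne _ _ _ _ _ hli.symm (fun e => e.symm), h3]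
  -- Each operation `x l i` also disturbs row `σ i`, so that row is left for the end; the last
  -- operation `x (σ i) i` disturbs no further row.
  obtain ⟨κ, hκ, h1, h2, h3⟩ := key (Finset.univ.filter fun l => l ∉ T ∧ l ≠ i ∧ l ≠ S.σ i)
    (by simp)
  have h2' : ∀ k, k ≠ i → k ≠ S.σ i → (κ * g).1 k i = 0 := by
    intro k hk hk'
    by_cases hkT : k ∈ T
    · exact h1 k i hk (Or.inl hkT)
    · exact h2 k (by simp [hkT, hk, hk'])
  by_cases hσ : S.σ i = i
  · exact ⟨κ, hκ, h1, fun k hk => h2' k hk (by rwa [hσ]), h3⟩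
  have hc : -((κ * g).1 (S.σ i) i * v) ∈ J :=
    neg_mem (J.mul_mem_right _ (entry_mem (mul_mem (genBy_le_relGL P J hκ) hJ) hσ))
  have hσT := hT.σ_notMem hi
  refine ⟨S.x (S.σ i) i hσ (-((κ * g).1 (S.σ i) i * v)) * κ,
    mul_mem (x_mem_genBy hσ (hP _ hσT) hc) hκ, ?_, ?_, ?_⟩
  · rw [mul_assoc]; exact h1.x_mul hT hσ hσT hi _
  · intro k hk
    rw [mul_assoc]
    rcases eq_or_ne k (S.σ i) with rfl | hk'
    · rw [S.x_mul_row, h3]; linear_combination -(κ * g).1 (S.σ i) i * hv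
    · rw [S.x_mul_row_ne _ _ _ _ _ hk' (fun _ => hk')]
      exact h2' k hk hk'
  · rw [mul_assoc, S.x_mul_row_ne _ _ _ _ _ (fun e => hσ e.symm) (fun e => e.symm), h3]

/-- Clearing a row with a unit pivot whose column is clear. -/
theorem exists_clear_row {T : Finset (Fin N)} (hT : S.Stable T) {J : Ideal B}
    {g : GL (Fin N) B} (hJ : g ∈ relGL N B J) (hg : SDiag T g) {i : Fin N} (hi : i ∉ T)
    (hu : IsUnit (g.1 i i)) (hcol : ∀ k, k ≠ i → g.1 k i = 0) {P : Fin N → Fin N → Prop}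
    (hP : ∀ l, l ∉ T → P i l) :
    ∃ κ ∈ S.genBy P J, SDiag T (g * κ) ∧ (∀ l, l ≠ i → (g * κ).1 i l = 0) ∧
      (∀ k, (g * κ).1 k i = g.1 k i) ∧
      (∀ k l, k ≠ i → l ≠ S.σ i → (g * κ).1 k l = g.1 k l) := by
  obtain ⟨v, hv⟩ := hu.exists_left_inv
  have key : ∀ F : Finset (Fin N), (∀ l ∈ F, l ∉ T ∧ l ≠ i ∧ l ≠ S.σ i) →
      ∃ κ ∈ S.genBy P J, SDiag T (g * κ) ∧ (∀ l ∈ F, (g * κ).1 i l = 0) ∧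
      (∀ k, (g * κ).1 k i = g.1 k i) ∧
      (∀ k l, k ≠ i → l ≠ S.σ i → (g * κ).1 k l = g.1 k l) := by
    intro F
    induction F using Finset.induction_on with
    | empty => exact fun _ => ⟨1, one_mem _, by simpa using hg, by simp, by simp, by simp⟩
    | insert l F hlF ih =>
      intro hF
      obtain ⟨κ, hκ, h1, h2, h3, h4⟩ := ih fun l hl => hF l (Finset.mem_insert_of_mem hl)
      obtain ⟨hlT, hli, hlσ⟩ := hF l (Finset.mem_insert_self l F)
      have hc : -((g * κ).1 i l * v) ∈ J :=
        neg_mem (J.mul_mem_right _ (entry_mem (mul_mem hJ (genBy_le_relGL P J hκ)) hli.symm))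
      refine ⟨κ * S.x i l hli.symm (-((g * κ).1 i l * v)),
        mul_mem hκ (x_mem_genBy hli.symm (hP l hlT) hc), ?_, ?_, ?_, ?_⟩
      · rw [← mul_assoc]; exact h1.mul_x hT hli.symm hi hlT _
      · intro k hk
        rw [← mul_assoc]
        rcases Finset.mem_insert.mp hk with rfl | hk
        · rw [S.mul_x_col, h3]; linear_combination -(g * κ).1 i k * hv
        · rw [S.mul_x_col_ne _ _ _ _ _ (fun e : k = l => hlF (e ▸ hk))
            (fun _ => (hF k (Finset.mem_insert_of_mem hk)).2.2)]
          exact h2 k hk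
      · intro k
        rw [← mul_assoc, S.mul_x_col_ne _ _ _ _ _ hli.symm (fun e => e.symm), h3]
      · intro k m hk hm
        rw [← mul_assoc]
        rcases eq_or_ne m l with rfl | hml
        -- A multiple of column `i` is added, and this column vanishes outside row `i`. So away from
        -- row `i` and column `σ i` nothing changes.
        · rw [S.mul_x_col, h3, hcol k hk, mul_zero, add_zero, h4 k m hk hm]
        · rw [S.mul_x_col_ne _ _ _ _ _ hml (fun _ => hm), h4 k m hk hm]
  obtain ⟨κ, hκ, h1, h2, h3, h4⟩ := key (Finset.univ.filter fun l => l ∉ T ∧ l ≠ i ∧ l ≠ S.σ i)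
    (by simp)
  have h2' : ∀ k, k ≠ i → k ≠ S.σ i → (g * κ).1 i k = 0 := by
    intro k hk hk'
    by_cases hkT : k ∈ T
    · exact h1 i k hk.symm (Or.inr hkT)
    · exact h2 k (by simp [hkT, hk, hk'])
  by_cases hσ : S.σ i = i
  · exact ⟨κ, hκ, h1, fun k hk => h2' k hk (by rwa [hσ]), h3, h4⟩
  have hσ' : i ≠ S.σ i := fun e => hσ e.symm
  have hc : -((g * κ).1 i (S.σ i) * v) ∈ J :=
    neg_mem (J.mul_mem_right _ (entry_mem (mul_mem hJ (genBy_le_relGL P J hκ)) hσ'))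
  have hσT := hT.σ_notMem hi
  refine ⟨κ * S.x i (S.σ i) hσ' (-((g * κ).1 i (S.σ i) * v)),
    mul_mem hκ (x_mem_genBy hσ' (hP _ hσT) hc), ?_, ?_, ?_, ?_⟩
  · rw [← mul_assoc]; exact h1.mul_x hT hσ' hi hσT _
  · intro k hk
    rw [← mul_assoc]
    rcases eq_or_ne k (S.σ i) with rfl | hk'
    · rw [S.mul_x_col, h3]; linear_combination -(g * κ).1 i (S.σ i) * hv
    · rw [S.mul_x_col_ne _ _ _ _ _ hk' (fun _ => hk')]
      exact h2' k hk hk'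
  · intro k
    rw [← mul_assoc, S.mul_x_col_ne _ _ _ _ _ hσ' (fun e => e.symm), h3]
  · intro k m hk hm
    rw [← mul_assoc, S.mul_x_col_ne _ _ _ _ _ hm (fun _ => hm), h4 k m hk hm]

theorem SDiag.insert_of_clear {T : Finset (Fin N)} {g : GL (Fin N) B}
    (hg : SDiag T g) (hG : g ∈ S.G B) {i : Fin N} (hrow : ∀ l, l ≠ i → g.1 i l = 0)
    (hcol : ∀ k, k ≠ i → g.1 k i = 0) : SDiag (insert i (insert (S.σ i) T)) g := by
  have hσ := S.G_clear hG i hrow hcol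
  intro a b hab h
  simp only [Finset.mem_insert] at h
  rcases h with (rfl | rfl | h) | (rfl | rfl | h)
  · exact hrow b hab.symm
  · exact (hσ b hab.symm).1
  · exact hg a b hab (Or.inl h)
  · exact hcol a hab
  · exact (hσ a hab).2
  · exact hg a b hab (Or.inr h)

/-- Induction over the stable sets of indices, adding the orbit of a chosen index each time. -/
theorem stable_induction {motive : Finset (Fin N) → Prop} (huniv : motive Finset.univ)
    (hstep : ∀ T, S.Stable T → T ≠ Finset.univ →
      ∃ i ∉ T, motive (insert i (insert (S.σ i) T)) → motive T) : motive ∅ := by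
  have : ∀ n, ∀ T : Finset (Fin N), S.Stable T → Tᶜ.card ≤ n → motive T := by
    intro n
    induction n with
    | zero =>
      intro T _ h
      have : T = Finset.univ := by simpa using h
      exact this ▸ huniv
    | succ n ih =>
      intro T hT h
      by_cases hTu : T = Finset.univ
      · exact hTu ▸ huniv
      obtain ⟨i, hi, hm⟩ := hstep T hT hTu
      refine hm (ih _ (hT.insert i) ?_)
      have : (insert i (insert (S.σ i) T))ᶜ ⊂ Tᶜ := by
        rw [Finset.compl_ssubset_compl]
        refine ⟨fun a ha => by simp [ha], fun h' => hi (h' (by simp))⟩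
      have := Finset.card_lt_card this
      omega
  exact this _ ∅ (fun a h => absurd h (Finset.notMem_empty _)) le_rfl

/-- The `L D U` decomposition of matrices congruent to `1` modulo an ideal in the Jacobson
radical, with respect to a weight on the indices. -/
theorem exists_ldu {J : Ideal B} (hJ : J ≤ Ideal.jacobson ⊥) (w : Fin N → ℕ) {g : GL (Fin N) B}
    (hG : g ∈ S.G B) (hg : g ∈ relGL N B J) :
    ∃ l ∈ S.genBy (fun a b => w a ≤ w b) J, ∃ d ∈ S.G B, d ∈ relGL N B J ∧
      (∀ a b, a ≠ b → d.1 a b = 0) ∧ ∃ r ∈ S.genBy (fun a b => w b ≤ w a) J, g = l * d * r := by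
  revert g
  suffices h : ∀ g : GL (Fin N) B, SDiag ∅ g → g ∈ S.G B → g ∈ relGL N B J →
    ∃ l ∈ S.genBy (fun a b => w a ≤ w b) J, ∃ d ∈ S.G B, d ∈ relGL N B J ∧
      (∀ a b, a ≠ b → d.1 a b = 0) ∧ ∃ r ∈ S.genBy (fun a b => w b ≤ w a) J, g = l * d * r from
    fun {g} hG hg => h g (fun a b _ h => by simp at h) hG hg
  refine stable_induction (S := S) (motive := fun T => ∀ g : GL (Fin N) B, SDiag T g → g ∈ S.G B →
    g ∈ relGL N B J →
    ∃ l ∈ S.genBy (fun a b => w a ≤ w b) J, ∃ d ∈ S.G B, d ∈ relGL N B J ∧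
      (∀ a b, a ≠ b → d.1 a b = 0) ∧ ∃ r ∈ S.genBy (fun a b => w b ≤ w a) J, g = l * d * r) ?_ ?_
  · exact fun g hg hG hJ => ⟨1, one_mem _, g, hG, hJ, fun a b h => hg a b h (by simp), 1,
      one_mem _, by simp⟩
  intro T hT hTu
  have hne : (Tᶜ).Nonempty := by
    rw [Finset.nonempty_iff_ne_empty, Ne, Finset.compl_eq_empty_iff]; exact hTu
  -- A pivot of maximal weight makes every column operation `x l i` eligible for the left factor and
  -- every row operation `x i l` for the right factor.
  obtain ⟨i, hi, hmax⟩ := Finset.exists_max_image _ w hne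
  rw [Finset.mem_compl] at hi
  refine ⟨i, hi, fun ih g hg hG hgJ => ?_⟩
  -- The pivot is congruent to `1` modulo an ideal inside the Jacobson radical.
  have hu : IsUnit (g.1 i i) := by
    have h1 := hJ (mem_relGL.mp hgJ i i)
    rw [Matrix.one_apply_eq, Ideal.mem_jacobson_bot] at h1
    simpa using h1 1
  obtain ⟨κ, hκ, h1, h2, h3⟩ := exists_clear_column hT hgJ hg hi hu
    (P := fun a b => w a ≤ w b) (fun l hl => hmax l (by simpa using hl))
  have hκG := mul_mem (genBy_le_G _ _ hκ) hG
  have hκJ := mul_mem (genBy_le_relGL _ _ hκ) hgJ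
  obtain ⟨ρ, hρ, h4, h5, h6, -⟩ := exists_clear_row hT hκJ h1 hi (h3 ▸ hu) h2
    (P := fun a b => w b ≤ w a) (fun l hl => hmax l (by simpa using hl))
  have hρG := mul_mem hκG (genBy_le_G _ _ hρ)
  have hρJ := mul_mem hκJ (genBy_le_relGL _ _ hρ)
  obtain ⟨l, hl, d, hd, hdJ, hd', r, hr, e⟩ := ih _
    (h4.insert_of_clear hρG h5 fun k hk => by rw [h6, h2 k hk]) hρG hρJ
  refine ⟨κ⁻¹ * l, mul_mem (inv_mem hκ) hl, d, hd, hdJ, hd', r * ρ⁻¹, mul_mem hr (inv_mem hρ), ?_⟩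
  rw [show g = κ⁻¹ * (κ * g * ρ) * ρ⁻¹ by group, e]
  group

/-- With the constant weight the LDU decomposition puts no condition on the two outer factors. -/
theorem relGL_le_relE {J : Ideal B} (hJ : J ≤ Ideal.jacobson ⊥) {g : GL (Fin N) B}
    (hG : g ∈ S.G B) (hg : g ∈ relGL N B J) : g ∈ S.relE B J := by
  obtain ⟨l, hl, d, hd, hdJ, hd', r, hr, rfl⟩ := exists_ldu hJ (fun _ => 0) hG hg
  exact mul_mem (mul_mem (genBy_le_relE _ _ hl) (S.diag_mem J hd hd' hdJ)) (genBy_le_relE _ _ hr)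

/-- Upper triangular matrices congruent to `1` modulo `J` are relative elementary. -/
theorem relE_of_triangular (pos : Fin N → ℕ) (hpos : Function.Injective pos) {J : Ideal B}
    {g : GL (Fin N) B} (hG : g ∈ S.G B) (hg : g ∈ relGL N B J) (hu : ∀ a, IsUnit (g.1 a a))
    (ht : ∀ a b, pos b < pos a → g.1 a b = 0) : g ∈ S.relE B J := by
  revert g
  suffices h : ∀ g : GL (Fin N) B, SDiag ∅ g → g ∈ S.G B → g ∈ relGL N B J →
      (∀ a ∉ (∅ : Finset (Fin N)), IsUnit (g.1 a a)) →
      (∀ a ∉ (∅ : Finset (Fin N)), ∀ b ∉ (∅ : Finset (Fin N)), pos b < pos a → g.1 a b = 0) →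
      g ∈ S.relE B J from
    fun {g} hG hg hu ht => h g (fun a b _ h => by simp at h) hG hg (fun a _ => hu a)
      fun a _ b _ => ht a b
  refine stable_induction (S := S) (motive := fun T => ∀ g : GL (Fin N) B, SDiag T g → g ∈ S.G B →
      g ∈ relGL N B J → (∀ a ∉ T, IsUnit (g.1 a a)) →
      (∀ a ∉ T, ∀ b ∉ T, pos b < pos a → g.1 a b = 0) → g ∈ S.relE B J) ?_ ?_
  · exact fun g hg hG hJ _ _ => S.diag_mem J hG (fun a b h => hg a b h (by simp)) hJ
  intro T hT hTu
  have hne : (Tᶜ).Nonempty := by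
    rw [Finset.nonempty_iff_ne_empty, Ne, Finset.compl_eq_empty_iff]; exact hTu
  -- The column of the first remaining index is already clear, so only its row must be cleared. This
  -- changes other rows in column `σ i` only, and that index leaves the process together with `i`;
  -- triangularity and unit diagonal survive on the rest.
  obtain ⟨i, hi, hmin⟩ := Finset.exists_min_image _ pos hne
  rw [Finset.mem_compl] at hi
  refine ⟨i, hi, fun ih g hg hG hgJ hu ht => ?_⟩
  have hcol : ∀ k, k ≠ i → g.1 k i = 0 := by
    intro k hk
    by_cases hkT : k ∈ T
    · exact hg k i hk (Or.inl hkT)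
    · exact ht k hkT i hi (lt_of_le_of_ne (hmin k (by simpa using hkT)) fun e => hk (hpos e).symm)
  obtain ⟨ρ, hρ, h4, h5, h6, h7⟩ := exists_clear_row hT hgJ hg hi (hu i hi) hcol
    (P := fun _ _ => True) (fun _ _ => trivial)
  have hρG := mul_mem hG (genBy_le_G _ _ hρ)
  have hρJ := mul_mem hgJ (genBy_le_relGL _ _ hρ)
  have := ih _ (h4.insert_of_clear hρG h5 fun k hk => by rw [h6, hcol k hk]) hρG hρJ
    (fun a ha => by
      simp only [Finset.mem_insert, not_or] at ha
      rw [h7 a a ha.1 ha.2.1]; exact hu a ha.2.2)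
    (fun a ha b hb hab => by
      simp only [Finset.mem_insert, not_or] at ha hb
      rw [h7 a b ha.1 hb.2.1]; exact ht a ha.2.2 b hb.2.2 hab)
  rw [show g = g * ρ * ρ⁻¹ by group]
  exact mul_mem this (inv_mem (genBy_le_relE _ _ hρ))

end ElementaryGroup

/-! ### Local rings and Euclidean domains: all matrices of the group are elementary. -/

namespace ElementaryGroup

variable {N : ℕ} {S : ElementaryGroup.{u} N} {B : Type u} [CommRing B]

theorem SDiag.genBy_mul {T : Finset (Fin N)} (hT : S.Stable T) {g κ : GL (Fin N) B}
    (hg : SDiag T g) (hκ : κ ∈ S.genBy (fun a b => a ∉ T ∧ b ∉ T) ⊤) : SDiag T (κ * g) := by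
  induction hκ using Subgroup.closure_induction_left with
  | one => simpa using hg
  | mul_left _ hx _ _ ih =>
    obtain ⟨a, b, h, ⟨ha, hb⟩, c, -, rfl⟩ := hx
    rw [mul_assoc]
    exact ih.x_mul hT h ha hb c
  | inv_mul_cancel _ hx _ _ ih =>
    obtain ⟨a, b, h, ⟨ha, hb⟩, c, -, rfl⟩ := hx
    rw [mul_assoc, ← S.x_neg]
    exact ih.x_mul hT h ha hb _

/-- If unit pivots can be created by elementary operations, then all matrices of the group are
elementary. -/
theorem G_le_E_of_pivot (hp : ∀ T, S.Stable T → ∀ i ∉ T, ∀ g ∈ S.G B, SDiag T g →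
    ∃ κ ∈ S.genBy (fun a b => a ∉ T ∧ b ∉ T) ⊤, IsUnit ((κ * g : GL (Fin N) B).1 i i)) :
    S.G B ≤ S.E B := by
  suffices h : ∀ g : GL (Fin N) B, SDiag ∅ g → g ∈ S.G B → g ∈ S.E B from
    fun g hG => h g (fun a b _ h => by simp at h) hG
  refine stable_induction (S := S) (motive := fun T => ∀ g : GL (Fin N) B, SDiag T g →
    g ∈ S.G B → g ∈ S.E B) ?_ ?_
  · exact fun g hg hG => S.relE_le_E _ (S.diag_mem ⊤ hG (fun a b h => hg a b h (by simp))
      (mem_relGL.mpr fun _ _ => trivial))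
  intro T hT hTu
  obtain ⟨i, hi⟩ : ∃ i, i ∉ T := by
    by_contra! h
    exact hTu (Finset.eq_univ_iff_forall.mpr h)
  refine ⟨i, hi, fun ih g hg hG => ?_⟩
  have htop : ∀ g : GL (Fin N) B, g ∈ relGL N B ⊤ := fun g => mem_relGL.mpr fun _ _ => trivial
  have hE : ∀ {P} {κ : GL (Fin N) B}, κ ∈ S.genBy P ⊤ → κ ∈ S.E B :=
    fun h => S.relE_le_E _ (genBy_le_relE _ _ h)
  obtain ⟨π, hπ, hu⟩ := hp T hT i hi g hG hg
  have hg' := hg.genBy_mul hT hπ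
  obtain ⟨κ, hκ, h1, h2, h3⟩ := exists_clear_column hT (htop _) hg' hi hu
    (P := fun _ _ => True) (fun _ _ => trivial)
  obtain ⟨ρ, hρ, h4, h5, h6, -⟩ := exists_clear_row hT (htop _) h1 hi (h3 ▸ hu) h2
    (P := fun _ _ => True) (fun _ _ => trivial)
  have hρG : κ * (π * g) * ρ ∈ S.G B :=
    mul_mem (mul_mem (genBy_le_G _ _ hκ) (mul_mem (genBy_le_G _ _ hπ) hG)) (genBy_le_G _ _ hρ)
  have := ih _ (h4.insert_of_clear hρG h5 fun k hk => by rw [h6, h2 k hk]) hρG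
  rw [show g = π⁻¹ * κ⁻¹ * (κ * (π * g) * ρ) * ρ⁻¹ by group]
  exact mul_mem (mul_mem (mul_mem (inv_mem (hE hπ)) (inv_mem (hE hκ))) this) (inv_mem (hE hρ))

theorem sum_inv_mul (g : GL (Fin N) B) (i : Fin N) :
    ∑ k, g⁻¹.1 i k * g.1 k i = 1 := by
  rw [← Matrix.mul_apply, ← Units.val_mul, inv_mul_cancel]
  simp

theorem exists_pivot_of_unit {T : Finset (Fin N)} {i j : Fin N} (hi : i ∉ T) (hj : j ∉ T)
    {g : GL (Fin N) B} (hu : IsUnit (g.1 j i)) :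
    ∃ κ ∈ S.genBy (fun a b => a ∉ T ∧ b ∉ T) ⊤, IsUnit ((κ * g : GL (Fin N) B).1 i i) := by
  rcases eq_or_ne i j with rfl | h
  · exact ⟨1, one_mem _, by simpa using hu⟩
  obtain ⟨v, hv⟩ := hu.exists_left_inv
  refine ⟨S.x i j h ((1 - g.1 i i) * v), x_mem_genBy h ⟨hi, hj⟩ trivial, ?_⟩
  rw [S.x_mul_row, show g.1 i i + (1 - g.1 i i) * v * g.1 j i = 1 by
    linear_combination (1 - g.1 i i) * hv]
  exact isUnit_one

/-- The column of an invertible matrix is unimodular, so over a local ring it contains a unit. That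
unit is not in a row of `T`, where the column vanishes, and can be moved to the diagonal. -/
theorem G_le_E_of_isLocalRing [IsLocalRing B] : S.G B ≤ S.E B := by
  refine G_le_E_of_pivot fun T hT i hi g _ hg => ?_
  obtain ⟨j, hj⟩ : ∃ j, IsUnit (g.1 j i) := by
    by_contra! h
    have h1 : (1 : B) ∈ IsLocalRing.maximalIdeal B := by
      rw [← sum_inv_mul g i]
      exact Ideal.sum_mem _ fun k _ => Ideal.mul_mem_left _ _ (h k)
    exact (Ideal.ne_top_iff_one _).mp (IsLocalRing.maximalIdeal.isMaximal B).ne_top h1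
  refine exists_pivot_of_unit hi (fun hjT => ?_) hj
  rw [hg j i (fun e => hi (e ▸ hjT)) (Or.inl hjT)] at hj
  exact not_isUnit_zero hj

/-- Among all nonzero entries that operations outside `T` can produce in column `i`, a minimal one
divides every entry of its column, since a remainder would be smaller. The column is unimodular, so
this entry is a unit. -/
theorem G_le_E_of_euclideanDomain {B : Type u} [EuclideanDomain B] : S.G B ≤ S.E B := by
  refine G_le_E_of_pivot fun T hT i hi g _ hg => ?_
  let H : Subgroup (GL (Fin N) B) := S.genBy (fun a b => a ∉ T ∧ b ∉ T) ⊤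
  let V : Set B := {p | p ≠ 0 ∧ ∃ κ ∈ H, ∃ j ∉ T, p = (κ * g).1 j i}
  have hzero : ∀ κ ∈ H, ∀ k ∈ T, (κ * g).1 k i = 0 := fun κ hκ k hk =>
    hg.genBy_mul hT hκ k i (fun e => hi (e ▸ hk)) (Or.inl hk)
  have hV : V.Nonempty := by
    by_contra! h
    have h1 : ∀ k, g.1 k i = 0 := by
      intro k
      by_cases hk : k ∈ T
      · simpa using hzero 1 (one_mem _) k hk
      · by_contra h0
        have : g.1 k i ∈ V := ⟨h0, 1, one_mem _, k, hk, by simp⟩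
        simp [h] at this
    have := sum_inv_mul g i
    simp [h1] at this
  obtain ⟨p, ⟨hp0, κ, hκ, j, hj, hp⟩, hmin⟩ :=
    (EuclideanDomain.r_wellFounded (R := B)).has_min V hV
  have hdvd : ∀ l, p ∣ (κ * g).1 l i := by
    intro l
    by_cases hl : l ∈ T
    · rw [hzero κ hκ l hl]; exact dvd_zero p
    rcases eq_or_ne l j with rfl | hlj
    · exact hp ▸ dvd_rfl
    set q := (κ * g).1 l i
    by_contra hdvd
    have hmod : q % p ≠ 0 := fun h => hdvd (EuclideanDomain.mod_eq_zero.mp h)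
    refine hmin (q % p) ⟨hmod, S.x l j hlj (-(q / p)) * κ,
      mul_mem (x_mem_genBy hlj ⟨hl, hj⟩ trivial) hκ, l, hl, ?_⟩ (EuclideanDomain.mod_lt q hp0)
    rw [mul_assoc, S.x_mul_row, ← hp]
    linear_combination EuclideanDomain.div_add_mod q p
  have hu : IsUnit ((κ * g).1 j i) := by
    rw [← hp]
    refine isUnit_of_dvd_one ?_
    rw [← sum_inv_mul (κ * g) i]
    exact Finset.dvd_sum fun k _ => (hdvd k).mul_left _
  obtain ⟨κ', hκ', h⟩ := exists_pivot_of_unit (S := S) hi hj hu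
  exact ⟨κ' * κ, mul_mem hκ' hκ, by rwa [mul_assoc]⟩

end ElementaryGroup

/-! ### Triangular and monomial matrices, Bruhat decomposition modulo an ideal. -/

section Triangular

variable {N : ℕ} {B : Type*} [CommRing B]

/-- Upper triangular matrices with respect to the order of the indices given by `pos`. -/
def UpperTri (pos : Fin N → ℕ) (M : Matrix (Fin N) (Fin N) B) : Prop :=
  ∀ a b, pos b < pos a → M a b = 0

/-- Upper unitriangular matrices with respect to the order of the indices given by `pos`. -/
def Unitri (pos : Fin N → ℕ) (M : Matrix (Fin N) (Fin N) B) : Prop :=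
  UpperTri pos M ∧ ∀ a, M a a = 1

/-- Monomial matrices with unit entries. -/
def IsMonomial (π : Equiv.Perm (Fin N)) (v : Fin N → Bˣ) (M : Matrix (Fin N) (Fin N) B) : Prop :=
  ∀ a b, M a b = if a = π b then (v b : B) else 0

variable {pos : Fin N → ℕ} {M M' : Matrix (Fin N) (Fin N) B}

theorem UpperTri.mul (h : UpperTri pos M) (h' : UpperTri pos M') : UpperTri pos (M * M') := by
  intro a b hab
  rw [Matrix.mul_apply]
  refine Finset.sum_eq_zero fun k _ => ?_
  rcases lt_or_ge (pos k) (pos a) with hk | hk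
  · rw [h a k hk, zero_mul]
  · rw [h' k b (by omega), mul_zero]

theorem UpperTri.mul_diag (hpos : Function.Injective pos) (h : UpperTri pos M)
    (h' : UpperTri pos M') (a : Fin N) : (M * M') a a = M a a * M' a a := by
  rw [Matrix.mul_apply]
  refine Finset.sum_eq_single a (fun k _ hk => ?_) (by simp)
  rcases lt_or_ge (pos k) (pos a) with hk' | hk'
  · rw [h a k hk', zero_mul]
  · rw [h' k a (lt_of_le_of_ne hk' fun e => hk (hpos e).symm), mul_zero]

theorem Unitri.mul (hpos : Function.Injective pos) (h : Unitri pos M) (h' : Unitri pos M') :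
    Unitri pos (M * M') :=
  ⟨h.1.mul h'.1, fun a => by rw [h.1.mul_diag hpos h'.1, h.2, h'.2, one_mul]⟩

/-- No index lies strictly between adjacent positions, so the coordinate of a simple root is a
homomorphism to the additive group. -/
theorem Unitri.mul_adjacent (hpos : Function.Injective pos) (h : Unitri pos M)
    (h' : Unitri pos M') {a b : Fin N} (hab : pos b = pos a + 1) :
    (M * M') a b = M a b + M' a b := by
  have hne : a ≠ b := fun e => by rw [e] at hab; omega
  rw [Matrix.mul_apply, ← Finset.sum_subset (Finset.subset_univ {a, b}),
    Finset.sum_pair hne, h.2, h'.2, one_mul, mul_one, add_comm]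
  intro k _ hk
  simp only [Finset.mem_insert, Finset.mem_singleton, not_or] at hk
  rcases lt_or_ge (pos k) (pos a) with hk' | hk'
  · rw [h.1 a k hk', zero_mul]
  · have h1 : pos a ≠ pos k := fun e => hk.1 (hpos e).symm
    have h2 : pos b ≠ pos k := fun e => hk.2 (hpos e).symm
    rw [h'.1 k b (by omega), mul_zero]

theorem unitri_one : Unitri pos (1 : Matrix (Fin N) (Fin N) B) :=
  ⟨fun a b h => Matrix.one_apply_ne fun e => by rw [e] at h; omega, fun a => Matrix.one_apply_eq a⟩

theorem isMonomial_one : IsMonomial 1 (fun _ => 1) (1 : Matrix (Fin N) (Fin N) B) := fun a b => by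
  rw [Matrix.one_apply, Equiv.Perm.one_apply, Units.val_one]

theorem IsMonomial.mul {π π' : Equiv.Perm (Fin N)} {v v' : Fin N → Bˣ} (h : IsMonomial π v M)
    (h' : IsMonomial π' v' M') : IsMonomial (π * π') (fun b => v (π' b) * v' b) (M * M') := by
  intro a b
  rw [Matrix.mul_apply, Finset.sum_eq_single (π' b)]
  · rw [h a, h', if_pos rfl, ite_mul, zero_mul, ← Units.val_mul]
    rfl
  · intro k _ hk
    rw [h' k b, if_neg hk, mul_zero]
  · simp

end Triangular

/-- The representative of the reflection in the Weyl group which is attached to a root. -/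
def RootElements.weylElement {N : ℕ} (S : RootElements.{u} N) {B : Type u} [CommRing B]
    (a b : Fin N) (h : a ≠ b) (c : Bˣ) : GL (Fin N) B :=
  S.x a b h (-((c⁻¹ : Bˣ) : B)) * S.x b a h.symm (c : B) * S.x a b h (-((c⁻¹ : Bˣ) : B))

/-- The data of a Bruhat decomposition: an ordering of the indices for which the root elements with
adjacent indices behave like simple root elements. -/
structure BruhatData {N : ℕ} (S : ElementaryGroup.{u} N) where
  pos : Fin N → ℕ
  pos_injective : Function.Injective pos
  x_unitri : ∀ {B : Type u} [CommRing B] (a b : Fin N) (h : a ≠ b) (c : B), pos a < pos b →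
    Unitri pos (S.x a b h c).1
  -- The unitriangular matrices with trivial coordinate at a simple root form the unipotent radical
  -- of a minimal parabolic, which the opposite root group normalizes.
  conj_unitri : ∀ {B : Type u} [CommRing B] (a b : Fin N) (h : b ≠ a) (c : B) (g : GL (Fin N) B),
    pos b = pos a + 1 → g ∈ S.G B → Unitri pos g.1 → g.1 a b = 0 →
    Unitri pos (S.x b a h c * g * S.x b a h (-c)).1 ∧
      (S.x b a h c * g * S.x b a h (-c)).1 a b = 0
  weyl : ∀ {B : Type u} [CommRing B] (a b : Fin N) (h : a ≠ b) (c : Bˣ), pos b = pos a + 1 →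
    ∃ π v, IsMonomial π v (S.weylElement a b h c).1 ∧ π a = b ∧ π b = a
  monomial_mul_x : ∀ {B : Type u} [CommRing B] {n : GL (Fin N) B} {π : Equiv.Perm (Fin N)}
    {v : Fin N → Bˣ}, n ∈ S.G B → IsMonomial π v n.1 → ∀ (a b : Fin N) (h : a ≠ b) (c : B),
    n * S.x a b h c = S.x (π a) (π b) (π.injective.ne h) (((v a * (v b)⁻¹ : Bˣ) : B) * c) * n
  E_le : ∀ {B : Type u} [CommRing B], S.E B ≤ Subgroup.closure
    {g | ∃ (a b : Fin N) (h : a ≠ b) (c : B), (pos b = pos a + 1 ∨ pos a = pos b + 1) ∧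
      g = S.x a b h c}

namespace BruhatData

variable {N : ℕ} {S : ElementaryGroup.{u} N} (D : BruhatData S) {B : Type u} [CommRing B]

/-- The elementary unitriangular matrices. -/
def U (B : Type u) [CommRing B] : Subgroup (GL (Fin N) B) where
  carrier := {g | g ∈ S.E B ∧ Unitri D.pos g.1 ∧ Unitri D.pos g⁻¹.1}
  one_mem' := ⟨one_mem _, unitri_one, by simpa using unitri_one⟩
  mul_mem' := fun h h' => ⟨mul_mem h.1 h'.1, h.2.1.mul D.pos_injective h'.2.1, by
    rw [mul_inv_rev]; exact h'.2.2.mul D.pos_injective h.2.2⟩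
  inv_mem' := fun h => ⟨inv_mem h.1, h.2.2, by simpa using h.2.1⟩

theorem x_mem_U {a b : Fin N} (h : a ≠ b) (c : B) (hab : D.pos a < D.pos b) :
    S.x a b h c ∈ D.U B :=
  ⟨S.x_mem_E a b h c, D.x_unitri a b h c hab, by
    rw [← S.x_neg]; exact D.x_unitri a b h _ hab⟩

/-- Together with `conj_y_mem_U` this shows that the representative of a simple reflection
normalizes the unitriangular matrices with trivial coordinate at that root. -/
theorem conj_x_mem_U {a b : Fin N} (h : a ≠ b) (hab : D.pos b = D.pos a + 1) (c : B)
    {g : GL (Fin N) B} (hg : g ∈ D.U B) (h0 : g.1 a b = 0) :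
    S.x a b h c * g * (S.x a b h c)⁻¹ ∈ D.U B ∧
      (S.x a b h c * g * (S.x a b h c)⁻¹).1 a b = 0 := by
  have hx := D.x_mem_U h c (by omega)
  refine ⟨mul_mem (mul_mem hx hg) (inv_mem hx), ?_⟩
  have h1 := (mul_mem hx hg).2.1
  have h2 := (Unitri.mul_adjacent D.pos_injective hx.2.1 hx.2.2 hab).symm
  rw [← Units.val_mul, mul_inv_cancel, Units.val_one, Matrix.one_apply_ne h] at h2
  rw [Units.val_mul, Unitri.mul_adjacent D.pos_injective h1 hx.2.2 hab, Units.val_mul,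
    Unitri.mul_adjacent D.pos_injective hx.2.1 hg.2.1 hab, h0]
  linear_combination h2

theorem conj_y_mem_U {a b : Fin N} (h : b ≠ a) (hab : D.pos b = D.pos a + 1) (c : B)
    {g : GL (Fin N) B} (hg : g ∈ D.U B) (h0 : g.1 a b = 0) :
    S.x b a h c * g * (S.x b a h c)⁻¹ ∈ D.U B ∧
      (S.x b a h c * g * (S.x b a h c)⁻¹).1 a b = 0 := by
  have hi : g⁻¹.1 a b = 0 := by
    have h2 := (Unitri.mul_adjacent D.pos_injective hg.2.1 hg.2.2 hab)
    rw [← Units.val_mul, mul_inv_cancel, Units.val_one, Matrix.one_apply_ne h.symm, h0] at h2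
    linear_combination -h2
  have h1 := D.conj_unitri a b h c g hab (S.E_le_G hg.1) hg.2.1 h0
  have h2 := D.conj_unitri a b h c g⁻¹ hab (inv_mem (S.E_le_G hg.1)) hg.2.2 hi
  rw [S.x_neg] at h1 h2
  refine ⟨⟨mul_mem (mul_mem (S.x_mem_E _ _ _ _) hg.1) (inv_mem (S.x_mem_E _ _ _ _)), h1.1, ?_⟩,
    h1.2⟩
  simpa [mul_assoc] using h2.1

/-- The products `κ u n v` with `κ` relative elementary, `n` monomial, `u` and `v`
unitriangular. -/
def cell (J : Ideal B) : Set (GL (Fin N) B) :=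
  {g | ∃ κ ∈ S.relE B J, ∃ u ∈ D.U B, ∃ n ∈ S.E B, ∃ π v, IsMonomial π v n.1 ∧
    ∃ u' ∈ D.U B, g = κ * u * n * u'}

variable {D} {J : Ideal B} {g : GL (Fin N) B}

theorem relE_mul_mem_cell {κ : GL (Fin N) B} (hκ : κ ∈ S.relE B J) (hg : g ∈ D.cell J) :
    κ * g ∈ D.cell J := by
  obtain ⟨κ', hκ', u, hu, n, hn, π, v, hm, u', hu', rfl⟩ := hg
  exact ⟨κ * κ', mul_mem hκ hκ', u, hu, n, hn, π, v, hm, u', hu', by simp only [mul_assoc]⟩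

theorem U_mul_mem_cell {x : GL (Fin N) B} (hx : x ∈ D.U B) (hg : g ∈ D.cell J) :
    x * g ∈ D.cell J := by
  obtain ⟨κ', hκ', u, hu, n, hn, π, v, hm, u', hu', rfl⟩ := hg
  exact ⟨x * κ' * x⁻¹, S.relE_conj hx.1 hκ', x * u, mul_mem hx hu, n, hn, π, v, hm, u', hu',
    by group⟩

/-- The exchange argument of a BN-pair. Write `u = u₁ x(d)` with `u₁` trivial at the simple root, so
that `w` normalizes past `u₁`. If `d ∈ J`, the factor `x(d)` is absorbed in the relative group.
Otherwise `d` may be replaced by a unit `e`. Either `x(e)` passes through `n` into the right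
unitriangular factor, or `w x(e) w⁻¹` is an opposite root element, which is rewritten as `x w' x`;
the surplus factor then passes through `w` and `n`. -/
theorem weyl_mul_mem_cell (hJ : ∀ c : B, c ∈ J ∨ ∃ e : Bˣ, c - e ∈ J)
    {a b : Fin N} (h : a ≠ b) (hab : D.pos b = D.pos a + 1) (c : Bˣ) {u n u' : GL (Fin N) B}
    (hu : u ∈ D.U B) (hn : n ∈ S.E B) {π : Equiv.Perm (Fin N)} {v : Fin N → Bˣ}
    (hm : IsMonomial π v n.1) (hu' : u' ∈ D.U B) :
    S.weylElement a b h c * (u * n * u') ∈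
      D.cell J := by
  have hxE : ∀ a b h (c : B), S.x a b h c ∈ S.E B := S.x_mem_E
  have hWE : ∀ c : Bˣ, S.weylElement a b h c ∈
      S.E B := fun c => mul_mem (mul_mem (hxE _ _ _ _) (hxE _ _ _ _)) (hxE _ _ _ _)
  have hW : ∀ c : Bˣ, ∃ π v, IsMonomial π v (S.weylElement a b h c).1 ∧ π a = b ∧ π b = a :=
    fun c => D.weyl a b h c hab
  have hconj : ∀ u ∈ D.U B, u.1 a b = 0 →
      S.weylElement a b h c * u *
      (S.weylElement a b h c)⁻¹ ∈ D.U B := by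
    intro u hu h0
    obtain ⟨h1, h1'⟩ := D.conj_x_mem_U h hab (-((c⁻¹ : Bˣ) : B)) hu h0
    obtain ⟨h2, h2'⟩ := D.conj_y_mem_U h.symm hab (c : B) h1 h1'
    obtain ⟨h3, h3'⟩ := D.conj_x_mem_U h hab (-((c⁻¹ : Bˣ) : B)) h2 h2'
    simpa [RootElements.weylElement, mul_assoc] using h3
  -- split off the coordinate of the simple root
  obtain ⟨d, u₁, hu₁, h0, rfl⟩ : ∃ d, ∃ u₁ ∈ D.U B, u₁.1 a b = 0 ∧ u = u₁ * S.x a b h d := by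
    have hx : S.x a b h (-(u.1 a b)) ∈ D.U B := D.x_mem_U h _ (by omega)
    refine ⟨u.1 a b, u * S.x a b h (-(u.1 a b)), mul_mem hu hx, ?_, ?_⟩
    · rw [S.mul_x_col, hu.2.1.2]; ring
    · rw [S.x_neg]; group
  obtain ⟨ρ, r, hr, hρa, hρb⟩ := hW c
  have hwE := hWE c
  generalize S.weylElement a b h c = w at *
  have hwx : ∀ e : B, w * S.x a b h e = S.x b a h.symm (((r a * (r b)⁻¹ : Bˣ) : B) * e) * w := by
    intro e
    have := D.monomial_mul_x (S.E_le_G hwE) hr a b h e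
    simp only [hρa, hρb] at this
    exact this
  have hwy : ∀ e : B, w * S.x b a h.symm e = S.x a b h (((r b * (r a)⁻¹ : Bˣ) : B) * e) * w := by
    intro e
    have := D.monomial_mul_x (S.E_le_G hwE) hr b a h.symm e
    simp only [hρa, hρb] at this
    exact this
  suffices hs : w * (S.x a b h d * n * u') ∈ D.cell J by
    have := U_mul_mem_cell (hconj u₁ hu₁ h0) hs
    rwa [show w * u₁ * w⁻¹ * (w * (S.x a b h d * n * u')) = w * (u₁ * S.x a b h d * n * u') by
      group] at this
  -- The parameter matters only modulo `J`, because the relative group is normalized by `w`.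
  have hmul : ∀ {j e : B}, j ∈ J → w * (S.x a b h e * n * u') ∈ D.cell J →
      w * (S.x a b h (j + e) * n * u') ∈ D.cell J := by
    intro j e hj he
    have := relE_mul_mem_cell (S.conj_mem_relE hwE a b h hj) he
    rwa [show w * S.x a b h j * w⁻¹ * (w * (S.x a b h e * n * u')) =
      w * (S.x a b h (j + e) * n * u') by rw [S.x_add]; group] at this
  have hnx : ∀ (a b : Fin N) (h : a ≠ b) (e : B), D.pos (π.symm a) < D.pos (π.symm b) →
      ∃ x ∈ D.U B, S.x a b h e * n = n * x := by
    intro a b h e hlt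
    refine ⟨S.x (π.symm a) (π.symm b) (π.symm.injective.ne h)
      (((v (π.symm b) * (v (π.symm a))⁻¹ : Bˣ) : B) * e), D.x_mem_U _ _ hlt, ?_⟩
    rw [D.monomial_mul_x (S.E_le_G hn) hm]
    simp only [Equiv.apply_symm_apply]
    rw [← mul_assoc, ← Units.val_mul]
    simp
  have hmono := hr.mul hm
  have hcell : ∀ x ∈ D.U B, w * n * (x * u') ∈ D.cell J := fun x hx =>
    ⟨1, one_mem _, 1, one_mem _, w * n, mul_mem hwE hn, _, _, hmono, x * u', mul_mem hx hu', by
      group⟩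
  rcases hJ d with hd | ⟨e, hd⟩
  · have := hmul (e := (0 : B)) hd (by simpa [S.x_zero, mul_assoc] using hcell 1 (one_mem _))
    rwa [add_zero] at this
  suffices hs : w * (S.x a b h (e : B) * n * u') ∈ D.cell J by
    have := hmul hd hs
    rwa [sub_add_cancel] at this
  have hne : D.pos (π.symm a) ≠ D.pos (π.symm b) :=
    D.pos_injective.ne (π.symm.injective.ne h)
  rcases lt_or_gt_of_ne hne with hlt | hlt
  · obtain ⟨x, hx, hxn⟩ := hnx a b h (e : B) hlt
    rw [hxn]
    simpa only [mul_assoc] using hcell x hx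
  -- By the choice of `e'`, `w x_{ab}(e) = x_{ba}(e') w`. Here `π⁻¹` reverses the order of `a` and
  -- `b`, so root elements at `(b, a)` pass through `n` into the upper unitriangular matrices.
  · let e' : Bˣ := r a * (r b)⁻¹ * e
    obtain ⟨x, hx, hxn⟩ := hnx b a h.symm ((r a * (r b)⁻¹ * e'⁻¹ : Bˣ) : B) hlt
    obtain ⟨ρ', r', hr', -, -⟩ := hW e'
    have hw'E := hWE e'
    obtain ⟨w', hw'⟩ : ∃ w', w' = S.weylElement a b h e' := ⟨_, rfl⟩
    rw [← hw'] at hr' hw'E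
    have hy : S.x b a h.symm (e' : B) = S.x a b h ((e'⁻¹ : Bˣ) : B) * w' * S.x a b h ((e'⁻¹ : Bˣ) : B) := by
      rw [hw', RootElements.weylElement, S.x_neg]; group
    have h3 : S.x a b h ((e'⁻¹ : Bˣ) : B) * w =
        w * S.x b a h.symm ((r a * (r b)⁻¹ * e'⁻¹ : Bˣ) : B) := by
      rw [hwy, ← Units.val_mul, show r b * (r a)⁻¹ * (r a * (r b)⁻¹ * e'⁻¹) = e'⁻¹ by group]
    have h4 : w * (S.x a b h (e : B) * n * u') =
        S.x a b h ((e'⁻¹ : Bˣ) : B) * (w' * w * n * (x * u')) := by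
      calc w * (S.x a b h (e : B) * n * u') = (w * S.x a b h (e : B)) * n * u' := by group
        _ = S.x b a h.symm (e' : B) * w * n * u' := by rw [hwx]; rfl
        _ = S.x a b h ((e'⁻¹ : Bˣ) : B) * w' * (S.x a b h ((e'⁻¹ : Bˣ) : B) * w) * n * u' := by
            rw [hy]; group
        _ = S.x a b h ((e'⁻¹ : Bˣ) : B) * w' * w *
            (S.x b a h.symm ((r a * (r b)⁻¹ * e'⁻¹ : Bˣ) : B) * n) * u' := by rw [h3]; group
        _ = _ := by rw [hxn]; group
    rw [h4]
    refine U_mul_mem_cell (D.x_mem_U h _ (by omega)) ⟨1, one_mem _, 1, one_mem _, w' * w * n,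
      mul_mem (mul_mem hw'E hwE) hn, _, _, (hr'.mul hr).mul hm, x * u', mul_mem hx hu', by group⟩

/-- A parameter in `J` is absorbed; for a unit `e` the opposite root element equals `x(e⁻¹) w
x(e⁻¹)`, which reduces to left multiplication by `w`. -/
theorem y_mul_mem_cell (hJ : ∀ c : B, c ∈ J ∨ ∃ e : Bˣ, c - e ∈ J)
    {a b : Fin N} (h : b ≠ a) (hab : D.pos b = D.pos a + 1) (c : B) (hg : g ∈ D.cell J) :
    S.x b a h c * g ∈ D.cell J := by
  rcases hJ c with hc | ⟨e, hc⟩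
  · exact relE_mul_mem_cell (S.x_mem_relE b a h hc) hg
  rw [show c = c - e + e by ring, S.x_add, mul_assoc]
  refine relE_mul_mem_cell (S.x_mem_relE b a h hc) ?_
  obtain ⟨κ, hκ, u, hu, n, hn, π, v, hm, u', hu', rfl⟩ := hg
  have hx : S.x a b h.symm ((e⁻¹ : Bˣ) : B) ∈ D.U B := D.x_mem_U _ _ (by omega)
  have key := relE_mul_mem_cell (S.relE_conj (S.x_mem_E b a h (e : B)) hκ)
    (U_mul_mem_cell hx (weyl_mul_mem_cell hJ h.symm hab e (mul_mem hx hu) hn hm hu'))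
  convert key using 1
  rw [RootElements.weylElement, S.x_neg]
  group

theorem E_subset_cell (hJ : ∀ c : B, c ∈ J ∨ ∃ e : Bˣ, c - e ∈ J) (hg : g ∈ S.E B) :
    g ∈ D.cell J := by
  have hx : ∀ (a b : Fin N) (h : a ≠ b) (c : B), (D.pos b = D.pos a + 1 ∨ D.pos a = D.pos b + 1) →
      ∀ g ∈ D.cell J, S.x a b h c * g ∈ D.cell J := by
    rintro a b h c (hab | hab) g hg
    · exact U_mul_mem_cell (D.x_mem_U h c (by omega)) hg
    · exact y_mul_mem_cell hJ h hab c hg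
  replace hg := D.E_le hg
  induction hg using Subgroup.closure_induction_left with
  | one => exact ⟨1, one_mem _, 1, one_mem _, 1, one_mem _, 1, _, isMonomial_one, 1, one_mem _,
      by simp⟩
  | mul_left _ hx' _ _ ih =>
    obtain ⟨a, b, h, c, hab, rfl⟩ := hx'
    exact hx a b h c hab _ ih
  | inv_mul_cancel _ hx' _ _ ih =>
    obtain ⟨a, b, h, c, hab, rfl⟩ := hx'
    rw [← S.x_neg]
    exact hx a b h _ hab _ ih

/-- If every element outside `J` is congruent to a unit, then the elementary
matrices congruent to `1` modulo `J` are relative elementary. -/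
theorem E_inf_relGL_le (D : BruhatData S) (hJ : ∀ c : B, c ∈ J ∨ ∃ e : Bˣ, c - e ∈ J) :
    S.E B ⊓ relGL N B J ≤ S.relE B J := by
  rintro g ⟨hgE, hgJ⟩
  by_cases hJt : J = ⊤
  · rw [hJt, S.relE_top]; exact hgE
  obtain ⟨κ, hκ, u, hu, n, hn, π, v, hm, u', hu', rfl⟩ := E_subset_cell (D := D) hJ hgE
  -- Modulo the proper ideal `J` the monomial factor is a product of unitriangular matrices, so its
  -- diagonal entries are `1` there; a moved index would give a zero.
  have hπ : ∀ j, π j = j := by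
    intro j
    by_contra hj
    have h1 : (u * n * u') ∈ relGL N B J := by
      have := mul_mem (inv_mem (S.relE_le_relGL J hκ)) hgJ
      convert this using 1
      group
    have h2 : Matrix.GeneralLinearGroup.map (Ideal.Quotient.mk J) n =
        Matrix.GeneralLinearGroup.map (Ideal.Quotient.mk J) (u⁻¹ * u'⁻¹) := by
      rw [relGL, MonoidHom.mem_ker, map_mul, map_mul] at h1
      rw [map_mul, map_inv, map_inv, eq_inv_mul_iff_mul_eq, eq_inv_iff_mul_eq_one, h1]
    have h3 := congrArg (fun g : GL (Fin N) (B ⧸ J) => g.1 j j) h2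
    simp only [Matrix.GeneralLinearGroup.map_apply] at h3
    change Ideal.Quotient.mk J (n.1 j j) = Ideal.Quotient.mk J ((u⁻¹ * u'⁻¹).1 j j) at h3
    rw [hm, if_neg (fun e => hj e.symm), (mul_mem (inv_mem hu) (inv_mem hu')).2.1.2 j, map_zero,
      map_one] at h3
    exact hJt ((Ideal.eq_top_iff_one J).mpr (Ideal.Quotient.eq_zero_iff_mem.mp (by simpa using h3.symm)))
  have hnt : UpperTri D.pos n.1 := by
    intro a b hab
    rw [hm, hπ, if_neg]
    rintro rfl
    omega
  rw [mul_assoc, mul_assoc] at hgJ hgE ⊢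
  have hκJ := S.relE_le_relGL J hκ
  -- With a diagonal `n`, the product `u n u'` is upper triangular with unit diagonal, and it is
  -- congruent to `1` since both `κ` and the whole product are.
  refine mul_mem hκ (ElementaryGroup.relE_of_triangular D.pos D.pos_injective
    (S.E_le_G (mul_mem hu.1 (mul_mem hn hu'.1))) ((Subgroup.mul_mem_cancel_left _ hκJ).mp hgJ)
    (fun a => ?_) (hu.2.1.1.mul (hnt.mul hu'.2.1.1)))
  rw [Units.val_mul, Units.val_mul, hu.2.1.1.mul_diag D.pos_injective (hnt.mul hu'.2.1.1),
    hnt.mul_diag D.pos_injective hu'.2.1.1, hu.2.1.2, hu'.2.1.2, one_mul, mul_one, hm, hπ, if_pos rfl]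
  exact (v a).isUnit

end BruhatData

/-! ### Elementary systems and the splitting over two charts. -/

/-- The diagonal matrix with entry `t` at the indices where `w` is true, and `1` elsewhere. -/
def tau {N : ℕ} {B : Type*} [CommRing B] (w : Fin N → Bool) (t : Bˣ) : GL (Fin N) B where
  val := Matrix.diagonal fun a => if w a then (t : B) else 1
  inv := Matrix.diagonal fun a => if w a then ((t⁻¹ : Bˣ) : B) else 1
  val_inv := by
    rw [Matrix.diagonal_mul_diagonal, ← Matrix.diagonal_one]
    congr 1; ext a; split_ifs <;> simp
  inv_val := by
    rw [Matrix.diagonal_mul_diagonal, ← Matrix.diagonal_one]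
    congr 1; ext a; split_ifs <;> simp

/-- The entries of `tau w t` as units. -/
def tauUnit {N : ℕ} {B : Type*} [CommRing B] (w : Fin N → Bool) (t : Bˣ) (a : Fin N) : Bˣ :=
  if w a then t else 1

/-- Every element of `L` becomes the image of an element of `R` after multiplication with
an element of `M`. -/
def HasDenominators {R L : Type*} [CommRing R] [CommRing L] (φ : R →+* L) (M : Submonoid R) :
    Prop :=
  ∀ l, ∃ s ∈ M, ∃ r, φ r = φ s * l

/-- A natural group of matrices with root elements for which the theory of the elementary subgroup
works over polynomial rings. -/
structure ElementarySystem (N : ℕ) extends ElementaryGroup.{u} N where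
  -- With `s = T` and `y = c Tⁿ` this is the passage from the exponents 0, 1, n, n + 1 to n + 2.
  -- Both signs of a parameter are asked for because `H` is only a submonoid.
  sq_mul_mem : ∀ {B : Type u} [CommRing B] (H : Submonoid (GL (Fin N) B)) (s y : B),
    (∀ z, z = 1 ∨ z = s ∨ z = y ∨ z = s * y →
      ∀ a b h, x a b h z ∈ H ∧ x a b h (-z) ∈ H) → ∀ a b h, x a b h (s ^ 2 * y) ∈ H
  W : Set (Fin N → Bool)
  W_compl : ∀ w ∈ W, (fun a => !w a) ∈ W
  W_sep : ∀ a b, a ≠ b → ∃ w ∈ W, w a = true ∧ w b = false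
  tau_conj_mem_G : ∀ {B : Type u} [CommRing B] (w : Fin N → Bool) (t : Bˣ) (g : GL (Fin N) B),
    w ∈ W → g ∈ G B → tau w t * g * (tau w t)⁻¹ ∈ G B
  tau_conj_x : ∀ {B : Type u} [CommRing B] (w : Fin N → Bool) (t : Bˣ) (a b : Fin N) (h : a ≠ b)
    (c : B), w ∈ W → tau w t * x a b h c * (tau w t)⁻¹ =
      x a b h (((tauUnit w t a * (tauUnit w t b)⁻¹ : Bˣ) : B) * c)
  -- The factor `X` in the parameter absorbs the `t⁻¹` that conjugation with `tau w t` creates, so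
  -- the entries stay polynomial.
  tau_conj_mem_E : ∀ {P L : Type u} [CommRing P] [CommRing L] (w : Fin N → Bool) (φ : P →+* L)
    (X : P) (t : Lˣ) (γ : GL (Fin N) P) (a b : Fin N) (h : a ≠ b) (p : P), w ∈ W → φ X = t →
    γ ∈ toRootElements.E P →
    tau w t * Matrix.GeneralLinearGroup.map φ (γ * x a b h (X * p) * γ⁻¹) * (tau w t)⁻¹ ∈
      (toRootElements.E P).map (Matrix.GeneralLinearGroup.map φ)
  -- Conjugation by a fixed matrix is undone by a denominator `s` that depends neither on the
  -- parameter `r` nor on the ideal `J`.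
  exists_conj_mem : ∀ {R L : Type u} [CommRing R] [CommRing L] (φ : R →+* L) (M : Submonoid R)
    (γ : GL (Fin N) L) (a b : Fin N) (h : a ≠ b), HasDenominators φ M →
    γ ∈ toRootElements.E L → ∃ s ∈ M, ∀ (J : Ideal R), ∀ r ∈ J,
      γ * x a b h (φ (s * r)) * γ⁻¹ ∈
        (toRootElements.relE R J).map (Matrix.GeneralLinearGroup.map φ)
  E_inf_relGL_le : ∀ {B : Type u} [CommRing B] (J : Ideal B),
    (∀ c : B, c ∈ J ∨ ∃ e : Bˣ, c - e ∈ J) →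
    toRootElements.E B ⊓ relGL N B J ≤ toRootElements.relE B J

namespace ElementarySystem

variable {N : ℕ} (S : ElementarySystem.{u} N)

theorem map_mem_map {B C : Type*} [CommRing B] [CommRing C] {φ : B →+* C}
    {H : Subgroup (GL (Fin N) B)} {g : GL (Fin N) B} (hg : g ∈ H) :
    Matrix.GeneralLinearGroup.map φ g ∈ H.map (Matrix.GeneralLinearGroup.map φ) :=
  ⟨g, hg, rfl⟩

/-- Elementary matrices over an intersection of two open sets split. -/
theorem exists_split {R₁ R₂ C : Type u} [CommRing R₁] [CommRing R₂] [CommRing C] (φ₁ : R₁ →+* C)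
    (φ₂ : R₂ →+* C) {M₁ : Submonoid R₁} {M₂ : Submonoid R₂} (h₁ : HasDenominators φ₁ M₁)
    (h₂ : HasDenominators φ₂ M₂) (J₁ : Ideal R₁) (J₂ : Ideal R₂) (J : Ideal C)
    (hJ : ∀ a ∈ J, ∀ s ∈ M₁, ∀ t ∈ M₂, ∃ r₁ ∈ J₁, ∃ r₂ ∈ J₂, a = φ₁ (s * r₁) + φ₂ (t * r₂))
    {g : GL (Fin N) C} (hg : g ∈ S.relE C J) :
    ∃ g₁ ∈ S.relE R₁ J₁, ∃ g₂ ∈ S.relE R₂ J₂,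
      g = Matrix.GeneralLinearGroup.map φ₁ g₁ * Matrix.GeneralLinearGroup.map φ₂ g₂ := by
  have key : ∀ (g : GL (Fin N) C) (γ : GL (Fin N) C), γ ∈ S.E C → ∀ a b (h : a ≠ b), ∀ c ∈ J,
      (∃ g₁ ∈ S.relE R₁ J₁, ∃ g₂ ∈ S.relE R₂ J₂,
        g = Matrix.GeneralLinearGroup.map φ₁ g₁ * Matrix.GeneralLinearGroup.map φ₂ g₂) →
      ∃ g₁ ∈ S.relE R₁ J₁, ∃ g₂ ∈ S.relE R₂ J₂, g * (γ * S.x a b h c * γ⁻¹) =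
        Matrix.GeneralLinearGroup.map φ₁ g₁ * Matrix.GeneralLinearGroup.map φ₂ g₂ := by
    rintro _ γ hγ a b h c hc ⟨g₁, hg₁, g₂, hg₂, rfl⟩
    -- With `x = x₁x₂` according to the two charts, `g₁g₂·γxγ⁻¹ = g₁·(g₂γ)x₁(g₂γ)⁻¹·g₂·γx₂γ⁻¹`.
    -- Hence the first denominator is taken for the conjugating matrix `g₂γ`, the second for `γ`.
    have hγ' := mul_mem (S.map_mem_E φ₂ (S.relE_le_E _ hg₂)) hγ
    obtain ⟨s, hs, hs'⟩ := S.exists_conj_mem φ₁ M₁ _ a b h h₁ hγ'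
    obtain ⟨t, ht, ht'⟩ := S.exists_conj_mem φ₂ M₂ γ a b h h₂ hγ
    obtain ⟨r₁, hr₁, r₂, hr₂, rfl⟩ := hJ c hc s hs t ht
    obtain ⟨k₁, hk₁, e₁⟩ := hs' J₁ r₁ hr₁
    obtain ⟨k₂, hk₂, e₂⟩ := ht' J₂ r₂ hr₂
    refine ⟨g₁ * k₁, mul_mem hg₁ hk₁, g₂ * k₂, mul_mem hg₂ hk₂, ?_⟩
    rw [S.x_add, (Matrix.GeneralLinearGroup.map φ₁).map_mul,
      (Matrix.GeneralLinearGroup.map φ₂).map_mul, e₁, e₂]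
    group
  induction hg using Subgroup.closure_induction_right with
  | one => exact ⟨1, one_mem _, 1, one_mem _, by simp⟩
  | mul_right g hg _ hx ih =>
    obtain ⟨γ, hγ, a, b, h, c, hc, rfl⟩ := hx
    exact key g γ hγ a b h c hc ih
  | mul_inv_cancel g hg _ hx ih =>
    obtain ⟨γ, hγ, a, b, h, c, hc, rfl⟩ := hx
    have := key g γ hγ a b h (-c) (neg_mem hc) ih
    rwa [S.x_neg, show γ * (S.x a b h c)⁻¹ * γ⁻¹ = (γ * S.x a b h c * γ⁻¹)⁻¹ by group] at this

end ElementarySystem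

/-! ### Laurent polynomials. -/

section Laurent

open LaurentPolynomial

variable {A A' : Type*} [CommRing A] [CommRing A']

/-- The variable of the Laurent polynomial ring as a unit. -/
noncomputable def Tunit (A : Type*) [CommRing A] : A[T;T⁻¹]ˣ where
  val := T 1
  inv := T (-1)
  val_inv := by rw [← T_add]; simp
  inv_val := by rw [← T_add]; simp

/-- The homomorphism `A[X] → A[T;T⁻¹]` with `X ↦ T⁻¹`. -/
noncomputable def toLaurentInv (A : Type*) [CommRing A] : A[X] →+* A[T;T⁻¹] :=
  Polynomial.eval₂RingHom C (T (-1))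

/-- The homomorphism of Laurent polynomial rings induced by a homomorphism of the coefficients. -/
noncomputable def laurentMap (f : A →+* A') : A[T;T⁻¹] →+* A'[T;T⁻¹] :=
  eval₂ ((C : A' →+* A'[T;T⁻¹]).comp f) (Tunit A')

theorem toLaurentInv_C (a : A) : toLaurentInv A (Polynomial.C a) = C a := by
  simp [toLaurentInv]

theorem toLaurentInv_X : toLaurentInv A Polynomial.X = T (-1) := by
  simp [toLaurentInv]

theorem toLaurentInv_eq (p : A[X]) : toLaurentInv A p = invert (Polynomial.toLaurent p) := by
  have : toLaurentInv A =
      ((invert : A[T;T⁻¹] ≃ₐ[A] A[T;T⁻¹]) : A[T;T⁻¹] →+* A[T;T⁻¹]).comp Polynomial.toLaurent := by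
    refine Polynomial.ringHom_ext (fun a => ?_) ?_
    · simp [toLaurentInv_C]
    · simp [toLaurentInv_X]
  rw [this]
  rfl

theorem toLaurentInv_injective : Function.Injective (toLaurentInv A) := fun p q h => by
  rw [toLaurentInv_eq, toLaurentInv_eq] at h
  exact Polynomial.toLaurent_injective ((invert (R := A)).injective h)

theorem laurentMap_T (f : A →+* A') (n : ℤ) : laurentMap f (T n) = T n := by
  rw [laurentMap, eval₂_T]
  have : ∀ n : ℤ, ((Tunit A' ^ n : A'[T;T⁻¹]ˣ) : A'[T;T⁻¹]) = T n := by
    intro n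
    rcases n.eq_nat_or_neg with ⟨k, rfl | rfl⟩
    · rw [zpow_natCast, Units.val_pow_eq_pow_val]
      change (T 1) ^ k = _
      rw [T_pow]; simp
    · rw [zpow_neg, zpow_natCast, ← inv_pow, Units.val_pow_eq_pow_val]
      change (T (-1)) ^ k = _
      rw [T_pow]; simp
  exact this n

theorem laurentMap_C (f : A →+* A') (a : A) : laurentMap f (C a) = C (f a) := by
  simp [laurentMap]

theorem laurentMap_toLaurent (f : A →+* A') (p : A[X]) :
    laurentMap f (Polynomial.toLaurent p) = Polynomial.toLaurent (p.map f) := by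
  have : (laurentMap f).comp Polynomial.toLaurent =
      Polynomial.toLaurent.comp (Polynomial.mapRingHom f) := by
    refine Polynomial.ringHom_ext (fun a => ?_) ?_
    · simp [laurentMap_C]
    · simp [laurentMap_T]
  exact congrArg (fun g : A[X] →+* A'[T;T⁻¹] => g p) this

/-- Every Laurent polynomial is the sum of a polynomial in `T` and one in `T⁻¹`. -/
theorem exists_add_eq (l : A[T;T⁻¹]) :
    ∃ p q : A[X], l = Polynomial.toLaurent p + toLaurentInv A q := by
  induction l using LaurentPolynomial.induction_on' with
  | add p q hp hq =>
    obtain ⟨p₁, p₂, rfl⟩ := hp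
    obtain ⟨q₁, q₂, rfl⟩ := hq
    exact ⟨p₁ + q₁, p₂ + q₂, by rw [map_add, map_add]; ring⟩
  | C_mul_T n a =>
    rcases n.eq_nat_or_neg with ⟨k, rfl | rfl⟩
    · exact ⟨Polynomial.C a * Polynomial.X ^ k, 0, by simp⟩
    · refine ⟨0, Polynomial.C a * Polynomial.X ^ k, ?_⟩
      rw [map_mul, map_pow, toLaurentInv_C, toLaurentInv_X, T_pow]
      simp

theorem exists_add_eq_of_mem_map {J : Ideal A} {l : A[T;T⁻¹]} (hl : l ∈ J.map C) :
    ∃ p ∈ polyIdeal J, ∃ q ∈ polyIdeal J, l = Polynomial.toLaurent p + toLaurentInv A q := by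
  induction hl using Submodule.closure_induction with
  | zero => exact ⟨0, zero_mem _, 0, zero_mem _, by simp⟩
  | add _ _ _ _ ih ih' =>
    obtain ⟨p, hp, q, hq, rfl⟩ := ih
    obtain ⟨p', hp', q', hq', rfl⟩ := ih'
    exact ⟨p + p', add_mem hp hp', q + q', add_mem hq hq', by rw [map_add, map_add]; ring⟩
  | smul_mem r _ h =>
    obtain ⟨a, ha, rfl⟩ := h
    obtain ⟨p, q, rfl⟩ := exists_add_eq r
    refine ⟨p * Polynomial.C a, Ideal.mul_mem_left _ _ (Ideal.mem_map_of_mem _ ha),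
      q * Polynomial.C a, Ideal.mul_mem_left _ _ (Ideal.mem_map_of_mem _ ha), ?_⟩
    rw [smul_eq_mul, add_mul, map_mul, map_mul, toLaurentInv_C, Polynomial.toLaurent_C]

end Laurent

/-! ### The double of a ring along an ideal. -/

section DoubleRing

variable {A : Type*} [CommRing A]

/-- The subring of pairs in `A × A` which are congruent modulo `J`. -/
def doubleRing (J : Ideal A) : Subring (A × A) where
  carrier := {p | p.2 - p.1 ∈ J}
  one_mem' := by simp
  zero_mem' := by simp
  add_mem' {p q} hp hq := by
    have := J.add_mem hp hq
    change p.2 + q.2 - (p.1 + q.1) ∈ J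
    convert this using 1; ring
  neg_mem' {p} hp := by
    have := J.neg_mem hp
    change -p.2 - -p.1 ∈ J
    convert this using 1; ring
  mul_mem' {p q} hp hq := by
    have := J.add_mem (J.mul_mem_left p.2 hq) (J.mul_mem_left q.1 hp)
    change p.2 * q.2 - p.1 * q.1 ∈ J
    convert this using 1; ring

namespace doubleRing

variable (J : Ideal A)

/-- The first projection of the double ring. -/
def fst : doubleRing J →+* A := (RingHom.fst A A).comp (doubleRing J).subtype

/-- The second projection of the double ring. -/
def snd : doubleRing J →+* A := (RingHom.snd A A).comp (doubleRing J).subtype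

/-- The diagonal of the double ring. -/
def diag : A →+* doubleRing J :=
  ((RingHom.id A).prod (RingHom.id A)).codRestrict _ fun a => by
    change a - a ∈ J
    simp

variable {J}

theorem snd_sub_fst_mem (e : doubleRing J) : snd J e - fst J e ∈ J := e.2

theorem snd_comp_diag : (snd J).comp (diag J) = RingHom.id A := rfl

theorem fst_comp_diag : (fst J).comp (diag J) = RingHom.id A := rfl

theorem ext {e e' : doubleRing J} (h₁ : fst J e = fst J e') (h₂ : snd J e = snd J e') : e = e' :=
  Subtype.ext (Prod.ext h₁ h₂)

theorem exists_lift {c : A} (hc : c ∈ J) : ∃ e, fst J e = 0 ∧ snd J e = c :=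
  ⟨⟨(0, c), by change c - 0 ∈ J; simpa using hc⟩, rfl, rfl⟩

theorem poly_ext {e e' : (doubleRing J)[X]} (h₁ : e.map (fst J) = e'.map (fst J))
    (h₂ : e.map (snd J) = e'.map (snd J)) : e = e' := by
  ext n : 1
  have h₁ := congrArg (fun p => p.coeff n) h₁
  have h₂ := congrArg (fun p => p.coeff n) h₂
  simp only [Polynomial.coeff_map] at h₁ h₂
  exact ext h₁ h₂

theorem map_snd_sub_map_fst_mem (e : (doubleRing J)[X]) :
    e.map (snd J) - e.map (fst J) ∈ polyIdeal J := by
  rw [Ideal.mem_map_C_iff]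
  intro n
  rw [Polynomial.coeff_sub, Polynomial.coeff_map, Polynomial.coeff_map]
  exact snd_sub_fst_mem _

theorem exists_poly_lift {c : A[X]} (hc : c ∈ polyIdeal J) :
    ∃ e : (doubleRing J)[X], e.map (fst J) = 0 ∧ e.map (snd J) = c := by
  induction hc using Submodule.closure_induction with
  | zero => exact ⟨0, by simp, by simp⟩
  | add _ _ _ _ ih ih' =>
    obtain ⟨e, h₁, h₂⟩ := ih
    obtain ⟨e', h₁', h₂'⟩ := ih'
    exact ⟨e + e', by simp [h₁, h₁'], by simp [h₂, h₂']⟩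
  | smul_mem r _ h =>
    obtain ⟨a, ha, rfl⟩ := h
    obtain ⟨e, h₁, h₂⟩ := exists_lift ha
    refine ⟨r.map (diag J) * Polynomial.C e, ?_, ?_⟩
    · rw [Polynomial.map_mul, Polynomial.map_C, h₁]; simp
    · rw [Polynomial.map_mul, Polynomial.map_C, h₂, Polynomial.map_map, snd_comp_diag]; simp

end doubleRing

end DoubleRing

/-! ### Diagonal conjugation and lifting of invertible matrices. -/

open Matrix (GeneralLinearGroup)
open scoped LaurentPolynomial

theorem tau_conj_apply {N : ℕ} {B : Type*} [CommRing B] (w : Fin N → Bool) (t : Bˣ)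
    (g : GL (Fin N) B) (a b : Fin N) : (tau w t * g * (tau w t)⁻¹).1 a b =
      (tauUnit w t a : B) * g.1 a b * ((tauUnit w t b)⁻¹ : Bˣ) := by
  have h : ((tau w t)⁻¹ : GL (Fin N) B).1 =
      Matrix.diagonal fun a => if w a then ((t⁻¹ : Bˣ) : B) else 1 := rfl
  rw [Units.val_mul, Units.val_mul, h, Matrix.mul_diagonal]
  change (Matrix.diagonal (fun a => if w a then (t : B) else 1) * g.1) a b * _ = _
  rw [Matrix.diagonal_mul]
  unfold tauUnit
  split_ifs <;> simp

/-- `tau w t` and `tau (!w) t` multiply to the scalar matrix `t`, which is central. -/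
theorem tau_inv_conj {N : ℕ} {B : Type*} [CommRing B] (w : Fin N → Bool) (t : Bˣ)
    (g : GL (Fin N) B) : (tau w t)⁻¹ * g * tau w t =
      tau (fun a => !w a) t * g * (tau (fun a => !w a) t)⁻¹ := by
  have e : (tau w t)⁻¹ = tau w t⁻¹ := rfl
  have e' : tau w t = (tau w t⁻¹)⁻¹ := by rw [← e, inv_inv]
  rw [e, e']
  ext a b
  rw [tau_conj_apply, tau_conj_apply]
  have key : ∀ (x y : Bool) (z : B),
      ((if x then t⁻¹ else 1 : Bˣ) : B) * z * ((if y then t⁻¹ else 1 : Bˣ)⁻¹ : Bˣ) =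
      ((if !x then t else 1 : Bˣ) : B) * z * ((if !y then t else 1 : Bˣ)⁻¹ : Bˣ) := by
    intro x y z
    cases x <;> cases y <;> simp <;>
      first | (rw [mul_right_comm]; simp) | exact mul_comm _ _
  exact key _ _ _

theorem map_tau {N : ℕ} {B C : Type*} [CommRing B] [CommRing C] (f : B →+* C) (w : Fin N → Bool)
    (t : Bˣ) : GeneralLinearGroup.map f (tau w t) = tau w (Units.map (f : B →* C) t) := by
  ext a b
  rw [GeneralLinearGroup.map_apply]
  change f (Matrix.diagonal _ a b) = Matrix.diagonal _ a b
  rw [Matrix.diagonal_apply, Matrix.diagonal_apply]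
  split_ifs <;> simp

/-- A matrix over a larger ring lifts if its entries and those of its inverse do. -/
theorem exists_lift_GL {N : ℕ} {B C : Type*} [CommRing B] [CommRing C] {φ : B →+* C}
    (hφ : Function.Injective φ) {g : GL (Fin N) C} (h₁ : ∀ a b, ∃ c, φ c = g.1 a b)
    (h₂ : ∀ a b, ∃ c, φ c = (g⁻¹).1 a b) :
    ∃ g' : GL (Fin N) B, GeneralLinearGroup.map φ g' = g := by
  choose M hM using h₁
  choose M' hM' using h₂
  have e : φ.mapMatrix (Matrix.of M) = g.1 := by ext a b; exact hM a b
  have e' : φ.mapMatrix (Matrix.of M') = (g⁻¹).1 := by ext a b; exact hM' a b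
  have hinj : Function.Injective (φ.mapMatrix : Matrix (Fin N) (Fin N) B →+* _) :=
    fun X Y h => Matrix.map_injective hφ h
  refine ⟨⟨Matrix.of M, Matrix.of M', hinj ?_, hinj ?_⟩, ?_⟩
  · rw [map_mul, e, e', map_one, ← Units.val_mul, mul_inv_cancel, Units.val_one]
  · rw [map_mul, e, e', map_one, ← Units.val_mul, inv_mul_cancel, Units.val_one]
  · exact Units.ext e

theorem GL_ext_of_jointly_injective {N : ℕ} {B C D : Type*} [CommRing B] [CommRing C] [CommRing D]
    {φ : B →+* C} {ψ : B →+* D} (h : ∀ b b', φ b = φ b' → ψ b = ψ b' → b = b') {g g' : GL (Fin N) B}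
    (h₁ : GeneralLinearGroup.map φ g = GeneralLinearGroup.map φ g')
    (h₂ : GeneralLinearGroup.map ψ g = GeneralLinearGroup.map ψ g') : g = g' := by
  ext a b
  exact h _ _ (congrArg (fun k : GL (Fin N) C => k.1 a b) h₁)
    (congrArg (fun k : GL (Fin N) D => k.1 a b) h₂)

theorem map_map_GL {N : ℕ} {B C D : Type*} [CommRing B] [CommRing C] [CommRing D]
    (φ : B →+* C) (ψ : C →+* D) (g : GL (Fin N) B) :
    GeneralLinearGroup.map ψ (GeneralLinearGroup.map φ g) =
      GeneralLinearGroup.map (ψ.comp φ) g := rfl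

/-! ### Factorization of relative elementary matrices over Laurent polynomials. -/

namespace ElementarySystem

variable {N : ℕ} (S : ElementarySystem.{u} N) {A : Type u} [CommRing A] (J : Ideal A)

/-- Substituting `0` for the variable, as an endomorphism of the polynomial ring. -/
noncomputable def evalZero (A : Type*) [CommRing A] : A[X] →+* A[X] :=
  Polynomial.C.comp (Polynomial.evalRingHom 0)

theorem X_dvd_sub_evalZero (p : A[X]) : Polynomial.X ∣ p - evalZero A p := by
  rw [Polynomial.X_dvd_iff]
  simp [evalZero, Polynomial.coeff_zero_eq_eval_zero]

/-- The image of the relative elementary group of polynomials in `T`. -/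
noncomputable def posPart : Subgroup (GL (Fin N) A[T;T⁻¹]) :=
  (S.relE A[X] (polyIdeal J)).map (GeneralLinearGroup.map Polynomial.toLaurent)

/-- The image of the congruence subgroup of polynomials in `T⁻¹`. -/
noncomputable def negPart : Subgroup (GL (Fin N) A[T;T⁻¹]) :=
  (S.G A[X] ⊓ relGL N A[X] (polyIdeal J)).map (GeneralLinearGroup.map (toLaurentInv A))

/-- Conjugation with the diagonal matrix `tau w T`. -/
noncomputable def twist (w : Fin N → Bool) : GL (Fin N) A[T;T⁻¹] →* GL (Fin N) A[T;T⁻¹] :=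
  (MulAut.conj (tau w (Tunit A))).toMonoidHom

theorem twist_apply (w : Fin N → Bool) (g : GL (Fin N) A[T;T⁻¹]) :
    twist w g = tau w (Tunit A) * g * (tau w (Tunit A))⁻¹ := rfl

theorem twist_twist_compl (w : Fin N → Bool) (g : GL (Fin N) A[T;T⁻¹]) :
    twist (fun a => !w a) (twist w g) = g := by
  rw [twist_apply (fun a => !w a), ← tau_inv_conj, twist_apply]
  group

variable {J}

/-- By excision an elementary matrix with value `1` at `X = 0` is a product of conjugates of root
elements with parameter divisible by `X`, and each of these stays elementary over the polynomials
after the twist. -/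
theorem twist_elementary {B : Type u} [CommRing B] {w : Fin N → Bool} (hw : w ∈ S.W)
    {d : GL (Fin N) B[X]} (hd : d ∈ S.E B[X])
    (h0 : GeneralLinearGroup.map (evalZero B) d = 1) :
    ∃ d' ∈ S.E B[X], GeneralLinearGroup.map Polynomial.toLaurent d' =
      twist w (GeneralLinearGroup.map Polynomial.toLaurent d) := by
  have h1 : d ∈ S.relE B[X] (Ideal.span {Polynomial.X}) := by
    have := S.excision (p₁ := evalZero B) (p₂ := RingHom.id _) (J := Ideal.span {Polynomial.X})
      (fun e => Ideal.mem_span_singleton.mpr (X_dvd_sub_evalZero e)) hd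
    rw [h0] at this
    simpa using this
  have h2 : S.relE B[X] (Ideal.span {Polynomial.X}) ≤
      ((S.E B[X]).map (GeneralLinearGroup.map Polynomial.toLaurent)).comap
        ((twist w).comp (GeneralLinearGroup.map Polynomial.toLaurent)) := by
    rw [RootElements.relE, Subgroup.closure_le]
    rintro _ ⟨γ, hγ, a, b, h, c, hc, rfl⟩
    obtain ⟨p, rfl⟩ := Ideal.mem_span_singleton.mp hc
    exact S.tau_conj_mem_E w Polynomial.toLaurent Polynomial.X (Tunit B) γ a b h p hw (by
      rw [Polynomial.toLaurent_X]; rfl) hγ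
  obtain ⟨d', hd', e⟩ := h2 h1
  exact ⟨d', hd', e⟩

theorem map_evalZero_comm {B C : Type*} [CommRing B] [CommRing C] (f : B →+* C)
    (g : GL (Fin N) B[X]) :
    GeneralLinearGroup.map (Polynomial.mapRingHom f) (GeneralLinearGroup.map (evalZero B) g) =
      GeneralLinearGroup.map (evalZero C) (GeneralLinearGroup.map (Polynomial.mapRingHom f) g) := by
  ext a b : 2
  simp [evalZero]

theorem map_laurentMap_twist {B C : Type u} [CommRing B] [CommRing C] (f : B →+* C)
    (w : Fin N → Bool) (g : GL (Fin N) B[T;T⁻¹]) :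
    GeneralLinearGroup.map (laurentMap f) (twist w g) =
      twist w (GeneralLinearGroup.map (laurentMap f) g) := by
  rw [twist_apply, twist_apply, map_mul, map_mul, map_inv, map_tau]
  have : Units.map (laurentMap f : B[T;T⁻¹] →* C[T;T⁻¹]) (Tunit B) = Tunit C :=
    Units.ext (laurentMap_T f 1)
  rw [this]

theorem map_laurentMap_map_toLaurent {B C : Type u} [CommRing B] [CommRing C] (f : B →+* C)
    (g : GL (Fin N) B[X]) : GeneralLinearGroup.map (laurentMap f)
      (GeneralLinearGroup.map Polynomial.toLaurent g) =
      GeneralLinearGroup.map Polynomial.toLaurent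
        (GeneralLinearGroup.map (Polynomial.mapRingHom f) g) := by
  ext a b : 2
  simp only [GeneralLinearGroup.map_apply]
  exact laurentMap_toLaurent f _

/-- The relative case follows from the absolute one over the double of `A` along `J`: `k` lifts to
an elementary matrix with first component `1`, whose twist is elementary over the double. -/
theorem twist_posPart {w : Fin N → Bool} (hw : w ∈ S.W) {k : GL (Fin N) A[X]}
    (hk : k ∈ S.relE A[X] (polyIdeal J)) (h0 : GeneralLinearGroup.map (evalZero A) k = 1) :
    twist w (GeneralLinearGroup.map Polynomial.toLaurent k) ∈ S.posPart J := by
  obtain ⟨d, hd, h1, h2⟩ := S.exists_lift_relE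
    (p₁ := Polynomial.mapRingHom (doubleRing.fst J)) (p₂ := Polynomial.mapRingHom (doubleRing.snd J))
    (s := Polynomial.mapRingHom (doubleRing.diag J)) (by
      rw [Polynomial.mapRingHom_comp, doubleRing.snd_comp_diag, Polynomial.mapRingHom_id])
    (fun c hc => doubleRing.exists_poly_lift hc) hk
  have hd0 : GeneralLinearGroup.map (evalZero (doubleRing J)) d = 1 := by
    refine GL_ext_of_jointly_injective (φ := Polynomial.mapRingHom (doubleRing.fst J))
      (ψ := Polynomial.mapRingHom (doubleRing.snd J)) (fun _ _ => doubleRing.poly_ext) ?_ ?_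
    · rw [map_evalZero_comm, h1, map_one, map_one]
    · rw [map_evalZero_comm, h2, h0, map_one]
  obtain ⟨d', hd', e⟩ := S.twist_elementary hw hd hd0
  refine ⟨GeneralLinearGroup.map (Polynomial.mapRingHom (doubleRing.snd J)) d', ?_, ?_⟩
  -- The twist of the trivial first component is trivial, so excision makes the second component
  -- relative elementary.
  · have h3 : GeneralLinearGroup.map (Polynomial.mapRingHom (doubleRing.fst J)) d' = 1 := by
      apply glMap_injective Polynomial.toLaurent_injective
      rw [← map_laurentMap_map_toLaurent, e, map_laurentMap_twist, map_laurentMap_map_toLaurent, h1]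
      simp
    have := S.excision (p₁ := Polynomial.mapRingHom (doubleRing.fst J))
      (p₂ := Polynomial.mapRingHom (doubleRing.snd J)) (J := polyIdeal J)
      (fun e => doubleRing.map_snd_sub_map_fst_mem e) hd'
    rw [h3] at this
    simpa using this
  · rw [← map_laurentMap_map_toLaurent, e, map_laurentMap_twist, map_laurentMap_map_toLaurent, h2]

/-- The condition on `(a, b)` excludes `w a = false`, `w b = true`, so the twist multiplies the
parameter by `1` or `T`. For the opposite condition in `twist_genBy_neg` the factor is `1` or `T⁻¹`.
-/
theorem twist_genBy_pos {w : Fin N → Bool} (hw : w ∈ S.W) {l : GL (Fin N) A}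
    (hl : l ∈ S.genBy (fun a b => (if w a then 0 else 1) ≤ if w b then 0 else 1) J) :
    twist w (GeneralLinearGroup.map LaurentPolynomial.C l) ∈ S.posPart J := by
  have : S.genBy (fun a b => (if w a then 0 else 1) ≤ if w b then 0 else 1) J ≤
      (S.posPart J).comap ((twist w).comp (GeneralLinearGroup.map LaurentPolynomial.C)) := by
    refine ElementaryGroup.genBy_le fun a b h hab c hc => ?_
    change twist w (GeneralLinearGroup.map LaurentPolynomial.C (S.x a b h c)) ∈ S.posPart J
    rw [S.x_map, twist_apply, S.tau_conj_x w _ a b h _ hw]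
    have : ∃ p : A[X], Polynomial.toLaurent p =
        ((tauUnit w (Tunit A) a * (tauUnit w (Tunit A) b)⁻¹ : A[T;T⁻¹]ˣ) : A[T;T⁻¹]) := by
      unfold tauUnit
      cases ha : w a <;> cases hb : w b <;> simp [ha, hb] at hab ⊢
      · exact ⟨1, map_one _⟩
      · exact ⟨Polynomial.X, Polynomial.toLaurent_X⟩
      · exact ⟨1, map_one _⟩
    obtain ⟨p, hp⟩ := this
    rw [← hp, ← Polynomial.toLaurent_C, ← map_mul, ← S.x_map]
    exact map_mem_map (S.x_mem_relE a b h (Ideal.mul_mem_left _ _ (Ideal.mem_map_of_mem _ hc)))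
  exact this hl

theorem x_mem_negPart (a b : Fin N) (h : a ≠ b) {c : A[X]} (hc : c ∈ polyIdeal J) :
    S.x a b h (toLaurentInv A c) ∈ S.negPart J := by
  rw [← S.x_map]
  exact map_mem_map ⟨S.x_mem_G a b h c, S.relE_le_relGL _ (S.x_mem_relE a b h hc)⟩

theorem twist_genBy_neg {w : Fin N → Bool} (hw : w ∈ S.W) {r : GL (Fin N) A}
    (hr : r ∈ S.genBy (fun a b => (if w b then 0 else 1) ≤ if w a then 0 else 1) J) :
    twist w (GeneralLinearGroup.map LaurentPolynomial.C r) ∈ S.negPart J := by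
  have : S.genBy (fun a b => (if w b then 0 else 1) ≤ if w a then 0 else 1) J ≤
      (S.negPart J).comap ((twist w).comp (GeneralLinearGroup.map LaurentPolynomial.C)) := by
    refine ElementaryGroup.genBy_le fun a b h hab c hc => ?_
    change twist w (GeneralLinearGroup.map LaurentPolynomial.C (S.x a b h c)) ∈ S.negPart J
    rw [S.x_map, twist_apply, S.tau_conj_x w _ a b h _ hw]
    have : ∃ p : A[X], toLaurentInv A p =
        ((tauUnit w (Tunit A) a * (tauUnit w (Tunit A) b)⁻¹ : A[T;T⁻¹]ˣ) : A[T;T⁻¹]) := by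
      unfold tauUnit
      cases ha : w a <;> cases hb : w b <;> simp [ha, hb] at hab ⊢
      · exact ⟨1, map_one _⟩
      · exact ⟨Polynomial.X, toLaurentInv_X⟩
      · exact ⟨1, map_one _⟩
    obtain ⟨p, hp⟩ := this
    rw [← hp, ← toLaurentInv_C, ← map_mul]
    exact S.x_mem_negPart a b h (Ideal.mul_mem_left _ _ (Ideal.mem_map_of_mem _ hc))
  exact this hr

theorem map_C_mem_relGL {g : GL (Fin N) A} (hg : g ∈ relGL N A J) :
    GeneralLinearGroup.map Polynomial.C g ∈ relGL N A[X] (polyIdeal J) := by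
  rw [mem_relGL] at hg ⊢
  intro a b
  have := Ideal.mem_map_of_mem (Polynomial.C : A →+* A[X]) (hg a b)
  rw [map_sub] at this
  simpa [Matrix.one_apply] using this

theorem map_C_eq_toLaurent (g : GL (Fin N) A) :
    GeneralLinearGroup.map LaurentPolynomial.C g =
      GeneralLinearGroup.map Polynomial.toLaurent (GeneralLinearGroup.map Polynomial.C g) := by
  ext a b : 2
  simp

theorem map_C_eq_toLaurentInv (g : GL (Fin N) A) :
    GeneralLinearGroup.map LaurentPolynomial.C g =
      GeneralLinearGroup.map (toLaurentInv A) (GeneralLinearGroup.map Polynomial.C g) := by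
  ext a b : 2
  simp [toLaurentInv_C]

theorem map_C_mem_negPart {g : GL (Fin N) A} (hG : g ∈ S.G A) (hg : g ∈ relGL N A J) :
    GeneralLinearGroup.map LaurentPolynomial.C g ∈ S.negPart J := by
  rw [map_C_eq_toLaurentInv]
  exact map_mem_map ⟨S.map_mem_G _ hG, map_C_mem_relGL hg⟩

theorem map_C_mem_posPart (hJ : J ≤ Ideal.jacobson ⊥) {g : GL (Fin N) A} (hG : g ∈ S.G A)
    (hg : g ∈ relGL N A J) : GeneralLinearGroup.map LaurentPolynomial.C g ∈ S.posPart J := by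
  rw [map_C_eq_toLaurent]
  exact map_mem_map (S.map_mem_relE _ (fun c hc => Ideal.mem_map_of_mem _ hc)
    (ElementaryGroup.relGL_le_relE hJ hG hg))

/-- The products of a polynomial matrix in `T` and one in `T⁻¹`. -/
def products : Set (GL (Fin N) A[T;T⁻¹]) :=
  {z | ∃ k ∈ S.posPart J, ∃ h ∈ S.negPart J, z = k * h}

theorem posPart_mul_mem {k z : GL (Fin N) A[T;T⁻¹]} (hk : k ∈ S.posPart J)
    (hz : z ∈ S.products (J := J)) : k * z ∈ S.products (J := J) := by
  obtain ⟨k', hk', h, hh, rfl⟩ := hz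
  exact ⟨_, mul_mem hk hk', h, hh, (mul_assoc _ _ _).symm⟩

theorem mul_negPart_mem {h z : GL (Fin N) A[T;T⁻¹]} (hh : h ∈ S.negPart J)
    (hz : z ∈ S.products (J := J)) : z * h ∈ S.products (J := J) := by
  obtain ⟨k, hk, h', hh', rfl⟩ := hz
  exact ⟨k, hk, _, mul_mem hh' hh, mul_assoc _ _ _⟩

/-- In the LDU decomposition weighted by `w`, the twist sends the left factor to polynomials in `T`
and the right factor to polynomials in `T⁻¹`, and fixes the diagonal factor. -/
theorem twist_const (hJ : J ≤ Ideal.jacobson ⊥) {w : Fin N → Bool} (hw : w ∈ S.W)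
    {g : GL (Fin N) A} (hG : g ∈ S.G A) (hg : g ∈ relGL N A J) :
    twist w (GeneralLinearGroup.map LaurentPolynomial.C g) ∈ S.products (J := J) := by
  obtain ⟨l, hl, d, hdG, hdJ, hd, r, hr, rfl⟩ :=
    ElementaryGroup.exists_ldu (S := S.toElementaryGroup) hJ (fun a => if w a then 0 else 1) hG hg
  rw [mul_assoc, map_mul, map_mul]
  refine ⟨_, S.twist_genBy_pos hw hl, _, ?_, rfl⟩
  rw [map_mul, map_mul]
  refine mul_mem ?_ (S.twist_genBy_neg hw hr)
  have : twist w (GeneralLinearGroup.map LaurentPolynomial.C d) =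
      GeneralLinearGroup.map LaurentPolynomial.C d := by
    ext a b
    rw [twist_apply, tau_conj_apply, GeneralLinearGroup.map_apply]
    rcases eq_or_ne a b with rfl | hab
    · rw [mul_right_comm, Units.mul_inv, one_mul]
    · rw [hd a b hab]; simp
  rw [this]
  exact S.map_C_mem_negPart hdG hdJ

/-- Off the diagonal the entries are divisible by the variable, which becomes `T⁻¹` and absorbs the
possible factor `T`; the diagonal entries are fixed by the twist. -/
theorem exists_toLaurentInv_twist_entry (w : Fin N → Bool) {g : GL (Fin N) A[X]}
    (hg : g ∈ relGL N A[X] (polyIdeal J)) (h0 : GeneralLinearGroup.map (evalZero A) g = 1)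
    (a b : Fin N) : ∃ p, p - (1 : Matrix (Fin N) (Fin N) A[X]) a b ∈ polyIdeal J ∧
      toLaurentInv A p = (twist w (GeneralLinearGroup.map (toLaurentInv A) g)).1 a b := by
  rw [twist_apply, tau_conj_apply, GeneralLinearGroup.map_apply]
  rcases eq_or_ne a b with rfl | hab
  · exact ⟨g.1 a a, mem_relGL.mp hg a a, by rw [mul_right_comm, Units.mul_inv, one_mul]⟩
  have hgab := ElementaryGroup.entry_mem hg hab
  obtain ⟨q, hq⟩ : Polynomial.X ∣ g.1 a b := by
    have := congrArg (fun k : GL (Fin N) A[X] => k.1 a b) h0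
    simp only [GeneralLinearGroup.map_apply, Units.val_one, Matrix.one_apply_ne hab] at this
    have h := X_dvd_sub_evalZero (g.1 a b)
    rwa [this, sub_zero] at h
  have hqJ : q ∈ polyIdeal J := by
    rw [hq, Ideal.mem_map_C_iff] at hgab
    rw [Ideal.mem_map_C_iff]
    intro n
    simpa using hgab (n + 1)
  simp only [Matrix.one_apply_ne hab, sub_zero]
  have hT : ((Tunit A : A[T;T⁻¹]ˣ) : A[T;T⁻¹]) * toLaurentInv A Polynomial.X = 1 := by
    rw [toLaurentInv_X]; exact (Tunit A).mul_inv
  have hT' : ((Tunit A)⁻¹ : A[T;T⁻¹]ˣ) = toLaurentInv A Polynomial.X := by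
    rw [toLaurentInv_X]; rfl
  have key : ∀ x y : Bool, ∃ p ∈ polyIdeal J, toLaurentInv A p =
      ((if x then Tunit A else 1 : A[T;T⁻¹]ˣ) : A[T;T⁻¹]) * toLaurentInv A (g.1 a b) *
        ((if y then Tunit A else 1 : A[T;T⁻¹]ˣ)⁻¹ : A[T;T⁻¹]ˣ) := by
    intro x y
    cases x <;> cases y
    · exact ⟨_, hgab, by simp⟩
    · exact ⟨_, Ideal.mul_mem_left _ Polynomial.X hgab, by simp [hT', mul_comm]⟩
    · refine ⟨q, hqJ, ?_⟩
      rw [hq, map_mul, ← mul_assoc]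
      simp [hT]
    · exact ⟨_, hgab, by simp [mul_right_comm]⟩
  exact key _ _

theorem twist_negPart {w : Fin N → Bool} (hw : w ∈ S.W) {g : GL (Fin N) A[X]} (hG : g ∈ S.G A[X])
    (hg : g ∈ relGL N A[X] (polyIdeal J)) (h0 : GeneralLinearGroup.map (evalZero A) g = 1) :
    twist w (GeneralLinearGroup.map (toLaurentInv A) g) ∈ S.negPart J := by
  have h1 := exists_toLaurentInv_twist_entry w hg h0
  have h2 := exists_toLaurentInv_twist_entry w (inv_mem hg)
    (by rw [map_inv, h0, inv_one])
  rw [map_inv, map_inv] at h2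
  obtain ⟨g', e⟩ := exists_lift_GL toLaurentInv_injective
    (fun a b => (h1 a b).imp fun _ h => h.2) (fun a b => (h2 a b).imp fun _ h => h.2)
  refine ⟨g', ⟨?_, ?_⟩, e⟩
  · have : GeneralLinearGroup.map (toLaurentInv A) g' ∈ S.G _ := by
      rw [e]
      exact S.tau_conj_mem_G w _ _ hw (S.map_mem_G _ hG)
    exact S.mem_G_of_map _ _ (fun b hb _ => toLaurentInv_injective (by rw [hb, map_zero])) this this
  · change g' ∈ relGL N A[X] (polyIdeal J)
    rw [mem_relGL]
    intro a b
    obtain ⟨p, hp, hp'⟩ := h1 a b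
    rw [← e, GeneralLinearGroup.map_apply] at hp'
    rwa [← toLaurentInv_injective hp']

theorem posPart_conj {J : Ideal A} {x : GL (Fin N) A[X]} (hx : x ∈ S.E A[X])
    {k : GL (Fin N) A[T;T⁻¹]} (hk : k ∈ S.posPart J) :
    GeneralLinearGroup.map Polynomial.toLaurent x * k *
      (GeneralLinearGroup.map Polynomial.toLaurent x)⁻¹ ∈ S.posPart J := by
  obtain ⟨k, hk, rfl⟩ := hk
  rw [← map_inv, ← map_mul, ← map_mul]
  exact map_mem_map (S.relE_conj hx hk)

theorem negPart_conj {J : Ideal A} {x : GL (Fin N) A[X]} (hx : x ∈ S.G A[X])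
    {k : GL (Fin N) A[T;T⁻¹]} (hk : k ∈ S.negPart J) :
    GeneralLinearGroup.map (toLaurentInv A) x * k *
      (GeneralLinearGroup.map (toLaurentInv A) x)⁻¹ ∈ S.negPart J := by
  obtain ⟨k, ⟨hk, hk'⟩, rfl⟩ := hk
  rw [← map_inv, ← map_mul, ← map_mul]
  refine map_mem_map ⟨(S.G A[X]).mul_mem ((S.G A[X]).mul_mem hx hk) ((S.G A[X]).inv_mem hx), ?_⟩
  exact (MonoidHom.normal_ker _).conj_mem _ hk' x

/-- The constant term of a matrix of polynomials. -/
noncomputable def constTerm (A : Type*) [CommRing A] : GL (Fin N) A[X] →* GL (Fin N) A :=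
  GeneralLinearGroup.map (Polynomial.evalRingHom 0)

theorem constTerm_mem_relGL {J : Ideal A} {g : GL (Fin N) A[X]}
    (hg : g ∈ relGL N A[X] (polyIdeal J)) : constTerm A g ∈ relGL N A J := by
  rw [mem_relGL] at hg ⊢
  intro a b
  have := (Ideal.mem_map_C_iff.mp (hg a b)) 0
  rw [Polynomial.coeff_zero_eq_eval_zero, Polynomial.eval_sub] at this
  simp only [constTerm, GeneralLinearGroup.map_apply]
  rcases eq_or_ne a b with rfl | hab <;> simpa [*] using this

theorem constTerm_mem_relE {J : Ideal A} {g : GL (Fin N) A[X]}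
    (hg : g ∈ S.relE A[X] (polyIdeal J)) : constTerm A g ∈ S.relE A J :=
  S.map_mem_relE _ (fun c hc => by
    have := (Ideal.mem_map_C_iff.mp hc) 0
    rwa [Polynomial.coeff_zero_eq_eval_zero] at this) hg

theorem evalZero_eq (g : GL (Fin N) A[X]) : GeneralLinearGroup.map (evalZero A) g =
    GeneralLinearGroup.map Polynomial.C (constTerm A g) := rfl

theorem evalZero_C (g : GL (Fin N) A) : GeneralLinearGroup.map (evalZero A)
    (GeneralLinearGroup.map Polynomial.C g) = GeneralLinearGroup.map Polynomial.C g := by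
  ext a b : 2
  simp [evalZero]

theorem x_C_conj_products (a b : Fin N) (h : a ≠ b) (c : A) {z : GL (Fin N) A[T;T⁻¹]}
    (hz : z ∈ S.products (J := J)) : S.x a b h (LaurentPolynomial.C c) * z *
      (S.x a b h (LaurentPolynomial.C c))⁻¹ ∈ S.products (J := J) := by
  obtain ⟨k, hk, h', hh', rfl⟩ := hz
  refine ⟨_, S.posPart_conj (S.x_mem_E a b h (Polynomial.C c)) hk, _,
    S.negPart_conj (S.x_mem_G a b h (Polynomial.C c)) hh', ?_⟩
  rw [S.x_map, S.x_map, toLaurentInv_C, Polynomial.toLaurent_C]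
  group

theorem x_mul_conj (w : Fin N → Bool) {a b : Fin N} (h : a ≠ b) (hw : w ∈ S.W) (ha : w a = true)
    (hb : w b = false) (c : A[T;T⁻¹]) : twist w (S.x a b h c) = S.x a b h (Tunit A * c) := by
  rw [twist_apply, S.tau_conj_x w _ a b h _ hw]
  simp [tauUnit, ha, hb]

/-- Write `y` for the conjugating root element. It is itself a matrix in `T⁻¹`, so only the left
factor `k` is at issue. The twist by a `w` separating `a` and `b` makes `y` constant. After its
constant term `k0` is moved to the right factor, `k` can be twisted, conjugated by the constant root
element and twisted back. The new constant term `k4` need not be trivial; its twist is again a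
product by `twist_const`. -/
theorem x_inv_conj_products (hJ : J ≤ Ideal.jacobson ⊥) (a b : Fin N) (h : a ≠ b) (c : A)
    {z : GL (Fin N) A[T;T⁻¹]} (hz : z ∈ S.products (J := J)) :
    S.x a b h (toLaurentInv A (Polynomial.C c * Polynomial.X)) * z *
      (S.x a b h (toLaurentInv A (Polynomial.C c * Polynomial.X)))⁻¹ ∈ S.products (J := J) := by
  set y := S.x a b h (toLaurentInv A (Polynomial.C c * Polynomial.X)) with hy
  have hyM : y = GeneralLinearGroup.map (toLaurentInv A)
    (S.x a b h (Polynomial.C c * Polynomial.X)) := by rw [S.x_map]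
  have hyn : ∀ k ∈ S.negPart J, y * k * y⁻¹ ∈ S.negPart J := fun k hk => by
    rw [hyM]; exact S.negPart_conj (S.x_mem_G _ _ _ _) hk
  obtain ⟨_, ⟨k, hk, rfl⟩, n, hn, rfl⟩ := hz
  obtain ⟨w, hw, ha, hb⟩ := S.W_sep a b h
  set k0 := constTerm A k
  have hk0 : k0 ∈ S.relE A J := S.constTerm_mem_relE hk
  have hk0' : GeneralLinearGroup.map Polynomial.C k0 ∈ S.relE A[X] (polyIdeal J) :=
    S.map_mem_relE _ (fun c hc => Ideal.mem_map_of_mem _ hc) hk0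
  have h1 := S.twist_posPart hw (mul_mem hk (inv_mem hk0')) (by
    rw [map_mul, map_inv, evalZero_eq, evalZero_C, mul_inv_cancel])
  have hty : twist w y = GeneralLinearGroup.map Polynomial.toLaurent
      (S.x a b h (Polynomial.C c)) := by
    rw [hy, S.x_mul_conj w h hw ha hb, S.x_map, map_mul, toLaurentInv_X, mul_left_comm]
    congr 1
    rw [show (Tunit A : A[T;T⁻¹]) * LaurentPolynomial.T (-1) = 1 from (Tunit A).mul_inv, mul_one,
      toLaurentInv_C, Polynomial.toLaurent_C]
  obtain ⟨k3, hk3, e3⟩ := S.posPart_conj (S.x_mem_E a b h (Polynomial.C c)) h1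
  rw [← hty] at e3
  have e4 : y * GeneralLinearGroup.map Polynomial.toLaurent
      (k * (GeneralLinearGroup.map Polynomial.C k0)⁻¹) * y⁻¹ =
      twist (fun a => !w a) (GeneralLinearGroup.map Polynomial.toLaurent k3) := by
    rw [e3, ← map_inv (twist w), ← map_mul (twist w), ← map_mul (twist w), twist_twist_compl]
  have hw' := S.W_compl w hw
  set k4 := constTerm A k3
  have hk4 : k4 ∈ S.relE A J := S.constTerm_mem_relE hk3
  have hk4' : GeneralLinearGroup.map Polynomial.C k4 ∈ S.relE A[X] (polyIdeal J) :=
    S.map_mem_relE _ (fun c hc => Ideal.mem_map_of_mem _ hc) hk4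
  have h5 := S.twist_posPart hw' (mul_mem hk3 (inv_mem hk4')) (by
    rw [map_mul, map_inv, evalZero_eq, evalZero_C, mul_inv_cancel])
  have h6 := S.twist_const hJ hw' (S.E_le_G (S.relE_le_E _ hk4)) (S.relE_le_relGL _ hk4)
  have h7 := S.posPart_mul_mem h5 h6
  rw [map_C_eq_toLaurent, ← map_mul, ← map_mul, inv_mul_cancel_right, ← e4] at h7
  have h8 := S.mul_negPart_mem (mul_mem
    (hyn _ (S.map_C_mem_negPart (S.E_le_G (S.relE_le_E _ hk0)) (S.relE_le_relGL _ hk0)))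
    (hyn _ hn)) h7
  convert h8 using 1
  rw [map_C_eq_toLaurent, map_mul, map_inv]
  group

/-- The mirror image of `x_inv_conj_products`: now the right factor `n` is twisted. Its constant
term `n0` must be moved into the relative elementary left factor, which is possible because `J` lies
in the Jacobson radical. -/
theorem x_pos_conj_products (hJ : J ≤ Ideal.jacobson ⊥) (a b : Fin N) (h : a ≠ b) (c : A)
    {z : GL (Fin N) A[T;T⁻¹]} (hz : z ∈ S.products (J := J)) :
    S.x a b h (Polynomial.toLaurent (Polynomial.C c * Polynomial.X)) * z *
      (S.x a b h (Polynomial.toLaurent (Polynomial.C c * Polynomial.X)))⁻¹ ∈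
        S.products (J := J) := by
  set y := S.x a b h (Polynomial.toLaurent (Polynomial.C c * Polynomial.X)) with hy
  have hyM : y = GeneralLinearGroup.map Polynomial.toLaurent
    (S.x a b h (Polynomial.C c * Polynomial.X)) := by rw [S.x_map]
  have hyp : ∀ k ∈ S.posPart J, y * k * y⁻¹ ∈ S.posPart J := fun k hk => by
    rw [hyM]; exact S.posPart_conj (S.x_mem_E _ _ _ _) hk
  obtain ⟨k, hk, _, ⟨n, ⟨hnG, hnJ⟩, rfl⟩, rfl⟩ := hz
  change n ∈ S.G A[X] at hnG
  change n ∈ relGL N A[X] (polyIdeal J) at hnJ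
  obtain ⟨w, hw, ha, hb⟩ := S.W_sep a b h
  have hw' := S.W_compl w hw
  set n0 := constTerm A n
  have hn0 : n0 ∈ S.G A := S.map_mem_G _ hnG
  have hn0J : n0 ∈ relGL N A J := constTerm_mem_relGL hnJ
  have h1 := S.twist_negPart hw' (mul_mem (inv_mem (S.map_mem_G Polynomial.C hn0)) hnG)
    (mul_mem (inv_mem (map_C_mem_relGL hn0J)) hnJ) (by
    rw [map_mul, map_inv, evalZero_C, evalZero_eq, inv_mul_cancel])
  set x0 : GL (Fin N) A[T;T⁻¹] := GeneralLinearGroup.map (toLaurentInv A)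
      (S.x a b h (Polynomial.C c)) with hx0
  have hty : twist (fun a => !w a) y = x0 := by
    have : y = twist w x0 := by
      rw [hy, hx0, S.x_map, S.x_mul_conj w h hw ha hb, map_mul, toLaurentInv_C,
        Polynomial.toLaurent_C, Polynomial.toLaurent_X, mul_comm]
      rfl
    rw [this, twist_twist_compl]
  obtain ⟨n3, ⟨hn3, hn3J⟩, e3⟩ := S.negPart_conj (S.x_mem_G a b h (Polynomial.C c)) h1
  rw [← hx0, ← hty] at e3
  change n3 ∈ S.G A[X] at hn3
  change n3 ∈ relGL N A[X] (polyIdeal J) at hn3J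
  have e4 : y * GeneralLinearGroup.map (toLaurentInv A)
      ((GeneralLinearGroup.map Polynomial.C n0)⁻¹ * n) * y⁻¹ =
      twist w (GeneralLinearGroup.map (toLaurentInv A) n3) := by
    rw [e3, ← map_inv (twist _), ← map_mul (twist _), ← map_mul (twist _)]
    have := twist_twist_compl (fun a => !w a) (y * GeneralLinearGroup.map (toLaurentInv A)
      ((GeneralLinearGroup.map Polynomial.C n0)⁻¹ * n) * y⁻¹)
    simpa using this.symm
  set n4 := constTerm A n3
  have hn4 : n4 ∈ S.G A := S.map_mem_G _ hn3
  have hn4J : n4 ∈ relGL N A J := constTerm_mem_relGL hn3J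
  have h5 := S.twist_negPart hw (mul_mem (inv_mem (S.map_mem_G Polynomial.C hn4)) hn3)
    (mul_mem (inv_mem (map_C_mem_relGL hn4J)) hn3J) (by
    rw [map_mul, map_inv, evalZero_C, evalZero_eq, inv_mul_cancel])
  have h7 := S.mul_negPart_mem h5 (S.twist_const hJ hw hn4 hn4J)
  rw [map_C_eq_toLaurentInv, ← map_mul, ← map_mul, mul_inv_cancel_left, ← e4] at h7
  have h8 := S.posPart_mul_mem (mul_mem (hyp _ hk) (hyp _ (S.map_C_mem_posPart hJ hn0 hn0J))) h7
  convert h8 using 1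
  rw [map_C_eq_toLaurentInv, map_mul, map_inv]
  group

end ElementarySystem

namespace ElementarySystem

variable {N : ℕ} (S : ElementarySystem.{u} N) {A : Type u} [CommRing A] {J : Ideal A}

variable (J) in
/-- The elements which conjugate `products` into itself. -/
def normalizer : Submonoid (GL (Fin N) A[T;T⁻¹]) where
  carrier := {g | ∀ z ∈ S.products (J := J), g * z * g⁻¹ ∈ S.products (J := J)}
  one_mem' z hz := by simpa using hz
  mul_mem' {g g'} hg hg' z hz := by
    have := hg _ (hg' z hz)
    convert this using 1
    group

theorem x_monomial_mem_normalizer_of_sq {m i j k : ℤ} (hi : 2 * i + k = m)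
    (h₀ : ∀ c a b h, S.x a b h (LaurentPolynomial.C c * LaurentPolynomial.T 0) ∈ S.normalizer J)
    (h₁ : ∀ c a b h, S.x a b h (LaurentPolynomial.C c * LaurentPolynomial.T i) ∈ S.normalizer J)
    (h₂ : ∀ c a b h, S.x a b h (LaurentPolynomial.C c * LaurentPolynomial.T k) ∈ S.normalizer J)
    (hj : i + k = j)
    (h₃ : ∀ c a b h, S.x a b h (LaurentPolynomial.C c * LaurentPolynomial.T j) ∈ S.normalizer J)
    (c : A) (a b : Fin N) (h : a ≠ b) :
    S.x a b h (LaurentPolynomial.C c * LaurentPolynomial.T m) ∈ S.normalizer J := by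
  have key : ∀ l : ℤ,
      (∀ c a b h, S.x a b h (LaurentPolynomial.C c * LaurentPolynomial.T l) ∈ S.normalizer J) →
      ∀ c a b h, S.x a b h (LaurentPolynomial.C c * LaurentPolynomial.T l) ∈ S.normalizer J ∧
        S.x a b h (-(LaurentPolynomial.C c * LaurentPolynomial.T l)) ∈ S.normalizer J :=
    fun l hl c a b h => ⟨hl c a b h, by rw [← neg_mul, ← map_neg]; exact hl _ a b h⟩
  have e : LaurentPolynomial.C c * LaurentPolynomial.T m = (LaurentPolynomial.T i : A[T;T⁻¹]) ^ 2 *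
      (LaurentPolynomial.C c * LaurentPolynomial.T k) := by
    rw [← hi, LaurentPolynomial.T_add, two_mul, LaurentPolynomial.T_add]
    ring
  have e' : (LaurentPolynomial.T i : A[T;T⁻¹]) * (LaurentPolynomial.C c * LaurentPolynomial.T k) =
      LaurentPolynomial.C c * LaurentPolynomial.T j := by
    rw [← hj, LaurentPolynomial.T_add]
    ring
  rw [e]
  refine S.sq_mul_mem _ _ _ ?_ a b h
  rintro z (rfl | rfl | rfl | rfl)
  · simpa using key 0 h₀ 1
  · simpa using key i h₁ 1
  · exact key k h₂ c
  · rw [e']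
    exact key j h₃ c

theorem x_monomial_mem_normalizer (hJ : J ≤ Ideal.jacobson ⊥) (m : ℤ) (c : A) (a b : Fin N)
    (h : a ≠ b) :
    S.x a b h (LaurentPolynomial.C c * LaurentPolynomial.T m) ∈ S.normalizer J := by
  have h0 : ∀ c a b h, S.x a b h (LaurentPolynomial.C c * LaurentPolynomial.T 0) ∈
      S.normalizer J := fun c a b h z hz => by
    have := S.x_C_conj_products a b h c hz
    simpa using this
  have h1 : ∀ c a b h, S.x a b h (LaurentPolynomial.C c * LaurentPolynomial.T 1) ∈
      S.normalizer J := fun c a b h z hz => by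
    have := S.x_pos_conj_products hJ a b h c hz
    simpa using this
  have h2 : ∀ c a b h, S.x a b h (LaurentPolynomial.C c * LaurentPolynomial.T (-1)) ∈
      S.normalizer J := fun c a b h z hz => by
    have := S.x_inv_conj_products hJ a b h c hz
    rwa [map_mul, toLaurentInv_C, toLaurentInv_X] at this
  have key : ∀ n : ℕ, (∀ c a b h, S.x a b h (LaurentPolynomial.C c * LaurentPolynomial.T n) ∈
      S.normalizer J) ∧ (∀ c a b h, S.x a b h (LaurentPolynomial.C c * LaurentPolynomial.T (-n)) ∈
      S.normalizer J) := by
    intro n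
    induction n using Nat.strong_induction_on with
    | _ n ih =>
      match n, ih with
      | 0, _ => exact ⟨by simpa using h0, by simpa using h0⟩
      | 1, _ => exact ⟨by simpa using h1, h2⟩
      | n + 2, ih =>
        -- `c Tⁿ⁺² = T² · c Tⁿ`, where the commutator relation also needs the intermediate parameter
        -- `c Tⁿ⁺¹`; likewise for negative exponents.
        refine ⟨S.x_monomial_mem_normalizer_of_sq (i := 1) (j := (n + 1 : ℕ)) (k := n) ?_ h0 h1
          (ih n (by omega)).1 ?_ (ih (n + 1) (by omega)).1,
          S.x_monomial_mem_normalizer_of_sq (i := -1) (j := -(n + 1 : ℕ)) (k := -n) ?_ h0 h2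
          (ih n (by omega)).2 ?_ (ih (n + 1) (by omega)).2⟩ <;> push_cast <;> ring
  rcases m.eq_nat_or_neg with ⟨n, rfl | rfl⟩
  · exact (key n).1 c a b h
  · exact (key n).2 c a b h

theorem conj_products (hJ : J ≤ Ideal.jacobson ⊥) {γ z : GL (Fin N) A[T;T⁻¹]}
    (hγ : γ ∈ S.E A[T;T⁻¹]) (hz : z ∈ S.products (J := J)) : γ * z * γ⁻¹ ∈ S.products (J := J) := by
  have hx : ∀ a b h c, S.x a b h c ∈ S.normalizer J := fun a b h c => by
    induction c using LaurentPolynomial.induction_on' with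
    | add p q hp hq => rw [S.x_add]; exact mul_mem hp hq
    | C_mul_T n c => exact S.x_monomial_mem_normalizer hJ n c a b h
  suffices h : γ ∈ S.normalizer J from h z hz
  induction hγ using Subgroup.closure_induction'' with
  | one => exact one_mem _
  | mem _ hg => obtain ⟨a, b, h, c, rfl⟩ := hg; exact hx a b h c
  | inv_mem _ hg => obtain ⟨a, b, h, c, rfl⟩ := hg; rw [← S.x_neg]; exact hx a b h _
  | mul _ _ _ _ ih ih' => exact mul_mem ih ih'

/-- With `c = p(T) + q(T⁻¹)` one has `x(c) z = x(p) · (x(q) z x(q)⁻¹) · x(q)`: the outer factors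
belong to the two parts, and the middle one is a product by stability under conjugation. -/
theorem x_mul_products (hJ : J ≤ Ideal.jacobson ⊥) {a b : Fin N} (h : a ≠ b) {c : A[T;T⁻¹]}
    (hc : c ∈ J.map LaurentPolynomial.C) {z : GL (Fin N) A[T;T⁻¹]}
    (hz : z ∈ S.products (J := J)) : S.x a b h c * z ∈ S.products (J := J) := by
  obtain ⟨p, hp, q, hq, rfl⟩ := exists_add_eq_of_mem_map hc
  have h1 := S.mul_negPart_mem (S.x_mem_negPart a b h hq)
    (S.conj_products hJ (S.x_mem_E a b h (toLaurentInv A q)) hz)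
  rw [inv_mul_cancel_right] at h1
  rw [S.x_add, mul_assoc]
  refine S.posPart_mul_mem ?_ h1
  rw [← S.x_map]
  exact map_mem_map (S.x_mem_relE a b h hp)

/-- Relative elementary matrices over the Laurent polynomial ring are products of a matrix over
`A[T]` and a matrix over `A[T⁻¹]`, for an ideal in the Jacobson radical. -/
theorem exists_factorization (hJ : J ≤ Ideal.jacobson ⊥) {g : GL (Fin N) A[T;T⁻¹]}
    (hg : g ∈ S.relE A[T;T⁻¹] (J.map LaurentPolynomial.C)) :
    ∃ k ∈ S.relE A[X] (polyIdeal J), ∃ h ∈ S.G A[X], h ∈ relGL N A[X] (polyIdeal J) ∧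
      g = GeneralLinearGroup.map Polynomial.toLaurent k *
        GeneralLinearGroup.map (toLaurentInv A) h := by
  suffices h : g ∈ S.products (J := J) by
    obtain ⟨_, ⟨k, hk, rfl⟩, _, ⟨n, ⟨hn, hn'⟩, rfl⟩, rfl⟩ := h
    exact ⟨k, hk, n, hn, hn', rfl⟩
  induction hg using Subgroup.closure_induction_left with
  | one => exact ⟨1, one_mem _, 1, one_mem _, by simp⟩
  | mul_left g hg z _ ih =>
    obtain ⟨γ, hγ, a, b, h, c, hc, rfl⟩ := hg
    have := S.conj_products hJ hγ (S.x_mul_products hJ h hc (S.conj_products hJ (inv_mem hγ) ih))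
    convert this using 1
    group
  | inv_mul_cancel g hg z _ ih =>
    obtain ⟨γ, hγ, a, b, h, c, hc, rfl⟩ := hg
    have := S.conj_products hJ hγ (S.x_mul_products hJ h (neg_mem hc)
      (S.conj_products hJ (inv_mem hγ) ih))
    rw [S.x_neg] at this
    convert this using 1
    group

/-- The automorphism `T ↦ T⁻¹` exchanges the roles of the charts. This order is the one needed for
Horrocks' theorem, where the elementary factor must cancel against a matrix in `T⁻¹`. -/
theorem exists_factorization' (hJ : J ≤ Ideal.jacobson ⊥) {g : GL (Fin N) A[T;T⁻¹]}
    (hg : g ∈ S.relE A[T;T⁻¹] (J.map LaurentPolynomial.C)) :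
    ∃ k ∈ S.relE A[X] (polyIdeal J), ∃ h ∈ S.G A[X], h ∈ relGL N A[X] (polyIdeal J) ∧
      g = GeneralLinearGroup.map (toLaurentInv A) k *
        GeneralLinearGroup.map Polynomial.toLaurent h := by
  set ι : A[T;T⁻¹] →+* A[T;T⁻¹] :=
    ((LaurentPolynomial.invert : A[T;T⁻¹] ≃ₐ[A] A[T;T⁻¹]) : A[T;T⁻¹] →+* A[T;T⁻¹]) with hι
  have hιι : ι.comp ι = RingHom.id _ := RingHom.ext fun x =>
    (LaurentPolynomial.invert (R := A)).symm_apply_apply x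
  have h1 : ι.comp Polynomial.toLaurent = toLaurentInv A := RingHom.ext fun p =>
    (toLaurentInv_eq p).symm
  have h2 : ι.comp (toLaurentInv A) = Polynomial.toLaurent := by
    rw [← h1, ← RingHom.comp_assoc, hιι, RingHom.id_comp]
  have hg' : GeneralLinearGroup.map ι g ∈ S.relE A[T;T⁻¹] (J.map LaurentPolynomial.C) := by
    refine S.map_mem_relE ι (fun c hc => ?_) hg
    have h3 : ι.comp LaurentPolynomial.C = LaurentPolynomial.C :=
      RingHom.ext fun a => by simp [hι]
    have := Ideal.mem_map_of_mem ι hc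
    rwa [Ideal.map_map, h3] at this
  obtain ⟨k, hk, h, hh, hh', e⟩ := S.exists_factorization hJ hg'
  refine ⟨k, hk, h, hh, hh', ?_⟩
  have e' := congrArg (GeneralLinearGroup.map ι) e
  rwa [map_mul, map_map_GL, map_map_GL, map_map_GL, hιι, h1, h2] at e'

end ElementarySystem

/-! ### The local-global principle. -/

theorem HasDenominators.mapRingHom {R L : Type*} [CommRing R] [CommRing L] {φ : R →+* L}
    {M : Submonoid R} (h : HasDenominators φ M) :
    HasDenominators (Polynomial.mapRingHom φ) (M.map (Polynomial.C : R →+* R[X])) := by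
  intro l
  induction l using Polynomial.induction_on' with
  | add p q hp hq =>
    obtain ⟨_, ⟨s, hs, rfl⟩, r, hr⟩ := hp
    obtain ⟨_, ⟨t, ht, rfl⟩, r', hr'⟩ := hq
    refine ⟨_, ⟨s * t, mul_mem hs ht, rfl⟩, Polynomial.C t * r + Polynomial.C s * r', ?_⟩
    rw [map_add, map_mul, map_mul, hr, hr', map_mul Polynomial.C, map_mul (Polynomial.mapRingHom φ)]
    ring
  | monomial n a =>
    obtain ⟨s, hs, r, hr⟩ := h a
    refine ⟨_, ⟨s, hs, rfl⟩, Polynomial.monomial n r, ?_⟩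
    simp [hr, Polynomial.C_mul_monomial]

theorem hasDenominators_algebraMap {R L : Type*} [CommRing R] [CommRing L] [Algebra R L]
    (M : Submonoid R) [IsLocalization M L] : HasDenominators (algebraMap R L) M := fun l => by
  obtain ⟨⟨r, s⟩, h⟩ := IsLocalization.surj M l
  exact ⟨s, s.2, r, by rw [mul_comm]; exact h.symm⟩

/-- Every element of the kernel of `φ` is annihilated by an element of `M`. -/
def KillsKernel {R L : Type*} [CommRing R] [CommRing L] (φ : R →+* L) (M : Submonoid R) : Prop :=
  ∀ r, φ r = 0 → ∃ s ∈ M, s * r = 0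

theorem KillsKernel.exists_forall {R L ι : Type*} [CommRing R] [CommRing L] {φ : R →+* L}
    {M : Submonoid R} (h : KillsKernel φ M) (F : Finset ι) (f : ι → R)
    (hf : ∀ i ∈ F, φ (f i) = 0) : ∃ s ∈ M, ∀ i ∈ F, s * f i = 0 := by
  classical
  induction F using Finset.induction_on with
  | empty => exact ⟨1, one_mem _, by simp⟩
  | insert i F _ ih =>
    obtain ⟨s, hs, H⟩ := ih fun j hj => hf j (Finset.mem_insert_of_mem hj)
    obtain ⟨t, ht, H'⟩ := h (f i) (hf i (Finset.mem_insert_self _ _))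
    refine ⟨s * t, mul_mem hs ht, fun j hj => ?_⟩
    rcases Finset.mem_insert.mp hj with rfl | hj
    · rw [mul_assoc, H', mul_zero]
    · rw [mul_right_comm, H j hj, zero_mul]

theorem KillsKernel.mapRingHom {R L : Type*} [CommRing R] [CommRing L] {φ : R →+* L}
    {M : Submonoid R} (h : KillsKernel φ M) :
    KillsKernel (Polynomial.mapRingHom φ) (M.map (Polynomial.C : R →+* R[X])) := by
  intro p hp
  obtain ⟨s, hs, H⟩ := h.exists_forall p.support p.coeff fun i _ => by
    have := congrArg (fun q => q.coeff i) hp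
    simpa using this
  refine ⟨_, ⟨s, hs, rfl⟩, ?_⟩
  ext n
  by_cases hn : n ∈ p.support
  · simpa using H n hn
  · simp [Polynomial.notMem_support_iff.mp hn]

theorem killsKernel_algebraMap {R L : Type*} [CommRing R] [CommRing L] [Algebra R L]
    (M : Submonoid R) [IsLocalization M L] : KillsKernel (algebraMap R L) M := fun r hr => by
  obtain ⟨s, hs⟩ := (IsLocalization.map_eq_zero_iff M L r).mp hr
  exact ⟨s, s.2, hs⟩

section Substitution

variable {B C : Type*} [CommRing B] [CommRing C]

/-- The substitution `X ↦ X + s T`. -/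
noncomputable def shift (s : B) : B[X] →+* B[X][X] :=
  Polynomial.eval₂RingHom (Polynomial.C.comp Polynomial.C)
    (Polynomial.C Polynomial.X + Polynomial.C (Polynomial.C s) * Polynomial.X)

/-- The substitution `T ↦ r T`. -/
noncomputable def scale (r : B) : B[X][X] →+* B[X][X] :=
  Polynomial.eval₂RingHom Polynomial.C (Polynomial.C (Polynomial.C r) * Polynomial.X)

/-- The substitution `X ↦ X + t T`, as an endomorphism of the ring of polynomials in `X`, `T`. -/
noncomputable def move (t : B) : B[X][X] →+* B[X][X] :=
  Polynomial.eval₂RingHom (shift t) Polynomial.X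

theorem shift_comp_mapRingHom (φ : B →+* C) (s : B) :
    (shift (φ s)).comp (Polynomial.mapRingHom φ) =
      (Polynomial.mapRingHom (Polynomial.mapRingHom φ)).comp (shift s) :=
  Polynomial.ringHom_ext (fun a => by simp [shift]) (by simp [shift])

theorem scale_comp_shift (r s : B) : (scale r).comp (shift s) = shift (s * r) :=
  Polynomial.ringHom_ext (fun a => by simp [shift, scale])
    (by simp [shift, scale]; ring)

theorem scale_comp_C (r : B) : (scale r).comp Polynomial.C = Polynomial.C :=
  RingHom.ext fun p => by simp [scale]

theorem move_comp_shift (t s : B) : (move t).comp (shift s) = shift (s + t) :=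
  Polynomial.ringHom_ext (fun a => by simp [shift, move])
    (by simp [shift, move]; ring)

theorem move_comp_C (t : B) : (move t).comp Polynomial.C = shift t :=
  RingHom.ext fun p => by simp [move]

theorem evalZero_comp_shift (s : B) :
    (Polynomial.evalRingHom (0 : B[X])).comp (shift s) = RingHom.id _ :=
  Polynomial.ringHom_ext (fun a => by simp [shift]) (by simp [shift])

theorem shift_zero : shift (0 : B) = Polynomial.C :=
  Polynomial.ringHom_ext (fun a => by simp [shift]) (by simp [shift])

/-- The difference of the two values of `p` is divisible by the difference `s T` of the two
arguments `X + s T` and `X`. Choosing `s` divisible by denominators therefore clears them. -/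
theorem dvd_shift_sub (s : B) (p : B[X]) :
    Polynomial.C (Polynomial.C s) ∣ shift s p - Polynomial.C p := by
  have h : ∀ q : B[X][X], Polynomial.eval₂ (Polynomial.C.comp Polynomial.C) q p =
      Polynomial.eval q (p.map (Polynomial.C.comp Polynomial.C)) := fun q => by
    rw [Polynomial.eval_map]
  have h1 : shift s p = Polynomial.eval
      (Polynomial.C Polynomial.X + Polynomial.C (Polynomial.C s) * Polynomial.X)
      (p.map (Polynomial.C.comp Polynomial.C)) := h _
  have h2 : Polynomial.C p = Polynomial.eval (Polynomial.C Polynomial.X)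
      (p.map (Polynomial.C.comp Polynomial.C)) := by
    rw [← h, ← Polynomial.hom_eval₂, Polynomial.eval₂_C_X]
  rw [h1, h2]
  refine dvd_trans ⟨Polynomial.X, ?_⟩ (Polynomial.sub_dvd_eval_sub _ _ _)
  ring

end Substitution

namespace ElementarySystem

variable {N : ℕ} (S : ElementarySystem.{u} N) {A L : Type u} [CommRing A] [CommRing L]

/-- The difference `α(X + s T) α(X)⁻¹`. -/
noncomputable def increment (s : A) (α : GL (Fin N) A[X]) : GL (Fin N) A[X][X] :=
  GeneralLinearGroup.map (shift s) α * (GeneralLinearGroup.map Polynomial.C α)⁻¹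

theorem map_increment (φ : A →+* L) (s : A) (α : GL (Fin N) A[X]) :
    GeneralLinearGroup.map (Polynomial.mapRingHom (Polynomial.mapRingHom φ)) (increment s α) =
      increment (φ s) (GeneralLinearGroup.map (Polynomial.mapRingHom φ) α) := by
  have h : (Polynomial.C : L[X] →+* L[X][X]).comp (Polynomial.mapRingHom φ) =
      (Polynomial.mapRingHom (Polynomial.mapRingHom φ)).comp Polynomial.C :=
    RingHom.ext fun p => by simp
  rw [increment, increment, map_mul, map_inv, map_map_GL, map_map_GL, map_map_GL, map_map_GL, h,
    shift_comp_mapRingHom]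

variable [Algebra A L] (M : Submonoid A) [IsLocalization M L]

/-- Induction on a word for `g`. The statement is made for all conjugating matrices `γ` and all
multiples `r` of `s`, because each letter changes `γ` and enlarges the denominator. -/
theorem exists_conj_increment_mem {g : GL (Fin N) L[X]} (hg : g ∈ S.E L[X]) :
    ∀ γ ∈ S.E L[X][X], ∃ s ∈ M, ∀ r, γ * increment (algebraMap A L (s * r)) g * γ⁻¹ ∈
      (S.E A[X][X]).map (GeneralLinearGroup.map
        (Polynomial.mapRingHom (Polynomial.mapRingHom (algebraMap A L)))) := by
  set Φ := Polynomial.mapRingHom (Polynomial.mapRingHom (algebraMap A L)) with hΦ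
  have key : ∀ a b (h : a ≠ b) (c : L[X]) (γ : GL (Fin N) L[X][X]), γ ∈ S.E L[X][X] →
      ∃ s ∈ M, ∀ r, γ * S.x a b h (shift (algebraMap A L (s * r)) c - Polynomial.C c) * γ⁻¹ ∈
        (S.E A[X][X]).map (GeneralLinearGroup.map Φ) := by
    intro a b h c γ hγ
    have hden := hasDenominators_algebraMap (L := L) M
    obtain ⟨_, ⟨_, ⟨s, hs, rfl⟩, rfl⟩, H⟩ := S.exists_conj_mem Φ _ γ a b h
      hden.mapRingHom.mapRingHom hγ
    obtain ⟨_, ⟨t, ht, rfl⟩, c', hc'⟩ := hden.mapRingHom c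
    -- `t` clears the denominators of `c`, `s` those of the conjugation by `γ`; the increment of `c`
    -- at `s t r` is divisible by `s` after `t` has been cancelled.
    refine ⟨s * t, mul_mem hs ht, fun r => ?_⟩
    obtain ⟨q, hq⟩ := dvd_shift_sub (s * t * r) c'
    have hu : IsUnit (Polynomial.C (Polynomial.C (algebraMap A L t))) :=
      ((IsLocalization.map_units L ⟨t, ht⟩).map Polynomial.C).map Polynomial.C
    have e : shift (algebraMap A L (s * t * r)) c - Polynomial.C c =
        Φ (Polynomial.C (Polynomial.C s) * (Polynomial.C (Polynomial.C r) * q)) := by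
      apply hu.mul_left_cancel
      have h1 := congrArg Φ hq
      have h2 : Φ (shift (s * t * r) c') = shift (algebraMap A L (s * t * r))
          (Polynomial.mapRingHom (algebraMap A L) c') :=
        (congrArg (fun f : A[X] →+* L[X][X] => f c')
          (shift_comp_mapRingHom (algebraMap A L) (s * t * r))).symm
      have h3 : Φ (Polynomial.C c') = Polynomial.C (Polynomial.mapRingHom (algebraMap A L) c') := by
        simp [hΦ]
      have h4 : ∀ y : A, Φ (Polynomial.C (Polynomial.C y)) =
          Polynomial.C (Polynomial.C (algebraMap A L y)) := fun y => by simp [hΦ]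
      have h5 : ∀ y z : L, shift y (Polynomial.C z) = Polynomial.C (Polynomial.C z) := fun y z => by
        simp [shift]
      have h6 : Polynomial.mapRingHom (algebraMap A L) (Polynomial.C t) =
        Polynomial.C (algebraMap A L t) := by simp
      have hc'' : Polynomial.mapRingHom (algebraMap A L) c' =
        Polynomial.C (algebraMap A L t) * c := by rw [← h6]; exact hc'
      rw [map_sub, h2, h3, hc'', map_mul (shift _), map_mul Polynomial.C, h5, map_mul Φ, h4] at h1
      rw [map_mul Φ, map_mul Φ, h4, h4, mul_sub, h1]
      simp only [map_mul]
      ring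
    rw [e]
    have := H ⊤ (Polynomial.C (Polynomial.C r) * q) trivial
    rwa [S.relE_top] at this
  have step : ∀ a b (h : a ≠ b) (c : L[X]) (g : GL (Fin N) L[X]),
      (∀ γ ∈ S.E L[X][X], ∃ s ∈ M, ∀ r, γ * increment (algebraMap A L (s * r)) g * γ⁻¹ ∈
        (S.E A[X][X]).map (GeneralLinearGroup.map Φ)) →
      ∀ γ ∈ S.E L[X][X], ∃ s ∈ M, ∀ r,
        γ * increment (algebraMap A L (s * r)) (S.x a b h c * g) * γ⁻¹ ∈
          (S.E A[X][X]).map (GeneralLinearGroup.map Φ) := by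
    intro a b h c g ih γ hγ
    -- The increment of `x(c) g` is the conjugate by `x(c)` of `x(c(X + sT) - c(X))` times the
    -- increment of `g`, so both pieces are used with `γ x(c)`.
    have hγ' := mul_mem hγ (S.x_mem_E a b h (Polynomial.C c))
    obtain ⟨s, hs, H⟩ := ih _ hγ'
    obtain ⟨t, ht, H'⟩ := key a b h c _ hγ'
    refine ⟨s * t, mul_mem hs ht, fun r => ?_⟩
    have h1 := mul_mem (H' (s * r)) (H (t * r))
    have e1 : t * (s * r) = s * t * r := by ring
    have e2 : s * (t * r) = s * t * r := by ring
    rw [e1, e2, sub_eq_neg_add, S.x_add, S.x_neg] at h1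
    convert h1 using 1
    rw [increment, increment, map_mul (GeneralLinearGroup.map _),
      map_mul (GeneralLinearGroup.map _) (S.x a b h c), S.x_map, S.x_map]
    group
  induction hg using Subgroup.closure_induction_left with
  | one => exact fun γ _ => ⟨1, one_mem _, fun r => by simp [increment]⟩
  | mul_left _ hx g _ ih =>
    obtain ⟨a, b, h, c, rfl⟩ := hx
    exact step a b h c g ih
  | inv_mul_cancel _ hx g _ ih =>
    obtain ⟨a, b, h, c, rfl⟩ := hx
    rw [← S.x_neg]
    exact step a b h (-c) g ih

/-- The difference is `T r` with `s r = 0`; the substitution `T ↦ s T` supplies the factor `s` that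
kills it. -/
theorem scale_eq_of_mul_eq {s : A} {p q : A[X][X]}
    (h : Polynomial.C (Polynomial.C s) * (p - q) = 0) (h0 : p.coeff 0 = q.coeff 0) :
    scale s p = scale s q := by
  rw [← sub_eq_zero, ← map_sub]
  have h1 : (p - q).coeff 0 = 0 := by rw [Polynomial.coeff_sub, h0, sub_self]
  obtain ⟨r, hr⟩ := Polynomial.X_dvd_iff.mpr h1
  rw [hr] at h ⊢
  have h2 : Polynomial.C (Polynomial.C s) * r = 0 := by
    rw [mul_left_comm] at h
    ext n : 1
    have := congrArg (fun q => q.coeff (n + 1)) h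
    simpa [-Polynomial.coeff_C_mul] using this
  have h3 : scale s (Polynomial.C (Polynomial.C s)) = Polynomial.C (Polynomial.C s) := by
    simp [scale]
  have h4 : scale s Polynomial.X = Polynomial.C (Polynomial.C s) * Polynomial.X := by
    simp [scale]
  rw [map_mul, h4, mul_right_comm, ← h3, ← map_mul, h2, map_zero, zero_mul]

/-- An elementary lift of the localized increment may differ from the increment by torsion.
Normalized to be `1` at `T = 0`, it agrees with the increment after a scaling of `T` by an element
that kills this torsion. -/
theorem exists_increment_mem {α : GL (Fin N) A[X]}
    (hα : GeneralLinearGroup.map (Polynomial.mapRingHom (algebraMap A L)) α ∈ S.E L[X]) :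
    ∃ s ∈ M, increment s α ∈ S.E A[X][X] := by
  set Φ := Polynomial.mapRingHom (Polynomial.mapRingHom (algebraMap A L)) with hΦ
  obtain ⟨s, hs, H⟩ := S.exists_conj_increment_mem M hα 1 (one_mem _)
  obtain ⟨e, he, hes⟩ := H 1
  rw [mul_one, one_mul, inv_one, mul_one, ← map_increment] at hes
  set z : A[X][X] →+* A[X][X] := evalZero A[X]
  have hz : GeneralLinearGroup.map z (increment s α) = 1 := by
    have h1 : z.comp (shift s) = Polynomial.C := by
      change (Polynomial.C.comp (Polynomial.evalRingHom 0)).comp (shift s) = _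
      rw [RingHom.comp_assoc, evalZero_comp_shift, RingHom.comp_id]
    have h2 : z.comp Polynomial.C = Polynomial.C := RingHom.ext fun p => by simp [z, evalZero]
    rw [increment, map_mul, map_inv, map_map_GL, map_map_GL, h1, h2, mul_inv_cancel]
  -- The increment is `1` at `T = 0`, so dividing by the value at `T = 0` does not change the image
  -- over the localization.
  set e' := e * (GeneralLinearGroup.map z e)⁻¹
  have he' : e' ∈ S.E A[X][X] := mul_mem he (inv_mem (S.map_mem_E z he))
  have hΦz : ∀ g : GL (Fin N) A[X][X], GeneralLinearGroup.map Φ (GeneralLinearGroup.map z g) =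
      GeneralLinearGroup.map (evalZero L[X]) (GeneralLinearGroup.map Φ g) := fun g =>
    map_evalZero_comm _ g
  have hzz : z.comp z = z := RingHom.ext fun p => by simp [z, evalZero]
  have hze' : GeneralLinearGroup.map z e' = 1 := by
    rw [map_mul, map_inv, map_map_GL, hzz, mul_inv_cancel]
  have hee : GeneralLinearGroup.map Φ e' = GeneralLinearGroup.map Φ (increment s α) := by
    rw [map_mul, map_inv, hΦz, hes, ← hΦz, hz, map_one, inv_one, mul_one]
  obtain ⟨_, ⟨_, ⟨t, ht, rfl⟩, rfl⟩, Ht⟩ :=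
    (killsKernel_algebraMap (L := L) M).mapRingHom.mapRingHom.exists_forall
    (Finset.univ : Finset (Fin N × Fin N)) (fun p => e'.1 p.1 p.2 - (increment s α).1 p.1 p.2)
    (fun p _ => by
      rw [map_sub, sub_eq_zero]
      exact congrArg (fun g : GL (Fin N) L[X][X] => g.1 p.1 p.2) hee)
  refine ⟨s * t, mul_mem hs ht, ?_⟩
  have h1 : increment (s * t) α = GeneralLinearGroup.map (scale t) (increment s α) := by
    rw [increment, increment, map_mul, map_inv, map_map_GL, map_map_GL, scale_comp_C,
      scale_comp_shift]
  have h2 : GeneralLinearGroup.map (scale t) (increment s α) =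
      GeneralLinearGroup.map (scale t) e' := by
    ext a b : 2
    refine (scale_eq_of_mul_eq (Ht (a, b) (Finset.mem_univ _)) ?_).symm
    have h3 := congrArg (fun g : GL (Fin N) A[X][X] => g.1 a b) (hze'.trans hz.symm)
    have h4 := Polynomial.C_injective (show Polynomial.C _ = Polynomial.C _ from h3)
    simpa [Polynomial.coeff_zero_eq_eval_zero] using h4
  rw [h1, h2]
  exact S.map_mem_E _ he'

/-- The ideal of those `s` for which `α(X + s T) α(X)⁻¹` is elementary. -/
noncomputable def incrementIdeal (α : GL (Fin N) A[X]) : Ideal A where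
  carrier := {s | increment s α ∈ S.E A[X][X]}
  zero_mem' := by
    change increment 0 α ∈ S.E A[X][X]
    rw [increment, shift_zero, mul_inv_cancel]
    exact one_mem _
  -- `α(X + (s+t)T) α(X)⁻¹` is the increment for `s`, moved by `X ↦ X + t T`, times the increment
  -- for `t`.
  add_mem' {s t} hs ht := by
    have h := mul_mem (S.map_mem_E (move t) hs) ht
    rw [increment, increment, map_mul, map_inv, map_map_GL, map_map_GL, move_comp_shift,
      move_comp_C, ← mul_assoc, inv_mul_cancel_right] at h
    exact h
  smul_mem' r s hs := by
    have h := S.map_mem_E (scale r) hs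
    rw [increment, map_mul, map_inv, map_map_GL, map_map_GL, scale_comp_shift, scale_comp_C,
      mul_comm] at h
    exact h

/-- The local-global principle: a matrix over `A[X]` which is elementary locally on `A` is
elementary up to its constant term. -/
theorem mul_constTerm_inv_mem_E_of_local {α : GL (Fin N) A[X]}
    (hα : ∀ p : Ideal A, ∀ _ : p.IsMaximal, GeneralLinearGroup.map
      (Polynomial.mapRingHom (algebraMap A (Localization.AtPrime p))) α ∈
        S.E (Localization.AtPrime p)[X]) :
    α * (GeneralLinearGroup.map Polynomial.C (constTerm A α))⁻¹ ∈ S.E A[X] := by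
  have htop : S.incrementIdeal α = ⊤ := by
    by_contra hne
    obtain ⟨p, hp, hle⟩ := Ideal.exists_le_maximal _ hne
    obtain ⟨s, hs, hs'⟩ := S.exists_increment_mem p.primeCompl (hα p hp)
    exact hs (hle hs')
  have h1 : increment 1 α ∈ S.E A[X][X] := (Ideal.eq_top_iff_one _).mp htop
  -- The substitution `X ↦ 0`, `T ↦ X` turns `α(X + T) α(X)⁻¹` into `α(X) α(0)⁻¹`.
  set f : A[X][X] →+* A[X] := Polynomial.eval₂RingHom (evalZero A) Polynomial.X
  have h2 : f.comp (shift 1) = RingHom.id _ :=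
    Polynomial.ringHom_ext (fun a => by simp [f, shift, evalZero])
      (by simp [f, shift, evalZero])
  have h3 : f.comp Polynomial.C = evalZero A := RingHom.ext fun p => by simp [f]
  have h4 := S.map_mem_E f h1
  rw [increment, map_mul, map_inv, map_map_GL, map_map_GL, h2, h3] at h4
  exact h4

end ElementarySystem

/-! ### Glueing on the projective line. -/

section Glueing

variable (A : Type u) [CommRing A]

/-- The polynomials with constant coefficient `1`. -/
def coeffZeroOne : Submonoid A[X] where
  carrier := {g | g.coeff 0 = 1}
  one_mem' := by simp
  mul_mem' {g h} hg hh := by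
    change (g * h).coeff 0 = 1
    rw [Polynomial.mul_coeff_zero, hg, hh, one_mul]

/-- The monic polynomials. -/
def monics : Submonoid A[X] where
  carrier := {f | f.Monic}
  one_mem' := Polynomial.monic_one
  mul_mem' hf hg := Polynomial.Monic.mul hf hg

/-- The localization of `A[X]` at the polynomials with constant coefficient `1`. -/
abbrev LocZero : Type u := Localization (coeffZeroOne A)

/-- The localization of `A[X]` at the monic polynomials. -/
abbrev LocMonic : Type u := Localization (monics A)

/-- The localization of the Laurent polynomial ring at the polynomials with constant
coefficient `1`. -/
abbrev LocBoth : Type u :=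
  Localization ((coeffZeroOne A).map (Polynomial.toLaurent : A[X] →+* A[T;T⁻¹]))

/-- The comparison map between the two localizations at polynomials with constant coefficient
`1`. -/
noncomputable def locZeroToBoth : LocZero A →+* LocBoth A :=
  IsLocalization.map (LocBoth A) (Polynomial.toLaurent : A[X] →+* A[T;T⁻¹])
    (Submonoid.le_comap_map (coeffZeroOne A))

variable {A}

theorem locZeroToBoth_comp : (locZeroToBoth A).comp (algebraMap A[X] (LocZero A)) =
    (algebraMap A[T;T⁻¹] (LocBoth A)).comp Polynomial.toLaurent :=
  IsLocalization.map_comp _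

theorem locZeroToBoth_injective : Function.Injective (locZeroToBoth A) :=
  IsLocalization.map_injective_of_injective (coeffZeroOne A) (LocZero A) (LocBoth A)
    Polynomial.toLaurent_injective

theorem isCoprime_X_pow {g : A[X]} (hg : g ∈ coeffZeroOne A) (n : ℕ) :
    IsCoprime (Polynomial.X ^ n) g := by
  refine IsCoprime.pow_left ?_
  obtain ⟨q, hq⟩ : Polynomial.X ∣ g - 1 := by
    rw [Polynomial.X_dvd_iff, Polynomial.coeff_sub, show g.coeff 0 = 1 from hg]
    simp
  exact ⟨-q, 1, by linear_combination hq⟩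

/-- Every power of `X` is coprime to `g`, hence divides `p`. So inverting `coeffZeroOne` loses
nothing, even if `A` has zero divisors. -/
theorem eq_zero_of_mul_eq_zero {g p : A[X]} (hg : g ∈ coeffZeroOne A) (h : g * p = 0) : p = 0 := by
  ext n
  exact Polynomial.X_pow_dvd_iff.mp ((isCoprime_X_pow hg (n + 1)).dvd_of_dvd_mul_left
    (h ▸ dvd_zero _)) n (Nat.lt_succ_self n)

theorem algebraMap_locBoth_injective : Function.Injective (algebraMap A[T;T⁻¹] (LocBoth A)) := by
  rw [injective_iff_map_eq_zero]
  intro a ha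
  obtain ⟨⟨_, g, hg, rfl⟩, h⟩ := (IsLocalization.map_eq_zero_iff
    ((coeffZeroOne A).map (Polynomial.toLaurent : A[X] →+* A[T;T⁻¹])) _ a).mp ha
  obtain ⟨n, p, hp⟩ := LaurentPolynomial.exists_T_pow a
  have h1 : Polynomial.toLaurent (g * p) = 0 := by
    rw [map_mul, hp, ← mul_assoc]
    change Polynomial.toLaurent g * a = 0 at h
    rw [h, zero_mul]
  have h2 := eq_zero_of_mul_eq_zero hg
    (Polynomial.toLaurent_injective (h1.trans (map_zero _).symm))
  rw [h2, map_zero] at hp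
  exact ((LaurentPolynomial.isUnit_T (n : ℤ)).mul_left_eq_zero.mp hp.symm)

/-- Writing `a = q / Xⁿ` and `b = p / g` gives `q g = Xⁿ p`, and coprimality of `Xⁿ` and `g` forces
`Xⁿ ∣ q`. -/
theorem exists_glue_elem {a : A[T;T⁻¹]} {b : LocZero A}
    (h : algebraMap A[T;T⁻¹] (LocBoth A) a = locZeroToBoth A b) :
    ∃ p : A[X], Polynomial.toLaurent p = a := by
  obtain ⟨⟨p, g⟩, hp⟩ := IsLocalization.surj (coeffZeroOne A) b
  have h1 : a * Polynomial.toLaurent (g : A[X]) = Polynomial.toLaurent p := by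
    apply algebraMap_locBoth_injective
    have e : ∀ q, algebraMap A[T;T⁻¹] (LocBoth A) (Polynomial.toLaurent q) =
        locZeroToBoth A (algebraMap A[X] (LocZero A) q) := fun q =>
      (congrArg (fun f : A[X] →+* LocBoth A => f q) locZeroToBoth_comp).symm
    rw [map_mul, e, e, h, ← map_mul]
    exact congrArg _ hp
  obtain ⟨n, q, hq⟩ := LaurentPolynomial.exists_T_pow a
  have h2 : q * (g : A[X]) = Polynomial.X ^ n * p := by
    apply Polynomial.toLaurent_injective
    rw [map_mul, map_mul, hq, ← h1, map_pow, Polynomial.toLaurent_X, LaurentPolynomial.T_pow,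
      mul_one]
    ring
  obtain ⟨r, hr⟩ := (isCoprime_X_pow g.2 n).dvd_of_dvd_mul_right (Dvd.intro p h2.symm)
  refine ⟨r, ?_⟩
  have h3 : Polynomial.toLaurent r * LaurentPolynomial.T n = a * LaurentPolynomial.T n := by
    rw [← hq, hr, map_mul, map_pow, Polynomial.toLaurent_X, LaurentPolynomial.T_pow, mul_one,
      mul_comm]
  exact (LaurentPolynomial.isUnit_T (n : ℤ)).mul_left_injective h3

theorem exists_glue {N : ℕ} {a : GL (Fin N) A[T;T⁻¹]} {b : GL (Fin N) (LocZero A)}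
    (h : GeneralLinearGroup.map (algebraMap A[T;T⁻¹] (LocBoth A)) a =
      GeneralLinearGroup.map (locZeroToBoth A) b) :
    ∃ β : GL (Fin N) A[X], GeneralLinearGroup.map Polynomial.toLaurent β = a ∧
      GeneralLinearGroup.map (algebraMap A[X] (LocZero A)) β = b := by
  have h' := congrArg (·⁻¹) h
  simp only [← map_inv] at h'
  obtain ⟨β, hβ⟩ := exists_lift_GL Polynomial.toLaurent_injective (g := a)
    (fun i j => exists_glue_elem
      (congrArg (fun k : GL (Fin N) (LocBoth A) => k.1 i j) h))
    (fun i j => exists_glue_elem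
      (congrArg (fun k : GL (Fin N) (LocBoth A) => k.1 i j) h'))
  refine ⟨β, hβ, glMap_injective locZeroToBoth_injective ?_⟩
  rw [← h, ← hβ, map_map_GL, map_map_GL, locZeroToBoth_comp]

theorem locZeroToBoth_algebraMap (q : A[X]) : locZeroToBoth A (algebraMap A[X] (LocZero A) q) =
    algebraMap A[T;T⁻¹] (LocBoth A) (Polynomial.toLaurent q) :=
  congrArg (fun f : A[X] →+* LocBoth A => f q) locZeroToBoth_comp

theorem toLaurentInv_mul_T (p : A[X]) :
    toLaurentInv A p * LaurentPolynomial.T p.natDegree = Polynomial.toLaurent p.reverse := by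
  rw [LaurentPolynomial.toLaurent_reverse, toLaurentInv_eq]

/-- Multiplied by `Tᵈ`, with `d` the degree of `x`, the left side is the reversed polynomial, of
degree at most `d`; hence `y` has degree zero. -/
theorem eq_C_of_toLaurentInv_eq {x y : A[X]} (h : toLaurentInv A x = Polynomial.toLaurent y) :
    y = Polynomial.C (y.coeff 0) := by
  have h1 : Polynomial.toLaurent (y * Polynomial.X ^ x.natDegree) =
      Polynomial.toLaurent x.reverse := by
    rw [← toLaurentInv_mul_T, h, map_mul, map_pow, Polynomial.toLaurent_X, LaurentPolynomial.T_pow,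
      mul_one]
  have h2 := congrArg Polynomial.natDegree (Polynomial.toLaurent_injective h1)
  apply Polynomial.eq_C_of_natDegree_eq_zero
  by_cases hy : y = 0
  · simp [hy]
  have := Polynomial.reverse_natDegree_le x
  nontriviality A
  rw [Polynomial.natDegree_mul_X_pow _ hy] at h2
  omega

/-- Up to a power of `T`, the value of a monic polynomial at `T⁻¹` is its reverse, which has
constant coefficient `1`. -/
theorem isUnit_toLaurentInv_monic (f : monics A) :
    IsUnit ((algebraMap A[T;T⁻¹] (LocBoth A)).comp (toLaurentInv A) f) := by
  have h1 : (f : A[X]).reverse ∈ coeffZeroOne A := by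
    change (f : A[X]).reverse.coeff 0 = 1
    rw [Polynomial.coeff_zero_reverse]
    exact f.2
  have h2 := IsLocalization.map_units (LocBoth A)
    (⟨Polynomial.toLaurent (f : A[X]).reverse, _, h1, rfl⟩ :
      (coeffZeroOne A).map (Polynomial.toLaurent : A[X] →+* A[T;T⁻¹]))
  change IsUnit (algebraMap A[T;T⁻¹] (LocBoth A) (Polynomial.toLaurent (f : A[X]).reverse)) at h2
  rw [← toLaurentInv_mul_T, map_mul] at h2
  exact isUnit_of_mul_isUnit_left h2

variable (A) in
/-- The homomorphism `X ↦ T⁻¹` from the localization at the monic polynomials. -/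
noncomputable def locMonicToBoth : LocMonic A →+* LocBoth A :=
  IsLocalization.lift (isUnit_toLaurentInv_monic (A := A))

theorem locMonicToBoth_comp : (locMonicToBoth A).comp (algebraMap A[X] (LocMonic A)) =
    (algebraMap A[T;T⁻¹] (LocBoth A)).comp (toLaurentInv A) :=
  IsLocalization.lift_comp _

theorem locZeroToBoth_mk'_mul (q : A[X]) (g : coeffZeroOne A) :
    locZeroToBoth A (IsLocalization.mk' (LocZero A) q g) *
      algebraMap A[T;T⁻¹] (LocBoth A) (Polynomial.toLaurent (g : A[X])) =
      algebraMap A[T;T⁻¹] (LocBoth A) (Polynomial.toLaurent q) := by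
  rw [← locZeroToBoth_algebraMap, ← map_mul, IsLocalization.mk'_spec, locZeroToBoth_algebraMap]

theorem isUnit_algebraMap_locBoth {g : A[X]} (hg : g ∈ coeffZeroOne A) :
    IsUnit (algebraMap A[T;T⁻¹] (LocBoth A) (Polynomial.toLaurent g)) :=
  IsLocalization.map_units (LocBoth A)
    (⟨Polynomial.toLaurent g, g, hg, rfl⟩ :
      (coeffZeroOne A).map (Polynomial.toLaurent : A[X] →+* A[T;T⁻¹]))

theorem hasDenominators_locZeroToBoth : HasDenominators (locZeroToBoth A)
    (Submonoid.powers (algebraMap A[X] (LocZero A) Polynomial.X)) := by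
  intro l
  obtain ⟨⟨a, _, g, hg, rfl⟩, h⟩ := IsLocalization.surj
    ((coeffZeroOne A).map (Polynomial.toLaurent : A[X] →+* A[T;T⁻¹])) l
  change l * algebraMap A[T;T⁻¹] (LocBoth A) (Polynomial.toLaurent g) =
    algebraMap A[T;T⁻¹] (LocBoth A) a at h
  obtain ⟨n, q, hq⟩ := LaurentPolynomial.exists_T_pow a
  refine ⟨_, ⟨n, rfl⟩, IsLocalization.mk' (LocZero A) q ⟨g, hg⟩, ?_⟩
  apply (isUnit_algebraMap_locBoth hg).mul_left_injective
  change _ * algebraMap A[T;T⁻¹] (LocBoth A) (Polynomial.toLaurent g) =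
    _ * algebraMap A[T;T⁻¹] (LocBoth A) (Polynomial.toLaurent g)
  rw [mul_assoc, h]
  refine (locZeroToBoth_mk'_mul q ⟨g, hg⟩).trans ?_
  change _ = locZeroToBoth A (algebraMap A[X] (LocZero A) Polynomial.X ^ n) * _
  rw [hq, ← map_pow, locZeroToBoth_algebraMap, ← map_mul, map_pow, Polynomial.toLaurent_X,
    LaurentPolynomial.T_pow, mul_one, mul_comm]

theorem exists_T_pow_of_mem_map {J : Ideal A} {a : A[T;T⁻¹]}
    (ha : a ∈ J.map (LaurentPolynomial.C : A →+* A[T;T⁻¹])) :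
    ∃ n : ℕ, ∃ q ∈ polyIdeal J, Polynomial.toLaurent q = a * LaurentPolynomial.T n := by
  obtain ⟨p, hp, q, hq, rfl⟩ := exists_add_eq_of_mem_map ha
  refine ⟨q.natDegree, p * Polynomial.X ^ q.natDegree + q.reverse,
    add_mem (Ideal.mul_mem_right _ _ hp) ?_, ?_⟩
  · rw [Ideal.mem_map_C_iff] at hq ⊢
    intro n
    rw [Polynomial.coeff_reverse]
    exact hq _
  · rw [map_add, map_mul, map_pow, Polynomial.toLaurent_X, LaurentPolynomial.T_pow, mul_one,
      ← toLaurentInv_mul_T, add_mul]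

/-- For `c = a / g` with `q = Tᵏ a` polynomial, the partition of unity `u Xⁿ⁺ᵏ + v s g = 1` gives `c
= s (v a) + Xⁿ (u q / g)`. It exists because `s g` has constant coefficient `1`. -/
theorem exists_split_elem (J : Ideal A) (c : LocBoth A)
    (hc : c ∈ (J.map (LaurentPolynomial.C : A →+* A[T;T⁻¹])).map
      (algebraMap A[T;T⁻¹] (LocBoth A)))
    (s : A[T;T⁻¹]) (hs : s ∈ (coeffZeroOne A).map (Polynomial.toLaurent : A[X] →+* A[T;T⁻¹]))
    (t : LocZero A) (ht : t ∈ Submonoid.powers (algebraMap A[X] (LocZero A) Polynomial.X)) :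
    ∃ r₁ ∈ J.map (LaurentPolynomial.C : A →+* A[T;T⁻¹]),
      ∃ r₂ ∈ (polyIdeal J).map (algebraMap A[X] (LocZero A)),
        c = algebraMap A[T;T⁻¹] (LocBoth A) (s * r₁) + locZeroToBoth A (t * r₂) := by
  obtain ⟨⟨⟨a, ha⟩, _, g, hg, rfl⟩, h⟩ := (IsLocalization.mem_map_algebraMap_iff
    ((coeffZeroOne A).map (Polynomial.toLaurent : A[X] →+* A[T;T⁻¹])) (LocBoth A)).mp hc
  change c * algebraMap A[T;T⁻¹] (LocBoth A) (Polynomial.toLaurent g) =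
    algebraMap A[T;T⁻¹] (LocBoth A) a at h
  obtain ⟨s, hs, rfl⟩ := hs
  obtain ⟨n, rfl⟩ := ht
  obtain ⟨k, q, hq, hqa⟩ := exists_T_pow_of_mem_map ha
  obtain ⟨u, v, huv⟩ := isCoprime_X_pow (mul_mem hs hg) (n + k)
  refine ⟨Polynomial.toLaurent v * a, Ideal.mul_mem_left _ _ ha,
    IsLocalization.mk' (LocZero A) (u * q) ⟨g, hg⟩, ?_, ?_⟩
  · rw [IsLocalization.mk'_eq_mul_mk'_one]
    exact Ideal.mul_mem_right _ _ (Ideal.mem_map_of_mem _ (Ideal.mul_mem_left _ _ hq))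
  apply (isUnit_algebraMap_locBoth hg).mul_left_injective
  change _ * algebraMap A[T;T⁻¹] (LocBoth A) (Polynomial.toLaurent g) =
    _ * algebraMap A[T;T⁻¹] (LocBoth A) (Polynomial.toLaurent g)
  have e := locZeroToBoth_mk'_mul (u * q) ⟨g, hg⟩
  change _ * algebraMap A[T;T⁻¹] (LocBoth A) (Polynomial.toLaurent g) = _ at e
  have huv' := congrArg (Polynomial.toLaurent : A[X] →+* A[T;T⁻¹]) huv
  rw [h, map_mul (locZeroToBoth A), add_mul, mul_assoc (locZeroToBoth A _), e]
  change _ = _ + locZeroToBoth A (algebraMap A[X] (LocZero A) Polynomial.X ^ n) * _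
  rw [← map_pow, locZeroToBoth_algebraMap, ← map_mul, ← map_mul, ← map_add]
  congr 1
  rw [map_mul Polynomial.toLaurent u q, hqa]
  simp only [map_add, map_mul, map_pow, map_one, Polynomial.toLaurent_X] at huv' ⊢
  rw [show (LaurentPolynomial.T k : A[T;T⁻¹]) = LaurentPolynomial.T 1 ^ k by
    rw [LaurentPolynomial.T_pow, mul_one]]
  linear_combination -a * huv'

end Glueing

/-! ### Horrocks' theorem. -/

namespace ElementarySystem

variable {N : ℕ} (S : ElementarySystem.{u} N) {A : Type u} [CommRing A]

/-- The extension of `J` to the common localization of `A[T,T⁻¹]`. -/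
noncomputable abbrev bothIdeal (J : Ideal A) : Ideal (LocBoth A) :=
  (J.map (LaurentPolynomial.C : A →+* A[T;T⁻¹])).map (algebraMap A[T;T⁻¹] (LocBoth A))

theorem exists_split_locBoth (J : Ideal A) {g : GL (Fin N) (LocBoth A)}
    (hg : g ∈ S.relE (LocBoth A) (bothIdeal J)) :
    ∃ g₁ ∈ S.relE A[T;T⁻¹] (J.map LaurentPolynomial.C),
      ∃ g₂ ∈ S.E (LocZero A), g =
        GeneralLinearGroup.map (algebraMap A[T;T⁻¹] (LocBoth A)) g₁ *
          GeneralLinearGroup.map (locZeroToBoth A) g₂ := by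
  obtain ⟨g₁, h₁, g₂, h₂, e⟩ := S.exists_split (algebraMap A[T;T⁻¹] (LocBoth A)) (locZeroToBoth A)
    (hasDenominators_algebraMap ((coeffZeroOne A).map (Polynomial.toLaurent : A[X] →+* A[T;T⁻¹])))
    hasDenominators_locZeroToBoth (J.map LaurentPolynomial.C)
    ((polyIdeal J).map (algebraMap A[X] (LocZero A))) (bothIdeal J) (exists_split_elem J) hg
  exact ⟨g₁, h₁, g₂, S.relE_le_E _ h₂, e⟩

theorem eq_map_C_of_map_eq {g h : GL (Fin N) A[X]} (e : GeneralLinearGroup.map (toLaurentInv A) g =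
    GeneralLinearGroup.map Polynomial.toLaurent h) :
    h = GeneralLinearGroup.map Polynomial.C (constTerm A h) ∧ g = h := by
  have h1 : h = GeneralLinearGroup.map Polynomial.C (constTerm A h) := by
    ext a b : 2
    have := eq_C_of_toLaurentInv_eq (congrArg (fun k : GL (Fin N) A[T;T⁻¹] => k.1 a b) e)
    rw [this]
    simp [constTerm, Polynomial.coeff_zero_eq_eval_zero]
  refine ⟨h1, glMap_injective toLaurentInv_injective ?_⟩
  rw [e, h1, ← map_C_eq_toLaurent, map_C_eq_toLaurentInv]

/-- A nonzero polynomial over the residue field is a unit times a monic polynomial; both lift, and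
the monic lift is invertible here. This is the hypothesis of the Bruhat decomposition modulo the
maximal ideal. -/
theorem mem_or_exists_unit_sub_mem [IsLocalRing A] (c : LocMonic A) :
    c ∈ (polyIdeal (IsLocalRing.maximalIdeal A)).map (algebraMap A[X] (LocMonic A)) ∨
      ∃ e : (LocMonic A)ˣ,
        c - e ∈ (polyIdeal (IsLocalRing.maximalIdeal A)).map (algebraMap A[X] (LocMonic A)) := by
  have hker : ∀ p : A[X], p.map (IsLocalRing.residue A) = 0 →
      p ∈ polyIdeal (IsLocalRing.maximalIdeal A) := fun p hp => by
    rw [Ideal.mem_map_C_iff]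
    intro n
    have := congrArg (fun q => q.coeff n) hp
    simpa [Polynomial.coeff_map] using this
  obtain ⟨⟨p, f⟩, rfl⟩ := IsLocalization.mk'_surjective (monics A) c
  change IsLocalization.mk' _ p f ∈ _ ∨ _
  by_cases hp : p.map (IsLocalRing.residue A) = 0
  · left
    rw [IsLocalization.mk'_eq_mul_mk'_one]
    exact Ideal.mul_mem_right _ _ (Ideal.mem_map_of_mem _ (hker p hp))
  right
  have hlc : (p.map (IsLocalRing.residue A)).leadingCoeff ≠ 0 := by simpa using hp
  obtain ⟨u, hu⟩ := IsLocalRing.residue_surjective (p.map (IsLocalRing.residue A)).leadingCoeff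
  have huu : IsUnit u := by
    rw [← IsLocalRing.residue_ne_zero_iff_isUnit, hu]
    exact hlc
  obtain ⟨q, hq, -, hqm⟩ := Polynomial.lifts_and_degree_eq_and_monic
    (f := IsLocalRing.residue A)
    (p := p.map (IsLocalRing.residue A) *
      Polynomial.C (p.map (IsLocalRing.residue A)).leadingCoeff⁻¹)
    (by
      rw [Polynomial.mem_lifts]
      exact Polynomial.map_surjective _ IsLocalRing.residue_surjective _)
    (Polynomial.monic_mul_leadingCoeff_inv hp)
  have hpq : p - Polynomial.C u * q ∈ polyIdeal (IsLocalRing.maximalIdeal A) := by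
    apply hker
    rw [Polynomial.map_sub, Polynomial.map_mul, hq, Polynomial.map_C, hu, mul_left_comm,
      ← Polynomial.C_mul, mul_inv_cancel₀ hlc]
    simp
  have hunit : IsUnit (algebraMap A[X] (LocMonic A) (Polynomial.C u * q) *
      IsLocalization.mk' (LocMonic A) 1 f) := by
    rw [map_mul]
    refine IsUnit.mul (IsUnit.mul ((huu.map Polynomial.C).map _)
      (IsLocalization.map_units (LocMonic A) (⟨q, hqm⟩ : monics A))) ?_
    exact IsUnit.of_mul_eq_one _ (by rw [IsLocalization.mk'_spec]; exact map_one _)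
  refine ⟨hunit.unit, ?_⟩
  change IsLocalization.mk' _ p f - _ ∈ _
  rw [IsUnit.unit_spec, IsLocalization.mk'_eq_mul_mk'_one p, ← sub_mul, ← map_sub]
  exact Ideal.mul_mem_right _ _ (Ideal.mem_map_of_mem _ hpq)

theorem map_locMonicToBoth_mem (J : Ideal A) (c : LocMonic A)
    (hc : c ∈ (polyIdeal J).map (algebraMap A[X] (LocMonic A))) :
    locMonicToBoth A c ∈ bothIdeal J := by
  have h1 : (toLaurentInv A).comp Polynomial.C = LaurentPolynomial.C :=
    RingHom.ext fun a => toLaurentInv_C a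
  have := Ideal.mem_map_of_mem (locMonicToBoth A) hc
  rwa [Ideal.map_map, locMonicToBoth_comp, ← Ideal.map_map, Ideal.map_map (I := J), h1] at this

/-- Horrocks' theorem over a local ring. -/
theorem mem_E_of_isLocalRing [IsLocalRing A] {α : GL (Fin N) A[X]} (hG : α ∈ S.G A[X])
    (hα : GeneralLinearGroup.map (algebraMap A[X] (LocMonic A)) α ∈ S.E (LocMonic A)) :
    α ∈ S.E A[X] := by
  set m := IsLocalRing.maximalIdeal A
  have hk : S.G (IsLocalRing.ResidueField A)[X] ≤ S.E (IsLocalRing.ResidueField A)[X] :=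
    S.G_le_E_of_euclideanDomain
  -- Over the Euclidean ring of polynomials over the residue field the reduction of `α` is
  -- elementary; dividing by a lift makes `α` trivial modulo the maximal ideal.
  obtain ⟨e, he, hee⟩ := S.exists_lift_E (φ := Polynomial.mapRingHom (IsLocalRing.residue A))
    (Polynomial.map_surjective (IsLocalRing.residue A) IsLocalRing.residue_surjective)
    (hk (S.map_mem_G (Polynomial.mapRingHom (IsLocalRing.residue A)) hG))
  have hmJ : m ≤ Ideal.jacobson ⊥ :=
    (IsLocalRing.jacobson_eq_maximalIdeal (⊥ : Ideal A) bot_ne_top).ge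
  suffices h : e⁻¹ * α ∈ S.E A[X] by simpa using mul_mem he h
  set β := e⁻¹ * α with hβ
  have hβG : β ∈ S.G A[X] := mul_mem (inv_mem (S.E_le_G he)) hG
  have hβm : β ∈ relGL N A[X] (polyIdeal m) := by
    have h1 : GeneralLinearGroup.map (Polynomial.mapRingHom (IsLocalRing.residue A)) β = 1 := by
      rw [hβ, map_mul, map_inv, hee, inv_mul_cancel]
    rw [mem_relGL]
    intro a b
    have h2 := congrArg (fun k : GL (Fin N) (IsLocalRing.ResidueField A)[X] => k.1 a b) h1
    have h3 : polyIdeal m = RingHom.ker (Polynomial.mapRingHom (IsLocalRing.residue A)) := by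
      rw [Polynomial.ker_mapRingHom, IsLocalRing.ker_residue]
    rw [h3, RingHom.mem_ker, map_sub, sub_eq_zero]
    refine h2.trans ?_
    rcases eq_or_ne a b with rfl | hab <;> simp [*]
  -- The Bruhat decomposition turns elementary and congruent to `1` into relative elementary; only
  -- this allows the later factorization with an ideal in the Jacobson radical.
  have hβE : GeneralLinearGroup.map (algebraMap A[X] (LocMonic A)) β ∈ S.relE (LocMonic A)
      ((polyIdeal m).map (algebraMap A[X] (LocMonic A))) := by
    refine S.E_inf_relGL_le _ mem_or_exists_unit_sub_mem ⟨?_, ?_⟩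
    · change _ ∈ S.E (LocMonic A)
      rw [hβ, map_mul, map_inv]
      exact mul_mem (inv_mem (S.map_mem_E _ he)) hα
    · change _ ∈ relGL _ _ _
      rw [mem_relGL] at hβm ⊢
      intro a b
      have := Ideal.mem_map_of_mem (algebraMap A[X] (LocMonic A)) (hβm a b)
      rw [map_sub] at this
      simpa [Matrix.one_apply] using this
  -- After the splitting, `g⁻¹ β(T⁻¹)` is a Laurent matrix that is regular at `T = 0`, so it is a
  -- polynomial matrix `δ(T)`.
  obtain ⟨g, hg, b, hb, hgb⟩ := S.exists_split_locBoth m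
    (S.map_mem_relE (locMonicToBoth A) (map_locMonicToBoth_mem m) hβE)
  rw [map_map_GL, locMonicToBoth_comp, ← map_map_GL, ← inv_mul_eq_iff_eq_mul, ← map_inv,
    ← map_mul] at hgb
  obtain ⟨δ, hδ, -⟩ := exists_glue hgb
  obtain ⟨k, hk, h, hhG, -, rfl⟩ := S.exists_factorization' hmJ hg
  -- The left side is polynomial in `T⁻¹` and the right side in `T`, so both are the same constant
  -- matrix, which is elementary over the local ring.
  have hconst : GeneralLinearGroup.map (toLaurentInv A) (k⁻¹ * β) =
      GeneralLinearGroup.map Polynomial.toLaurent (h * δ) := by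
    rw [map_mul _ k⁻¹ β, map_mul _ h δ, hδ, map_inv]
    group
  obtain ⟨h1, h2⟩ := eq_map_C_of_map_eq hconst
  have hkE := S.relE_le_E _ hk
  have h3 : constTerm A (h * δ) ∈ S.E A := by
    apply S.G_le_E_of_isLocalRing
    rw [← h2]
    exact S.map_mem_G _ (mul_mem (inv_mem (S.E_le_G hkE)) hβG)
  have h4 := mul_mem hkE (S.map_mem_E Polynomial.C h3)
  rwa [← h1, ← h2, mul_inv_cancel_left] at h4

/-- The hypothesis survives localization at a maximal ideal because monic polynomials stay monic;
there the local theorem applies, and the local-global principle assembles the results. -/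
theorem mul_constTerm_inv_mem_E {α : GL (Fin N) A[X]} (hG : α ∈ S.G A[X])
    (hα : GeneralLinearGroup.map (algebraMap A[X] (LocMonic A)) α ∈ S.E (LocMonic A)) :
    α * (GeneralLinearGroup.map Polynomial.C (constTerm A α))⁻¹ ∈ S.E A[X] := by
  refine S.mul_constTerm_inv_mem_E_of_local fun p hp => ?_
  refine S.mem_E_of_isLocalRing (S.map_mem_G _ hG) ?_
  set f := Polynomial.mapRingHom (algebraMap A (Localization.AtPrime p))
  have hf : monics A ≤ (monics (Localization.AtPrime p)).comap f := fun q hq =>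
    Polynomial.Monic.map _ hq
  have := S.map_mem_E (IsLocalization.map (LocMonic (Localization.AtPrime p)) f hf) hα
  rwa [map_map_GL, IsLocalization.map_comp, ← map_map_GL] at this

variable (A) in
/-- Evaluation at `0` on the localization at the polynomials with constant coefficient `1`. -/
noncomputable def locZeroEval : LocZero A →+* A :=
  IsLocalization.lift (M := coeffZeroOne A) (g := Polynomial.evalRingHom 0) fun g => by
    have : (g : A[X]).coeff 0 = 1 := g.2
    rw [Polynomial.coe_evalRingHom, ← Polynomial.coeff_zero_eq_eval_zero, this]
    exact isUnit_one

/-- Horrocks' theorem: a matrix over `A[X]` which becomes elementary after inverting the monic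
polynomials is elementary. -/
theorem mem_E_of_locMonic {α : GL (Fin N) A[X]} (hG : α ∈ S.G A[X])
    (hα : GeneralLinearGroup.map (algebraMap A[X] (LocMonic A)) α ∈ S.E (LocMonic A)) :
    α ∈ S.E A[X] := by
  have h1 := S.mul_constTerm_inv_mem_E hG hα
  set c := constTerm A α with hc
  set cX := GeneralLinearGroup.map (Polynomial.C : A →+* A[X]) c with hcX
  suffices h : c ∈ S.E A by
    have := mul_mem h1 (S.map_mem_E Polynomial.C h)
    rwa [inv_mul_cancel_right] at this
  have hcG : c ∈ S.G A := S.map_mem_G _ hG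
  -- Both `α` and `α α(0)⁻¹` are elementary over this ring, hence so is the constant `α(0)`.
  have h2 : GeneralLinearGroup.map (algebraMap A[X] (LocMonic A)) cX ∈ S.E (LocMonic A) := by
    have := mul_mem (inv_mem (S.map_mem_E (algebraMap A[X] (LocMonic A)) h1)) hα
    rw [map_mul, map_inv] at this
    simpa using this
  have h3 := S.map_mem_E (locMonicToBoth A) h2
  rw [map_map_GL, locMonicToBoth_comp, ← map_map_GL, ← map_C_eq_toLaurentInv, map_C_eq_toLaurent,
    ← hcX] at h3
  have htop : bothIdeal (⊤ : Ideal A) = ⊤ := by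
    rw [bothIdeal, Ideal.map_top, Ideal.map_top]
  rw [← S.relE_top, ← htop] at h3
  obtain ⟨ε₁, hε₁, ε₂, hε₂, e⟩ := S.exists_split_locBoth ⊤ h3
  replace hε₁ := S.relE_le_E _ hε₁
  rw [← inv_mul_eq_iff_eq_mul, ← map_inv, ← map_mul] at e
  -- The constant is now written as `(c β⁻¹) β` over `A[X]`, where the first factor is elementary
  -- over the Laurent polynomials and the second at `X = 0`. Each factor has an elementary constant
  -- term, for different reasons.
  obtain ⟨β, hβ, hβ'⟩ := exists_glue e
  have hβG : β ∈ S.G A[X] := by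
    have : GeneralLinearGroup.map Polynomial.toLaurent β ∈ S.G A[T;T⁻¹] := by
      rw [hβ]
      exact mul_mem (inv_mem (S.E_le_G hε₁)) (S.map_mem_G _ (S.map_mem_G _ hcG))
    exact S.mem_G_of_map _ _
      (fun b hb _ => Polynomial.toLaurent_injective (by rw [hb, map_zero])) this this
  have hγ : GeneralLinearGroup.map Polynomial.toLaurent (cX * β⁻¹) = ε₁ := by
    rw [map_mul, map_inv, hβ]
    group
  have hXm : (Polynomial.X : A[X]) ∈ monics A := Polynomial.monic_X
  set uX : (LocMonic A)ˣ := (IsLocalization.map_units (LocMonic A)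
    (⟨Polynomial.X, hXm⟩ : monics A)).unit with huX
  -- `X` is monic, so the Laurent polynomial ring maps to the localization at the monic polynomials.
  have hγm : GeneralLinearGroup.map (algebraMap A[X] (LocMonic A)) (cX * β⁻¹) ∈
      S.E (LocMonic A) := by
    have h4 := S.map_mem_E (LaurentPolynomial.eval₂
      ((algebraMap A[X] (LocMonic A)).comp Polynomial.C) uX) hε₁
    have h5 : (LaurentPolynomial.eval₂ ((algebraMap A[X] (LocMonic A)).comp Polynomial.C) uX).comp
        Polynomial.toLaurent = algebraMap A[X] (LocMonic A) :=
      Polynomial.ringHom_ext (fun a => by simp) (by simp [huX])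
    rwa [← hγ, map_map_GL, h5] at h4
  have h6 : cX * β⁻¹ * (GeneralLinearGroup.map Polynomial.C (constTerm A (cX * β⁻¹)))⁻¹ ∈
      S.E A[X] := S.mul_constTerm_inv_mem_E (mul_mem (S.map_mem_G _ hcG) (inv_mem hβG)) hγm
  have h7 : GeneralLinearGroup.map LaurentPolynomial.C (constTerm A (cX * β⁻¹)) ∈
      S.E A[T;T⁻¹] := by
    have := mul_mem (inv_mem (S.map_mem_E Polynomial.toLaurent h6)) (hγ ▸ hε₁)
    rw [← map_inv, ← map_mul, mul_inv_rev, inv_inv, inv_mul_cancel_right] at this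
    rwa [map_C_eq_toLaurent]
  -- A constant matrix that is elementary over the Laurent polynomials is elementary over `A`: set
  -- `T = 1`.
  have h8 := S.map_mem_E (LaurentPolynomial.eval₂ (RingHom.id A) 1) h7
  have h9 : (LaurentPolynomial.eval₂ (RingHom.id A) 1).comp LaurentPolynomial.C = RingHom.id A :=
    RingHom.ext fun a => by simp
  rw [map_map_GL, h9] at h8
  have h10 := S.map_mem_E (locZeroEval A) hε₂
  rw [← hβ', map_map_GL, locZeroEval, IsLocalization.lift_comp] at h10
  have h11 : constTerm A cX = c := by
    ext a b
    simp [constTerm, hcX]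
  -- Taking constant terms in `c = (c β⁻¹) β` exhibits `c` as a product of two elementary matrices.
  have h12 := mul_mem h8 h10
  change constTerm A (cX * β⁻¹) * constTerm A β ∈ S.E A at h12
  rwa [map_mul, map_inv, h11, inv_mul_cancel_right] at h12

end ElementarySystem

/-! ### Reduction of the relative theorem to the absolute one. -/

/-- An invertible matrix lifts along two jointly injective homomorphisms if the entries do. -/
theorem exists_lift_GL₂ {N : ℕ} {D B C : Type*} [CommRing D] [CommRing B] [CommRing C]
    {φ : D →+* B} {ψ : D →+* C} (hinj : ∀ d d', φ d = φ d' → ψ d = ψ d' → d = d')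
    {g : GL (Fin N) B} {h : GL (Fin N) C} (h₁ : ∀ a b, ∃ d, φ d = g.1 a b ∧ ψ d = h.1 a b)
    (h₂ : ∀ a b, ∃ d, φ d = (g⁻¹).1 a b ∧ ψ d = (h⁻¹).1 a b) :
    ∃ k : GL (Fin N) D, GeneralLinearGroup.map φ k = g ∧ GeneralLinearGroup.map ψ k = h := by
  choose M hM hM' using h₁
  choose K hK hK' using h₂
  have e₁ : φ.mapMatrix (Matrix.of M) = g.1 := by ext a b; exact hM a b
  have e₂ : ψ.mapMatrix (Matrix.of M) = h.1 := by ext a b; exact hM' a b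
  have e₃ : φ.mapMatrix (Matrix.of K) = (g⁻¹).1 := by ext a b; exact hK a b
  have e₄ : ψ.mapMatrix (Matrix.of K) = (h⁻¹).1 := by ext a b; exact hK' a b
  have key : ∀ X Y : Matrix (Fin N) (Fin N) D, φ.mapMatrix X = φ.mapMatrix Y →
      ψ.mapMatrix X = ψ.mapMatrix Y → X = Y := fun X Y h h' => by
    ext a b
    exact hinj _ _ (congrFun (congrFun h a) b) (congrFun (congrFun h' a) b)
  refine ⟨⟨Matrix.of M, Matrix.of K, key _ _ ?_ ?_, key _ _ ?_ ?_⟩, Units.ext e₁, Units.ext e₂⟩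
  · rw [map_mul, e₁, e₃, map_one, ← Units.val_mul, mul_inv_cancel, Units.val_one]
  · rw [map_mul, e₂, e₄, map_one, ← Units.val_mul, mul_inv_cancel, Units.val_one]
  · rw [map_mul, e₁, e₃, map_one, ← Units.val_mul, inv_mul_cancel, Units.val_one]
  · rw [map_mul, e₂, e₄, map_one, ← Units.val_mul, inv_mul_cancel, Units.val_one]

namespace doubleRing

variable {R : Type*} [CommRing R] {I : Ideal R}

theorem exists_lift_of_mem_relGL {N : ℕ} {α : GL (Fin N) R[X]}
    (hα : α ∈ relGL N R[X] (polyIdeal I)) : ∃ α' : GL (Fin N) (doubleRing I)[X],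
      GeneralLinearGroup.map (Polynomial.mapRingHom (fst I)) α' = 1 ∧
        GeneralLinearGroup.map (Polynomial.mapRingHom (snd I)) α' = α := by
  have key : ∀ β ∈ relGL N R[X] (polyIdeal I), ∀ a b, ∃ d,
      Polynomial.mapRingHom (fst I) d = (1 : GL (Fin N) R[X]).1 a b ∧
        Polynomial.mapRingHom (snd I) d = β.1 a b := fun β hβ a b => by
    obtain ⟨e, he, he'⟩ := exists_poly_lift (mem_relGL.mp hβ a b)
    refine ⟨e + (1 : Matrix (Fin N) (Fin N) (doubleRing I)[X]) a b, ?_, ?_⟩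
    · rw [map_add, Polynomial.coe_mapRingHom, he]
      rcases eq_or_ne a b with rfl | hab <;> simp [*]
    · rw [map_add, Polynomial.coe_mapRingHom, he']
      rcases eq_or_ne a b with rfl | hab <;> simp [*]
  refine exists_lift_GL₂ (fun _ _ => poly_ext) (key α hα) ?_
  rw [inv_one]
  exact key _ (inv_mem hα)

end doubleRing

section LocMap

variable {R R' : Type*} [CommRing R] [CommRing R']

/-- The homomorphism of localizations induced by a homomorphism of the coefficients. -/
noncomputable def locMap (φ : R' →+* R) {f' : R'[X]} {f : R[X]} (h : f'.map φ = f) :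
    Localization.Away f' →+* Localization.Away f :=
  IsLocalization.map (M := Submonoid.powers f') (T := Submonoid.powers f) (Localization.Away f)
    (Polynomial.mapRingHom φ) (by
      rintro _ ⟨n, rfl⟩
      exact ⟨n, by simp [h]⟩)

variable (φ : R' →+* R) {f' : R'[X]} {f : R[X]} (h : f'.map φ = f)

theorem locMap_comp : (locMap φ h).comp (algebraMap R'[X] (Localization.Away f')) =
    (algebraMap R[X] (Localization.Away f)).comp (Polynomial.mapRingHom φ) :=
  IsLocalization.map_comp _

theorem locMap_algebraMap (p : R'[X]) :
    locMap φ h (algebraMap R'[X] (Localization.Away f') p) =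
      algebraMap R[X] (Localization.Away f) (p.map φ) :=
  congrArg (fun k : R'[X] →+* Localization.Away f => k p) (locMap_comp φ h)

theorem algebraMap_away_injective (hf : f.Monic) :
    Function.Injective (algebraMap R[X] (Localization.Away f)) := by
  refine IsLocalization.injective (M := Submonoid.powers f) _ ?_
  rintro _ ⟨n, rfl⟩
  exact (hf.pow n).mem_nonZeroDivisors

end LocMap

namespace doubleRing

variable {R : Type*} [CommRing R] {I : Ideal R} {f : R[X]}

theorem map_diag_fst (f : R[X]) : (f.map (diag I)).map (fst I) = f := by
  rw [Polynomial.map_map, fst_comp_diag, Polynomial.map_id]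

theorem map_diag_snd (f : R[X]) : (f.map (diag I)).map (snd I) = f := by
  rw [Polynomial.map_map, snd_comp_diag, Polynomial.map_id]

/-- Monic polynomials are not zero divisors, so a numerator that dies in both localizations has both
components zero. -/
theorem loc_ext (hf : f.Monic) {l l' : Localization.Away (f.map (diag I))}
    (h₁ : locMap (fst I) (map_diag_fst f) l = locMap (fst I) (map_diag_fst f) l')
    (h₂ : locMap (snd I) (map_diag_snd f) l = locMap (snd I) (map_diag_snd f) l') : l = l' := by
  rw [← sub_eq_zero] at h₁ h₂ ⊢
  rw [← map_sub] at h₁ h₂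
  generalize l - l' = k at h₁ h₂ ⊢
  obtain ⟨⟨p, s⟩, hs⟩ := IsLocalization.surj (Submonoid.powers (f.map (diag I))) k
  have hp : p = 0 := by
    refine poly_ext ?_ ?_
    · apply algebraMap_away_injective hf
      rw [← locMap_algebraMap _ (map_diag_fst f)]
      erw [← hs]
      rw [map_mul, h₁]
      simp
    · apply algebraMap_away_injective hf
      rw [← locMap_algebraMap _ (map_diag_snd f)]
      erw [← hs]
      rw [map_mul, h₂]
      simp
  have hu := IsLocalization.map_units (Localization.Away (f.map (diag I))) s
  rw [hp, map_zero] at hs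
  exact hu.mul_left_eq_zero.mp hs

theorem locMap_snd_comp_diag : (locMap (snd I) (map_diag_snd f)).comp
    (locMap (diag I) (f' := f) rfl) = RingHom.id _ := by
  refine IsLocalization.ringHom_ext (Submonoid.powers f) ?_
  rw [RingHom.comp_assoc, locMap_comp, ← RingHom.comp_assoc, locMap_comp, RingHom.comp_assoc,
    Polynomial.mapRingHom_comp, snd_comp_diag, Polynomial.mapRingHom_id]
  rfl

theorem exists_loc_lift {c : Localization.Away f} (hc : c ∈ polyIdealAway I f) :
    ∃ e : Localization.Away (f.map (diag I)), locMap (fst I) (map_diag_fst f) e = 0 ∧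
      locMap (snd I) (map_diag_snd f) e = c := by
  induction hc using Submodule.closure_induction with
  | zero => exact ⟨0, by simp, by simp⟩
  | add _ _ _ _ ih ih' =>
    obtain ⟨e, h₁, h₂⟩ := ih
    obtain ⟨e', h₁', h₂'⟩ := ih'
    exact ⟨e + e', by simp [h₁, h₁'], by simp [h₂, h₂']⟩
  | smul_mem r _ h =>
    obtain ⟨a, ha, rfl⟩ := h
    obtain ⟨e, h₁, h₂⟩ := exists_poly_lift ha
    refine ⟨locMap (diag I) (f' := f) rfl r * algebraMap _ _ e, ?_, ?_⟩
    · rw [map_mul, locMap_algebraMap, h₁, map_zero, mul_zero]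
    · rw [map_mul, locMap_algebraMap, h₂]
      have := congrArg (fun k : Localization.Away f →+* _ => k r) (locMap_snd_comp_diag (I := I))
      exact congrArg (· * _) this

end doubleRing

namespace ElementarySystem

variable {N : ℕ} (S : ElementarySystem.{u} N) {R : Type u} [CommRing R]

/-- The monic inversion principle for relative elementary groups. -/
theorem mem_relE_of_monic (I : Ideal R) {α : GL (Fin N) R[X]} (hG : α ∈ S.G R[X])
    (hI : α ∈ relGL N R[X] (polyIdeal I)) {f : R[X]} (hf : f.Monic)
    (hα : locAway f α ∈ S.relE (Localization.Away f) (polyIdealAway I f)) :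
    α ∈ S.relE R[X] (polyIdeal I) := by
  obtain ⟨α', h₁, h₂⟩ := doubleRing.exists_lift_of_mem_relGL hI
  set f' := f.map (doubleRing.diag I) with hf'
  have hG' : α' ∈ S.G (doubleRing I)[X] := by
    refine S.mem_G_of_map (Polynomial.mapRingHom (doubleRing.fst I))
      (Polynomial.mapRingHom (doubleRing.snd I))
      (fun b hb hb' => doubleRing.poly_ext (hb.trans (Polynomial.map_zero _).symm)
        (hb'.trans (Polynomial.map_zero _).symm)) ?_ ?_
    · rw [h₁]; exact one_mem _
    · rw [h₂]; exact hG
  -- The lift `d` has components `1` and `α_f`, the same as the image of `α'`; joint injectivity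
  -- therefore identifies the two.
  obtain ⟨d, hd, hd₁, hd₂⟩ := S.exists_lift_relE
    (p₁ := locMap (doubleRing.fst I) (doubleRing.map_diag_fst f))
    (p₂ := locMap (doubleRing.snd I) (doubleRing.map_diag_snd f))
    (s := locMap (doubleRing.diag I) (f' := f) rfl)
    doubleRing.locMap_snd_comp_diag (fun c hc => doubleRing.exists_loc_lift hc) hα
  have hdα : GeneralLinearGroup.map
      (algebraMap (doubleRing I)[X] (Localization.Away f')) α' = d := by
    refine GL_ext_of_jointly_injective (fun _ _ => doubleRing.loc_ext hf) ?_ ?_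
    · rw [hd₁, map_map_GL, locMap_comp, ← map_map_GL, h₁, map_one]
    · rw [hd₂, map_map_GL, locMap_comp, ← map_map_GL, h₂]
  have hmon : f' ∈ monics (doubleRing I) := hf.map _
  have hle : Submonoid.powers f' ≤ (monics (doubleRing I)).comap (RingHom.id _) := by
    rintro _ ⟨n, rfl⟩
    exact pow_mem hmon n
  have hE : α' ∈ S.E (doubleRing I)[X] := by
    refine S.mem_E_of_locMonic hG' ?_
    have := S.map_mem_E (IsLocalization.map (LocMonic (doubleRing I)) (RingHom.id _) hle) hd
    rwa [← hdα, map_map_GL, IsLocalization.map_comp, RingHom.comp_id] at this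
  have := S.excision (p₁ := Polynomial.mapRingHom (doubleRing.fst I))
    (p₂ := Polynomial.mapRingHom (doubleRing.snd I)) (J := polyIdeal I)
    (fun e => doubleRing.map_snd_sub_map_fst_mem e) hE
  rwa [h₁, h₂, inv_one, one_mul] at this

end ElementarySystem

/-! ### Matrices supported in two indices. -/

section Block

variable {N : ℕ} {B : Type*} [CommRing B]

/-- The matrix which is `(p, q; r, s)` at the indices `a`, `b` and the identity elsewhere. -/
def blk (a b : Fin N) (p q r s : B) : Matrix (Fin N) (Fin N) B :=
  1 + Matrix.single a a (p - 1) + Matrix.single a b q + Matrix.single b a r +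
    Matrix.single b b (s - 1)

theorem blk_mul {a b : Fin N} (h : a ≠ b) (p q r s p' q' r' s' : B) :
    blk a b p q r s * blk a b p' q' r' s' =
      blk a b (p * p' + q * r') (p * q' + q * s') (r * p' + s * r') (r * q' + s * s') := by
  have e₁ : p * p' + q * r' - 1 = (p - 1) + (p' - 1) + (p - 1) * (p' - 1) + q * r' := by ring
  have e₂ : p * q' + q * s' = q + q' + (p - 1) * q' + q * (s' - 1) := by ring
  have e₃ : r * p' + s * r' = r + r' + r * (p' - 1) + (s - 1) * r' := by ring
  have e₄ : r * q' + s * s' - 1 = (s - 1) + (s' - 1) + (s - 1) * (s' - 1) + r * q' := by ring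
  unfold blk
  rw [e₁, e₂, e₃, e₄]
  simp only [mul_add, add_mul, mul_one, one_mul, Matrix.single_mul_single_same,
    Matrix.single_mul_single_of_ne _ _ _ _ h, Matrix.single_mul_single_of_ne _ _ _ _ h.symm,
    Matrix.single_add]
  abel

theorem transvection_eq_blk (a b : Fin N) (c : B) :
    Matrix.transvection a b c = blk a b 1 c 0 1 := by
  simp [blk, Matrix.transvection]

theorem transvection_eq_blk' (a b : Fin N) (c : B) :
    Matrix.transvection b a c = blk a b 1 0 c 1 := by
  simp [blk, Matrix.transvection]

theorem blk_one (a b : Fin N) : blk a b (1 : B) 0 0 1 = 1 := by simp [blk]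

theorem blk_diagonal {a b : Fin N} (h : a ≠ b) (p s : B) :
    blk a b p 0 0 s = Matrix.diagonal fun k => if k = a then p else if k = b then s else 1 := by
  ext k l
  simp only [blk, Matrix.single_zero, add_zero, Matrix.add_apply, Matrix.single_apply,
    Matrix.diagonal_apply, Matrix.one_apply]
  by_cases hkl : k = l
  · subst hkl
    by_cases ha : k = a
    · subst ha; simp [h.symm]
    · by_cases hb : k = b
      · subst hb; simp [h, ha]
      · simp [ha, hb, Ne.symm ha, Ne.symm hb]
  · have h1 : ¬ (a = k ∧ a = l) := fun e => hkl (e.1.symm.trans e.2)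
    have h2 : ¬ (b = k ∧ b = l) := fun e => hkl (e.1.symm.trans e.2)
    simp [hkl, h1, h2]

/-- The diagonal matrix with entries `t`, `t⁻¹` at `a`, `b`. -/
def diagPair {a b : Fin N} (h : a ≠ b) (t : Bˣ) : GL (Fin N) B where
  val := blk a b t 0 0 (t⁻¹ : Bˣ)
  inv := blk a b (t⁻¹ : Bˣ) 0 0 t
  val_inv := by rw [blk_mul h]; simp [blk_one]
  inv_val := by rw [blk_mul h]; simp [blk_one]

/-- Whitehead's identity `diag(t, t⁻¹) = x(t) y(-t⁻¹) x(t-1) y(1) x(-1)`, regrouped into conjugates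
of root elements with parameters `t - 1` and `1 - t⁻¹`, which lie in `J`. -/
theorem RootElements.diagPair_mem_relE (S : RootElements.{u} N) {B : Type u} [CommRing B]
    {a b : Fin N} (h : a ≠ b) (h₁ : ∀ c : B, (S.x a b h c).1 = Matrix.transvection a b c)
    (h₂ : ∀ c : B, (S.x b a h.symm c).1 = Matrix.transvection b a c) {J : Ideal B} {t : Bˣ}
    (ht : (t : B) - 1 ∈ J) : diagPair h t ∈ S.relE B J := by
  have ht' : 1 - ((t⁻¹ : Bˣ) : B) ∈ J := by
    have := J.mul_mem_left ((t⁻¹ : Bˣ) : B) ht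
    rwa [mul_sub, Units.inv_mul, mul_one] at this
  have e : diagPair h t = ((S.x a b h (t : B) * S.x b a h.symm (-((t⁻¹ : Bˣ) : B))) * S.x a b h ((t : B) - 1) *
      (S.x a b h (t : B) * S.x b a h.symm (-((t⁻¹ : Bˣ) : B)))⁻¹) *
      (S.x a b h (t : B) * S.x b a h.symm (1 - ((t⁻¹ : Bˣ) : B)) * (S.x a b h (t : B))⁻¹) *
      S.x a b h ((t : B) - 1) := by
    have e1 : ((S.x a b h (t : B) * S.x b a h.symm (-((t⁻¹ : Bˣ) : B))) * S.x a b h ((t : B) - 1) *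
      (S.x a b h (t : B) * S.x b a h.symm (-((t⁻¹ : Bˣ) : B)))⁻¹) *
      (S.x a b h (t : B) * S.x b a h.symm (1 - ((t⁻¹ : Bˣ) : B)) * (S.x a b h (t : B))⁻¹) *
      S.x a b h ((t : B) - 1) = S.x a b h (t : B) * S.x b a h.symm (-((t⁻¹ : Bˣ) : B)) * S.x a b h ((t : B) - 1) *
        S.x b a h.symm 1 * S.x a b h (-1) := by
      rw [sub_eq_neg_add (1 : B), S.x_add b a, sub_eq_add_neg (t : B), S.x_add a b]
      group
    rw [e1]
    apply Units.ext
    simp only [Units.val_mul, h₁, h₂]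
    change blk a b _ _ _ _ = _
    simp only [transvection_eq_blk a b, transvection_eq_blk' a b, blk_mul h]
    have ht := t.mul_inv
    congr 1
    all_goals first
      | ring1
      | linear_combination ht
      | linear_combination -ht
      | linear_combination (t : B) * ht
  rw [e]
  exact mul_mem (mul_mem (S.conj_mem_relE (mul_mem (S.x_mem_E _ _ _ _) (S.x_mem_E _ _ _ _)) _ _ _ ht)
    (S.conj_mem_relE (S.x_mem_E _ _ _ _) _ _ _ ht')) (S.x_mem_relE _ _ _ ht)

theorem RootElements.weylElement_val (S : RootElements.{u} N) {B : Type u} [CommRing B]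
    {a b : Fin N} (h : a ≠ b) (h₁ : ∀ c : B, (S.x a b h c).1 = Matrix.transvection a b c)
    (h₂ : ∀ c : B, (S.x b a h.symm c).1 = Matrix.transvection b a c) (c : Bˣ) :
    (S.weylElement a b h c).1 = blk a b 0 (-((c⁻¹ : Bˣ) : B)) c 0 := by
  rw [RootElements.weylElement]
  simp only [Units.val_mul, h₁, h₂, transvection_eq_blk a b,
    transvection_eq_blk' a b, blk_mul h]
  have hc := c.mul_inv
  congr 1
  all_goals first
    | ring1
    | linear_combination -hc
    | linear_combination ((c⁻¹ : Bˣ) : B) * hc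

theorem isMonomial_blk {a b : Fin N} (h : a ≠ b) (p q : Bˣ) :
    IsMonomial (Equiv.swap a b) (fun k => if k = a then p else if k = b then q else 1)
      (blk a b (0 : B) q p 0) := by
  intro k l
  simp only [blk, Matrix.add_apply, Matrix.single_apply, Matrix.one_apply, zero_sub]
  by_cases hla : l = a
  · subst hla
    rw [Equiv.swap_apply_left]
    by_cases hk : k = b
    · subst hk; simp [h, h.symm]
    · by_cases hk' : k = l
      · subst hk'; simp [h, h.symm]
      · simp [hk, hk', Ne.symm hk, Ne.symm hk', h.symm]
  · by_cases hlb : l = b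
    · subst hlb
      rw [Equiv.swap_apply_right]
      by_cases hk : k = a
      · subst hk; simp [h, h.symm]
      · by_cases hk' : k = l
        · subst hk'; simp [h, h.symm]
        · simp [hk, hk', Ne.symm hk, Ne.symm hk', h]
    · rw [Equiv.swap_apply_of_ne_of_ne hla hlb]
      simp [hla, hlb, Ne.symm hla, Ne.symm hlb]

end Block

/-! ### Transvections and Koszul vectors. -/

section MatMem

variable {N : ℕ} {B : Type*} [CommRing B]

/-- The matrix `M` is an element of `H`. -/
def MatMem (H : Subgroup (GL (Fin N) B)) (M : Matrix (Fin N) (Fin N) B) : Prop :=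
  ∃ g ∈ H, g.1 = M

variable {H : Subgroup (GL (Fin N) B)}

theorem MatMem.mem {g : GL (Fin N) B} (h : MatMem H g.1) : g ∈ H := by
  obtain ⟨g', hg', e⟩ := h
  rwa [← Units.ext e]

theorem MatMem.mul {M M' : Matrix (Fin N) (Fin N) B} (h : MatMem H M) (h' : MatMem H M') :
    MatMem H (M * M') := by
  obtain ⟨g, hg, rfl⟩ := h
  obtain ⟨g', hg', rfl⟩ := h'
  exact ⟨g * g', mul_mem hg hg', rfl⟩

theorem matMem_one : MatMem H 1 := ⟨1, one_mem _, rfl⟩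

open Matrix in
theorem one_add_vecMulVec_mul_left (v v' w : Fin N → B) (h : w ⬝ᵥ v' = 0) :
    (1 + vecMulVec v w) * (1 + vecMulVec v' w) = 1 + vecMulVec (v + v') w := by
  simp only [mul_add, add_mul, mul_one, one_mul, vecMulVec_mul_vecMulVec, h, zero_smul,
    vecMulVec_zero, add_zero,
    add_vecMulVec, add_assoc]

open Matrix in
theorem one_add_vecMulVec_mul_right (v w w' : Fin N → B) (h : w ⬝ᵥ v = 0) :
    (1 + vecMulVec v w) * (1 + vecMulVec v w') = 1 + vecMulVec v (w + w') := by
  simp only [mul_add, add_mul, mul_one, one_mul, vecMulVec_mul_vecMulVec, h, zero_smul, add_zero,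
    vecMulVec_add, vecMulVec_zero, add_assoc]

open Matrix in
theorem matMem_sum_left {ι : Type*} (s : Finset ι) (f : ι → Fin N → B) (w : Fin N → B)
    (hw : ∀ i ∈ s, w ⬝ᵥ f i = 0) (h : ∀ i ∈ s, MatMem H (1 + vecMulVec (f i) w)) :
    MatMem H (1 + vecMulVec (∑ i ∈ s, f i) w) := by
  classical
  induction s using Finset.induction_on with
  | empty => simpa using matMem_one
  | insert i s hi ih =>
    rw [Finset.sum_insert hi, ← one_add_vecMulVec_mul_left]
    · exact (h i (Finset.mem_insert_self _ _)).mul (ih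
        (fun j hj => hw j (Finset.mem_insert_of_mem hj))
        fun j hj => h j (Finset.mem_insert_of_mem hj))
    · rw [dotProduct_sum]
      exact Finset.sum_eq_zero fun j hj => hw j (Finset.mem_insert_of_mem hj)

open Matrix in
theorem matMem_sum_right {ι : Type*} (s : Finset ι) (v : Fin N → B) (f : ι → Fin N → B)
    (hw : ∀ i ∈ s, f i ⬝ᵥ v = 0) (h : ∀ i ∈ s, MatMem H (1 + vecMulVec v (f i))) :
    MatMem H (1 + vecMulVec v (∑ i ∈ s, f i)) := by
  classical
  induction s using Finset.induction_on with
  | empty => simpa using matMem_one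
  | insert i s hi ih =>
    rw [Finset.sum_insert hi, ← one_add_vecMulVec_mul_right]
    · exact (h i (Finset.mem_insert_self _ _)).mul (ih
        (fun j hj => hw j (Finset.mem_insert_of_mem hj))
        fun j hj => h j (Finset.mem_insert_of_mem hj))
    · exact hw i (Finset.mem_insert_self _ _)

open Matrix in
theorem transvection_eq_one_add (a b : Fin N) (c : B) :
    transvection a b c = 1 + vecMulVec (Pi.single a 1) (Pi.single b c) := by
  ext k l
  simp only [transvection, Matrix.add_apply, single_apply, vecMulVec_apply, Pi.single_apply]
  by_cases hk : a = k
  · by_cases hl : b = l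
    · subst hk hl; simp
    · subst hk; simp [hl, Ne.symm hl]
  · simp [hk, Ne.symm hk]

open Matrix in
theorem conj_one_add_vecMulVec (g : GL (Fin N) B) (v w : Fin N → B) :
    g.1 * (1 + vecMulVec v w) * (g⁻¹).1 = 1 + vecMulVec (g.1 *ᵥ v) (w ᵥ* (g⁻¹).1) := by
  rw [mul_add, add_mul, mul_one, ← Units.val_mul, mul_inv_cancel, Units.val_one, mul_vecMulVec,
    vecMulVec_mul]

/-- The vector `w_j e_i - w_i e_j`. -/
def koszul (w : Fin N → B) (i j : Fin N) : Fin N → B :=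
  Pi.single i (w j) - Pi.single j (w i)

open Matrix in
theorem dotProduct_koszul (w : Fin N → B) (i j : Fin N) : w ⬝ᵥ koszul w i j = 0 := by
  simp [koszul, dotProduct_sub, mul_comm]

open Matrix in
-- The sum is `v (w·u) - u (w·v)`: exactness of the Koszul complex of a unimodular vector.
theorem sum_koszul {v w u : Fin N → B} (hu : w ⬝ᵥ u = 1) (hv : w ⬝ᵥ v = 0) :
    ∑ p : Fin N × Fin N, (v p.1 * u p.2) • koszul w p.1 p.2 = v := by
  ext k
  simp only [koszul, Finset.sum_apply, Pi.smul_apply, Pi.sub_apply, smul_eq_mul, mul_sub,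
    Finset.sum_sub_distrib, Fintype.sum_prod_type, Pi.single_apply]
  simp only [mul_ite, mul_zero, Finset.sum_ite_eq, Finset.mem_univ, if_true]
  have h₁ : (∑ i, ∑ j, if k = i then v i * u j * w j else 0) = v k * (w ⬝ᵥ u) := by
    rw [Finset.sum_eq_single k, dotProduct, Finset.mul_sum]
    · exact Finset.sum_congr rfl fun j _ => by rw [if_pos rfl]; ring
    · exact fun i _ hi => Finset.sum_eq_zero fun j _ => if_neg hi.symm
    · simp
  have h₂ : ∑ i, v i * u k * w i = u k * (w ⬝ᵥ v) := by
    rw [dotProduct, Finset.mul_sum]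
    exact Finset.sum_congr rfl fun j _ => by ring
  rw [h₁, h₂, hu, hv]
  ring

open Matrix in
/-- Transvections are products of transvections supported in two coordinates. -/
theorem matMem_of_koszul {v w u : Fin N → B} (hu : w ⬝ᵥ u = 1) (hv : w ⬝ᵥ v = 0) (r : B)
    (h : ∀ i j, i ≠ j → MatMem H (1 + vecMulVec ((v i * u j) • koszul w i j) (r • w))) :
    MatMem H (1 + vecMulVec v (r • w)) := by
  rw [← sum_koszul hu hv]
  refine matMem_sum_left _ _ _ (fun p _ => ?_) fun p _ => ?_
  · rw [smul_dotProduct, dotProduct_smul, dotProduct_koszul, smul_zero, smul_zero]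
  · by_cases hp : p.1 = p.2
    · have : koszul w p.1 p.2 = 0 := by rw [koszul, hp, sub_self]
      rw [this, smul_zero]
      simpa using matMem_one
    · exact h _ _ hp

end MatMem

/-! ### The special linear group. -/

section Linear

/-- The elementary matrices as root elements. -/
def linearRoots (N : ℕ) : RootElements.{u} N where
  x a b h c := elem a b h c
  x_add a b h c d := Units.ext (Matrix.transvection_mul_transvection_same a b h c d).symm
  x_map φ a b h c := by
    ext k l
    change φ (Matrix.transvection a b c k l) = Matrix.transvection a b (φ c) k l
    simp [Matrix.transvection, Matrix.add_apply, Matrix.one_apply, Matrix.single_apply, apply_ite φ]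

/-- Multiplication by `diag(u, u⁻¹)` at `i` and `i₀` makes the entry at `i` equal to `1` and shifts
the defect to `i₀`; in the end the determinant forces the entry at `i₀` to be `1`. -/
theorem linear_diag_mem {N : ℕ} {B : Type u} [CommRing B] {J : Ideal B} (i₀ : Fin N)
    (s : Finset (Fin N)) : i₀ ∉ s → ∀ g : GL (Fin N) B, (∀ a b, a ≠ b → g.1 a b = 0) →
    g ∈ relGL N B J → g ∈ (GeneralLinearGroup.det (n := Fin N) (R := B)).ker →
    (∀ i, i ∉ s → i ≠ i₀ → g.1 i i = 1) → g ∈ (linearRoots N).relE B J := by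
  induction s using Finset.induction_on with
  | empty =>
    intro _ g hg _ hdet h1
    have hd : g.1 = Matrix.diagonal fun i => g.1 i i := by
      ext a b
      rcases eq_or_ne a b with rfl | hab
      · simp
      · rw [hg a b hab, Matrix.diagonal_apply_ne _ hab]
    have h0 : g.1 i₀ i₀ = 1 := by
      have := congrArg Units.val (MonoidHom.mem_ker.mp hdet)
      rw [GeneralLinearGroup.val_det_apply, hd, Matrix.det_diagonal, Finset.prod_eq_single i₀
        (fun i _ hi => h1 i (by simp) hi) (by simp)] at this
      exact this
    have : g = 1 := by
      apply Units.ext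
      rw [hd, Units.val_one, ← Matrix.diagonal_one]
      congr 1
      ext i
      rcases eq_or_ne i i₀ with rfl | hi
      · exact h0
      · exact h1 i (by simp) hi
    rw [this]
    exact one_mem _
  | insert i s his ih =>
    intro hi₀ g hg hJ hdet h1
    rw [Finset.mem_insert, not_or] at hi₀
    have hdiag : ∀ (k : GL (Fin N) B) (j), (g * k).1 j j = g.1 j j * k.1 j j := fun k j => by
      rw [Units.val_mul, Matrix.mul_apply, Finset.sum_eq_single j]
      · exact fun l _ hl => by rw [hg j l hl.symm, zero_mul]
      · simp
    have hu : g.1 i i * (g⁻¹).1 i i = 1 := by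
      rw [← hdiag, mul_inv_cancel, Units.val_one, Matrix.one_apply_eq]
    set u : Bˣ := ⟨(g⁻¹).1 i i, g.1 i i, by rw [mul_comm]; exact hu, hu⟩ with hu'
    have huJ : (u : B) - 1 ∈ J := by
      have := mem_relGL.mp (inv_mem hJ) i i
      rwa [Matrix.one_apply_eq] at this
    have hii : i ≠ i₀ := fun e => hi₀.1 e.symm
    have hp : diagPair hii u ∈ (linearRoots N).relE B J :=
      (linearRoots N).diagPair_mem_relE hii (fun _ => rfl) (fun _ => rfl) huJ
    have hpv : (diagPair hii u).1 = Matrix.diagonal fun k =>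
        if k = i then (u : B) else if k = i₀ then ((u⁻¹ : Bˣ) : B) else 1 := blk_diagonal hii _ _
    have hE : (linearRoots N).E B ≤ (GeneralLinearGroup.det (n := Fin N) (R := B)).ker :=
      (linearRoots N).E_le fun a b h c => Units.ext (Matrix.det_transvection_of_ne a b h c)
    have hgp : ∀ a b, (g * diagPair hii u).1 a b = g.1 a b *
        (if b = i then (u : B) else if b = i₀ then ((u⁻¹ : Bˣ) : B) else 1) := fun a b => by
      rw [Units.val_mul, hpv, Matrix.mul_diagonal]
    have := ih hi₀.2 (g * diagPair hii u)
      (fun a b hab => by rw [hgp, hg a b hab, zero_mul])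
      (mul_mem hJ ((linearRoots N).relE_le_relGL _ hp))
      (mul_mem hdet (hE ((linearRoots N).relE_le_E _ hp)))
      (fun j hj hj₀ => by
        rw [hgp]
        rcases eq_or_ne j i with rfl | hji
        · rw [if_pos rfl]; exact hu
        · rw [if_neg hji, if_neg hj₀, mul_one]
          exact h1 j (by simp [hji, hj]) hj₀)
    have := mul_mem this (inv_mem hp)
    rwa [mul_inv_cancel_right] at this

/-- The special linear group with the elementary matrices. -/
def linearGroup (N : ℕ) : ElementaryGroup.{u} N where
  toRootElements := linearRoots N
  σ := id
  σ_σ _ := rfl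
  G B _ := (GeneralLinearGroup.det (n := Fin N) (R := B)).ker
  x_mem_G a b h c := Units.ext (Matrix.det_transvection_of_ne a b h c)
  map_mem_G φ g hg := by
    rw [MonoidHom.mem_ker] at hg ⊢
    rw [GeneralLinearGroup.map_det, hg, map_one]
  mem_G_of_map φ ψ h g h₁ h₂ := by
    rw [MonoidHom.mem_ker] at h₁ h₂ ⊢
    rw [GeneralLinearGroup.map_det] at h₁ h₂
    have h₁ := congrArg Units.val h₁
    have h₂ := congrArg Units.val h₂
    rw [Units.coe_map, Units.val_one] at h₁ h₂
    refine Units.ext (sub_eq_zero.mp (h _ ?_ ?_))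
    · rw [Units.val_one, map_sub, map_one]
      exact sub_eq_zero.mpr h₁
    · rw [Units.val_one, map_sub, map_one]
      exact sub_eq_zero.mpr h₂
  x_row a b h c l := by
    change Matrix.transvection a b c a l = _
    simp [Matrix.transvection, Matrix.add_apply, Matrix.single_apply, eq_comm]
  x_row_ne a b h c k l hk _ := by
    change Matrix.transvection a b c k l = _
    simp [Matrix.transvection, Matrix.add_apply, hk.symm]
  x_col a b h c k := by
    change Matrix.transvection a b c k b = _
    simp [Matrix.transvection, Matrix.add_apply, Matrix.single_apply, eq_comm]
  x_col_ne a b h c k l hl _ := by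
    change Matrix.transvection a b c k l = _
    simp [Matrix.transvection, Matrix.add_apply, hl.symm]
  G_clear _ i h₁ h₂ k hk := ⟨h₁ k hk, h₂ k hk⟩
  diag_mem {B} _ J g hg hd hJ := by
    rcases isEmpty_or_nonempty (Fin N) with h | ⟨⟨i₀⟩⟩
    · rw [show g = 1 from Units.ext (Subsingleton.elim _ _)]
      exact one_mem _
    · exact linear_diag_mem i₀ (Finset.univ.erase i₀) (by simp) g hd hJ hg
        fun i hi hi' => absurd (Finset.mem_erase.mpr ⟨hi', Finset.mem_univ i⟩) hi

open Matrix in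
theorem linear_matMem_col {N : ℕ} {B : Type u} [CommRing B] {J : Ideal B} {v : Fin N → B}
    {k : Fin N} (hv : v k = 0) {c : B} (hc : c ∈ J) :
    MatMem ((linearRoots N).relE B J) (1 + vecMulVec v (Pi.single k c)) := by
  rw [← Finset.univ_sum_single v]
  refine matMem_sum_left _ _ _ (fun i _ => ?_) fun i _ => ?_
  · rcases eq_or_ne i k with rfl | h
    · simp [hv]
    · simp [h.symm]
  · rcases eq_or_ne i k with rfl | h
    · simpa [hv] using matMem_one
    · refine ⟨_, (linearRoots N).x_mem_relE i k h (J.mul_mem_left (v i) hc), ?_⟩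
      change transvection i k (v i * c) = _
      rw [transvection_eq_one_add]
      congr 1
      ext a b
      simp [vecMulVec_apply, Pi.single_apply]

open Matrix in
theorem linear_matMem_row {N : ℕ} {B : Type u} [CommRing B] {J : Ideal B} {w : Fin N → B}
    {k : Fin N} (hk : w k = 0) (hw : ∀ j, w j ∈ J) :
    MatMem ((linearRoots N).relE B J) (1 + vecMulVec (Pi.single k 1) w) := by
  rw [← Finset.univ_sum_single w]
  refine matMem_sum_right _ _ _ (fun i _ => ?_) fun i _ => ?_
  · rcases eq_or_ne i k with rfl | h
    · simp [hk]
    · simp [h]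
  · rcases eq_or_ne i k with rfl | h
    · simpa [hk] using matMem_one
    · refine ⟨_, (linearRoots N).x_mem_relE k i h.symm (hw i), ?_⟩
      rw [← transvection_eq_one_add]
      rfl

open Matrix in
-- The coordinate `k` is free: for `w₀`, which is `w` with its `k`-th entry removed, `1 + v w₀ᵗ` is
-- the commutator of `1 + v e_kᵗ` and `1 + e_k w₀ᵗ`. The removed entry contributes a single column.
theorem linear_matMem {N : ℕ} {B : Type u} [CommRing B] {J : Ideal B} {v w : Fin N → B}
    {k : Fin N} (hv : v k = 0) (hwv : w ⬝ᵥ v = 0) (hw : ∀ j, w j ∈ J) :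
    MatMem ((linearRoots N).relE B J) (1 + vecMulVec v w) := by
  set w₀ := w - Pi.single k (w k) with hw₀
  have hw₀k : w₀ k = 0 := by simp [hw₀]
  have hw₀J : ∀ j, w₀ j ∈ J := fun j => by
    rw [hw₀, Pi.sub_apply, Pi.single_apply]
    split_ifs
    · exact sub_mem (hw j) (hw k)
    · simpa using hw j
  have hw₀v : w₀ ⬝ᵥ v = 0 := by
    rw [hw₀, sub_dotProduct, hwv, single_dotProduct, hv, mul_zero, sub_zero]
  obtain ⟨V, hV, hVe⟩ := linear_matMem_col (J := ⊤) hv (c := (1 : B)) trivial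
  rw [RootElements.relE_top] at hV
  obtain ⟨U, hU, hUe⟩ := linear_matMem_row (k := k) hw₀k hw₀J
  have h₁ : V.1 *ᵥ Pi.single k 1 = v + Pi.single k 1 := by
    rw [hVe, add_mulVec, one_mulVec, vecMulVec_mulVec]
    simp [add_comm]
  have h₂ : w₀ ᵥ* (V⁻¹).1 = w₀ := by
    have : w₀ ᵥ* V.1 = w₀ := by
      rw [hVe, vecMul_add, vecMul_one, vecMul_vecMulVec, hw₀v, zero_smul, add_zero]
    conv_lhs => rw [← this]
    rw [vecMul_vecMul, ← Units.val_mul, mul_inv_cancel, Units.val_one, vecMul_one]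
  have h₃ : MatMem ((linearRoots N).relE B J) (1 + vecMulVec v w₀) := by
    refine ⟨V * U * V⁻¹ * U⁻¹, mul_mem ((linearRoots N).relE_conj hV hU) (inv_mem hU), ?_⟩
    have h₄ : (V * U * V⁻¹).1 = (1 + vecMulVec v w₀) * U.1 := by
      rw [Units.val_mul, Units.val_mul, hUe, conj_one_add_vecMulVec, h₁, h₂,
        one_add_vecMulVec_mul_left]
      simpa using hw₀k
    rw [Units.val_mul, h₄, mul_assoc, ← Units.val_mul, mul_inv_cancel, Units.val_one, mul_one]
  have h₅ := h₃.mul (linear_matMem_col (k := k) hv (hw k))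
  rwa [one_add_vecMulVec_mul_right _ _ _ hw₀v, hw₀, sub_add_cancel] at h₅

theorem elem_mul_eq_commutator {N : ℕ} {B : Type*} [CommRing B] {a k b : Fin N} (hak : a ≠ k)
    (hkb : k ≠ b) (hab : a ≠ b) (c d : B) : elem a b hab (c * d) =
      elem a k hak c * elem k b hkb d * (elem a k hak c)⁻¹ * (elem k b hkb d)⁻¹ := by
  rw [eq_mul_inv_iff_mul_eq, eq_mul_inv_iff_mul_eq]
  apply Units.ext
  change Matrix.transvection a b (c * d) * Matrix.transvection k b d * Matrix.transvection a k c =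
    Matrix.transvection a k c * Matrix.transvection k b d
  simp [Matrix.transvection, mul_add, add_mul, Matrix.single_mul_single_of_ne, hab.symm, hkb.symm]
  abel

/-- Induction on the distance of the indices, with the commutator of an adjacent and a shorter root.
-/
theorem linear_mem_of_adjacent {N : ℕ} {B : Type*} [CommRing B] (H : Subgroup (GL (Fin N) B))
    (hH : ∀ (a b : Fin N) (h : a ≠ b) (c : B),
      ((b : ℕ) = a + 1 ∨ (a : ℕ) = b + 1) → elem a b h c ∈ H) (n : ℕ) :
    ∀ (a b : Fin N) (h : a ≠ b) (c : B), (a : ℕ) ≤ b + n → (b : ℕ) ≤ a + n → elem a b h c ∈ H := by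
  induction n with
  | zero => exact fun a b h c h₁ h₂ => absurd (Fin.ext (by omega)) h
  | succ n ih =>
    intro a b h c h₁ h₂
    by_cases hadj : (b : ℕ) = a + 1 ∨ (a : ℕ) = b + 1
    · exact hH a b h c hadj
    have hne : (a : ℕ) ≠ b := fun e => h (Fin.ext e)
    obtain ⟨k, hk⟩ : ∃ k : Fin N, ((k : ℕ) = a + 1 ∧ (a : ℕ) < b) ∨ ((a : ℕ) = k + 1 ∧ (b : ℕ) < a) := by
      rcases lt_or_gt_of_ne hne with hlt | hlt
      · exact ⟨⟨a + 1, by omega⟩, Or.inl ⟨rfl, hlt⟩⟩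
      · exact ⟨⟨a - 1, by omega⟩, Or.inr ⟨by change (a : ℕ) = a - 1 + 1; omega, hlt⟩⟩
    have hak : a ≠ k := fun e => by rw [e] at hk; omega
    have hkb : k ≠ b := fun e => by rw [e] at hk; omega
    rw [← one_mul c, elem_mul_eq_commutator hak hkb h]
    have h1 := hH a k hak 1 (by omega)
    have h2 := ih k b hkb c (by omega) (by omega)
    exact mul_mem (mul_mem (mul_mem h1 h2) (inv_mem h1)) (inv_mem h2)

theorem transvection_conj_apply {N : ℕ} {B : Type*} [CommRing B] {M : Matrix (Fin N) (Fin N) B}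
    {a b : Fin N} (hM : M a b = 0) (c : B) (k l : Fin N) :
    (Matrix.transvection b a c * M * Matrix.transvection b a (-c)) k l =
      M k l + (if k = b then c * M a l else 0) - if l = a then c * M k b else 0 := by
  have e : ∀ k l, (Matrix.transvection b a c * M) k l =
      M k l + if k = b then c * M a l else 0 := fun k l => by
    rcases eq_or_ne k b with rfl | hk
    · rw [Matrix.transvection_mul_apply_same, if_pos rfl]
    · rw [Matrix.transvection_mul_apply_of_ne _ _ _ _ hk, if_neg hk, add_zero]
  rcases eq_or_ne l a with rfl | hl
  · rw [Matrix.mul_transvection_apply_same, if_pos rfl, e, e, hM]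
    simp only [mul_zero, ite_self, add_zero]
    ring
  · rw [Matrix.mul_transvection_apply_of_ne _ _ _ _ hl, if_neg hl, e, sub_zero]

theorem unitri_transvection_conj {N : ℕ} {B : Type*} [CommRing B] {M : Matrix (Fin N) (Fin N) B}
    {pos : Fin N → ℕ} (hpos : Function.Injective pos) {a b : Fin N} (hab : pos b = pos a + 1)
    (h : Unitri pos M) (hM : M a b = 0) (c : B) :
    Unitri pos (Matrix.transvection b a c * M * Matrix.transvection b a (-c)) := by
  have hne : a ≠ b := fun e => by rw [e] at hab; omega
  refine ⟨fun k l hkl => ?_, fun k => ?_⟩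
  · rw [transvection_conj_apply hM, h.1 k l hkl, zero_add]
    by_cases hk : k = b
    · subst hk
      by_cases hl : l = a
      · subst hl
        simp [h.2]
      · have hla : pos l ≠ pos a := fun e => hl (hpos e)
        rw [if_neg hl, if_pos rfl, h.1 a l (by omega), mul_zero, sub_zero]
    · rw [if_neg hk]
      by_cases hl : l = a
      · subst hl
        have hkb : pos k ≠ pos b := fun e => hk (hpos e)
        rw [if_pos rfl, h.1 k b (by omega), mul_zero, sub_zero]
      · rw [if_neg hl, sub_zero]
  · rw [transvection_conj_apply hM, h.2]
    by_cases hk : k = b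
    · subst hk
      rw [if_pos rfl, if_neg hne.symm, hM, mul_zero, add_zero, sub_zero]
    · by_cases hk' : k = a
      · subst hk'
        rw [if_neg hk, if_pos rfl, hM, mul_zero, add_zero, sub_zero]
      · rw [if_neg hk, if_neg hk', add_zero, sub_zero]

theorem IsMonomial.mul_transvection {N : ℕ} {B : Type*} [CommRing B] {M : Matrix (Fin N) (Fin N) B}
    {π : Equiv.Perm (Fin N)} {v : Fin N → Bˣ} (hn : IsMonomial π v M) (a b : Fin N) (c : B) :
    M * Matrix.transvection a b c =
      Matrix.transvection (π a) (π b) (((v a * (v b)⁻¹ : Bˣ) : B) * c) * M := by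
  ext k l
  rcases eq_or_ne l b with rfl | hl
  · rw [Matrix.mul_transvection_apply_same]
    rcases eq_or_ne k (π a) with rfl | hk
    · rw [Matrix.transvection_mul_apply_same, hn (π a) a, hn (π l) l, if_pos rfl, if_pos rfl,
        Units.val_mul]
      linear_combination (-(v a : B) * c) * (v l).inv_mul
    · rw [Matrix.transvection_mul_apply_of_ne _ _ _ _ hk, hn k a, if_neg hk]
      ring
  · rw [Matrix.mul_transvection_apply_of_ne _ _ _ _ hl]
    rcases eq_or_ne k (π a) with rfl | hk
    · rw [Matrix.transvection_mul_apply_same, hn (π b) l, if_neg (π.injective.ne hl.symm)]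
      ring
    · rw [Matrix.transvection_mul_apply_of_ne _ _ _ _ hk]

/-- The Bruhat decomposition of the special linear group. -/
def linearBruhat (N : ℕ) : BruhatData (linearGroup.{u} N) where
  pos := Fin.val
  pos_injective := Fin.val_injective
  x_unitri a b h c hab := by
    change Unitri _ (Matrix.transvection a b c)
    refine ⟨fun k l hkl => ?_, fun k => ?_⟩
    · have h1 : k ≠ l := fun e => by rw [e] at hkl; omega
      have h2 : ¬ (a = k ∧ b = l) := fun e => by rw [← e.1, ← e.2] at hkl; omega
      simp [Matrix.transvection, h1, h2]
    · have h2 : ¬ (a = k ∧ b = k) := fun e => h (e.1.trans e.2.symm)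
      simp [Matrix.transvection, h2]
  conj_unitri a b h c g hab _ hg hgab :=
    ⟨unitri_transvection_conj Fin.val_injective hab hg hgab c, by
      change (Matrix.transvection b a c * g.1 * Matrix.transvection b a (-c)) a b = 0
      rw [transvection_conj_apply hgab, hgab, if_neg h.symm, if_neg h]
      ring⟩
  weyl a b h c _ := by
    refine ⟨Equiv.swap a b, fun k => if k = a then c else if k = b then -c⁻¹ else 1, ?_,
      Equiv.swap_apply_left _ _, Equiv.swap_apply_right _ _⟩
    rw [RootElements.weylElement_val _ h (fun _ => rfl) (fun _ => rfl)]
    exact isMonomial_blk h c (-c⁻¹)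
  monomial_mul_x _ hn a b h c := Units.ext (hn.mul_transvection a b c)
  E_le {B} _ := by
    refine (linearRoots N).E_le fun a b h c => linear_mem_of_adjacent _ (fun a b h c hab => ?_) N
      a b h c (by omega) (by omega)
    exact Subgroup.subset_closure ⟨a, b, h, c, hab, rfl⟩

theorem exists_ne_ne {N : ℕ} (hN : 3 ≤ N) (a b : Fin N) : ∃ k : Fin N, k ≠ a ∧ k ≠ b := by
  obtain ⟨k, -, hk⟩ := Finset.exists_mem_notMem_of_card_lt_card (s := {a, b})
    (t := (Finset.univ : Finset (Fin N))) (Finset.card_le_two.trans_lt (by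
      rw [Finset.card_univ, Fintype.card_fin]; omega))
  exact ⟨k, by simpa using hk⟩

open Matrix in
theorem linear_conj_x {N : ℕ} {B : Type u} [CommRing B] (γ : GL (Fin N) B) (a b : Fin N)
    (h : a ≠ b) (c : B) : (γ * (linearRoots N).x a b h c * γ⁻¹).1 =
      1 + vecMulVec (γ.1 *ᵥ Pi.single a 1) (c • (Pi.single b 1 ᵥ* (γ⁻¹).1)) := by
  have e : ((linearRoots N).x a b h c).1 = 1 + vecMulVec (Pi.single a 1) (Pi.single b c) :=
    transvection_eq_one_add a b c
  have e' : (Pi.single b c : Fin N → B) = c • Pi.single b 1 := by ext; simp [Pi.single_apply]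
  rw [Units.val_mul, Units.val_mul, e, conj_one_add_vecMulVec, e', smul_vecMul]

open Matrix in
theorem single_vecMul_inv_dotProduct {N : ℕ} {B : Type*} [CommRing B] (γ : GL (Fin N) B)
    (a b : Fin N) : (Pi.single b 1 ᵥ* (γ⁻¹).1) ⬝ᵥ (γ.1 *ᵥ Pi.single a 1) =
      (1 : Matrix (Fin N) (Fin N) B) b a := by
  rw [dotProduct_mulVec, vecMul_vecMul, ← Units.val_mul, inv_mul_cancel, Units.val_one]
  simp [Pi.single_apply, Matrix.one_apply, eq_comm]

/-- Finitely many elements have a common denominator. -/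
theorem HasDenominators.exists_common {R L ι : Type*} [CommRing R] [CommRing L] [Fintype ι]
    {φ : R →+* L} {M : Submonoid R} (h : HasDenominators φ M) (v : ι → L) :
    ∃ s ∈ M, ∃ v' : ι → R, ∀ i, φ (v' i) = φ s * v i := by
  classical
  choose s hs r hr using fun i => h (v i)
  refine ⟨∏ i, s i, prod_mem fun i _ => hs i, fun i => (∏ j ∈ Finset.univ.erase i, s j) * r i,
    fun i => ?_⟩
  rw [map_mul, hr, ← mul_assoc, ← map_mul, Finset.prod_erase_mul _ _ (Finset.mem_univ i)]

theorem MatMem.map {N : ℕ} {B C : Type*} [CommRing B] [CommRing C] (φ : B →+* C)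
    {H : Subgroup (GL (Fin N) B)} {M : Matrix (Fin N) (Fin N) B} (h : MatMem H M) :
    MatMem (H.map (GeneralLinearGroup.map φ)) (M.map φ) := by
  obtain ⟨g, hg, rfl⟩ := h
  exact ⟨_, ⟨g, hg, rfl⟩, rfl⟩

theorem koszul_apply_of_ne {N : ℕ} {B : Type*} [CommRing B] (w : Fin N → B) {i j k : Fin N}
    (hi : k ≠ i) (hj : k ≠ j) : koszul w i j k = 0 := by
  simp [koszul, hi, hj]

theorem map_koszul {N : ℕ} {B C : Type*} [CommRing B] [CommRing C] (φ : B →+* C) (w : Fin N → B)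
    (i j k : Fin N) : φ (koszul w i j k) = koszul (fun l => φ (w l)) i j k := by
  simp [koszul, Pi.single_apply, apply_ite φ]

theorem koszul_smul {N : ℕ} {B : Type*} [CommRing B] (c : B) (w : Fin N → B)
    (i j : Fin N) : koszul (fun l => c * w l) i j = c • koszul w i j := by
  ext k
  simp only [koszul, Pi.sub_apply, Pi.smul_apply, Pi.single_apply, smul_eq_mul, mul_sub, mul_ite,
    mul_zero]

open Matrix in
-- The conjugate is `1 + v wᵗ` with `w` unimodular. Its Koszul pieces involve two coordinates, so
-- for `N ≥ 3` a third one vanishes and `linear_matMem` applies after clearing denominators.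
theorem linear_exists_conj_mem {N : ℕ} (hN : 3 ≤ N) {R L : Type u} [CommRing R] [CommRing L]
    (φ : R →+* L) (M : Submonoid R) (γ : GL (Fin N) L) (a b : Fin N) (h : a ≠ b)
    (hφ : HasDenominators φ M) : ∃ s ∈ M, ∀ (J : Ideal R), ∀ r ∈ J,
      γ * (linearRoots N).x a b h (φ (s * r)) * γ⁻¹ ∈
        ((linearRoots N).relE R J).map (GeneralLinearGroup.map φ) := by
  obtain ⟨s₁, hs₁, v', hv'⟩ := hφ.exists_common (γ.1 *ᵥ Pi.single a 1)
  obtain ⟨s₂, hs₂, w', hw'⟩ := hφ.exists_common (Pi.single b 1 ᵥ* (γ⁻¹).1)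
  obtain ⟨s₃, hs₃, u', hu'⟩ := hφ.exists_common (γ.1 *ᵥ Pi.single b 1)
  -- The denominator of `w` occurs twice, once in the Koszul vector and once in the row.
  refine ⟨s₁ * s₃ * s₂ * s₂, mul_mem (mul_mem (mul_mem hs₁ hs₃) hs₂) hs₂, fun J r hr => ?_⟩
  apply MatMem.mem
  rw [linear_conj_x]
  refine matMem_of_koszul (u := γ.1 *ᵥ Pi.single b 1)
    (by rw [single_vecMul_inv_dotProduct, one_apply_eq])
    (by rw [single_vecMul_inv_dotProduct, one_apply_ne h.symm]) _ fun i j _ => ?_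
  obtain ⟨k, hki, hkj⟩ := exists_ne_ne hN i j
  have key := (linear_matMem (J := J) (v := (v' i * u' j) • koszul w' i j) (w := r • w') (k := k)
    (by rw [Pi.smul_apply, koszul_apply_of_ne _ hki hkj, smul_zero])
    (by rw [smul_dotProduct, dotProduct_smul, dotProduct_koszul, smul_zero, smul_zero])
    fun l => J.mul_mem_right _ hr).map φ
  convert key using 1
  ext k l
  simp only [Matrix.map_apply, Matrix.add_apply, vecMulVec_apply, Pi.smul_apply, smul_eq_mul,
    map_add, map_mul, map_koszul, hv', hw', hu', koszul_smul]
  congr 1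
  · simp [Matrix.one_apply, apply_ite φ]
  · ring

open Matrix in
theorem linear_tau_conj_mem_E {N : ℕ} (hN : 3 ≤ N) {P L : Type u} [CommRing P] [CommRing L]
    (w : Fin N → Bool) (φ : P →+* L) {X : P} {t : Lˣ} (hX : φ X = t) (γ : GL (Fin N) P)
    (a b : Fin N) (h : a ≠ b) (p : P) :
    tau w t * GeneralLinearGroup.map φ (γ * (linearRoots N).x a b h (X * p) * γ⁻¹) * (tau w t)⁻¹ ∈
      ((linearRoots N).E P).map (GeneralLinearGroup.map φ) := by
  suffices γ * (linearRoots N).x a b h (X * p) * γ⁻¹ ∈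
      (((linearRoots N).E P).map (GeneralLinearGroup.map φ)).comap
        ((MulAut.conj (tau w t)).toMonoidHom.comp (GeneralLinearGroup.map φ)) from this
  apply MatMem.mem
  rw [linear_conj_x]
  refine matMem_of_koszul (u := γ.1 *ᵥ Pi.single b 1)
    (by rw [single_vecMul_inv_dotProduct, one_apply_eq])
    (by rw [single_vecMul_inv_dotProduct, one_apply_ne h.symm]) _ fun i j _ => ?_
  obtain ⟨k, hki, hkj⟩ := exists_ne_ne hN i j
  set W := Pi.single b 1 ᵥ* (γ⁻¹).1
  set d := (γ.1 *ᵥ Pi.single a 1) i * (γ.1 *ᵥ Pi.single b 1) j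
  have hd : W ⬝ᵥ (d • koszul W i j) = 0 := by rw [dotProduct_smul, dotProduct_koszul, smul_zero]
  obtain ⟨g, -, hge⟩ := linear_matMem (J := ⊤) (v := d • koszul W i j) (w := (X * p) • W) (k := k)
    (by rw [Pi.smul_apply, koszul_apply_of_ne _ hki hkj, smul_zero])
    (by rw [smul_dotProduct, hd, smul_zero]) fun l => trivial
  -- The factor `X` goes to the column coordinates with `w k = true` and to the row coordinates with
  -- `w l = false`. This matches conjugation by `tau`, and each term of the dot product still
  -- receives exactly one `X`.
  obtain ⟨g', hg', hge'⟩ := linear_matMem (J := ⊤)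
    (v := fun k => (if w k then X else 1) * (d • koszul W i j) k)
    (w := fun l => p * ((if w l then 1 else X) * W l)) (k := k)
    (by rw [Pi.smul_apply, koszul_apply_of_ne _ hki hkj, smul_zero, mul_zero]) (by
      rw [← mul_zero (X * p), ← hd, dotProduct, dotProduct, Finset.mul_sum]
      refine Finset.sum_congr rfl fun l _ => ?_
      split_ifs <;> ring) fun l => trivial
  rw [RootElements.relE_top] at hg'
  refine ⟨g, ⟨g', hg', ?_⟩, hge⟩
  ext k l
  change φ (g'.1 k l) = (tau w t * GeneralLinearGroup.map φ g * (tau w t)⁻¹).1 k l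
  rw [tau_conj_apply]
  change _ = _ * φ (g.1 k l) * _
  rw [hge, hge']
  simp only [Matrix.add_apply, vecMulVec_apply, map_add, map_mul, Pi.smul_apply, smul_eq_mul,
    Matrix.one_apply, apply_ite φ, map_one, map_zero, hX, tauUnit]
  have ht := t.mul_inv
  by_cases hkl : k = l
  · subst hkl
    by_cases hk : w k <;> simp only [hk, if_true, if_false, Bool.false_eq_true, inv_one,
      Units.val_one]
    · linear_combination -(1 + φ d * φ (koszul W i j k) * t * φ p * φ (W k)) * ht
    · ring
  · by_cases hk : w k <;> by_cases hl : w l <;> simp only [hkl, hk, hl, if_true, if_false,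
      Bool.false_eq_true, inv_one, Units.val_one]
    · linear_combination -(φ d * φ (koszul W i j k) * t * φ p * φ (W l)) * ht
    · ring
    · linear_combination -(φ d * φ (koszul W i j k) * φ p * φ (W l)) * ht
    · ring

/-- The special linear group as an elementary system. -/
def linearSystem {N : ℕ} (hN : 3 ≤ N) : ElementarySystem.{u} N where
  toElementaryGroup := linearGroup N
  sq_mul_mem H s y hH a b h := by
    obtain ⟨k, hka, hkb⟩ := exists_ne_ne hN a b
    -- The commutator of `x_{ak}(s)` and `x_{kb}(s y)`.
    have e : (linearRoots N).x a b h (s ^ 2 * y) = (linearRoots N).x a k hka.symm s *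
        (linearRoots N).x k b hkb (s * y) * (linearRoots N).x a k hka.symm (-s) *
        (linearRoots N).x k b hkb (-(s * y)) := by
      rw [(linearRoots N).x_neg, (linearRoots N).x_neg, sq, mul_assoc]
      exact elem_mul_eq_commutator hka.symm hkb h s (s * y)
    have h₁ := hH s (by simp) a k hka.symm
    have h₂ := hH (s * y) (by simp) k b hkb
    change (linearRoots N).x a b h (s ^ 2 * y) ∈ H
    rw [e]
    exact mul_mem (mul_mem (mul_mem h₁.1 h₂.1) h₁.2) h₂.2
  W := Set.univ
  W_compl _ _ := trivial
  W_sep a b h := ⟨fun c => decide (c = a), trivial, by simp, by simpa using h.symm⟩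
  tau_conj_mem_G w t g _ hg := (MonoidHom.normal_ker _).conj_mem g hg _
  tau_conj_x w t a b h c _ := by
    ext k l
    rw [tau_conj_apply]
    change _ * Matrix.transvection a b c k l * _ = Matrix.transvection a b _ k l
    simp only [Matrix.transvection, Matrix.add_apply, Matrix.one_apply, Matrix.single_apply]
    by_cases hkl : k = l
    · subst hkl
      have : ¬ (a = k ∧ b = k) := fun e => h (e.1.trans e.2.symm)
      simp [this]
    · by_cases hab : a = k ∧ b = l
      · rw [if_neg hkl, if_pos hab, if_pos hab, ← hab.1, ← hab.2, Units.val_mul]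
        ring
      · rw [if_neg hkl, if_neg hab, if_neg hab]
        simp
  tau_conj_mem_E w φ X t γ a b h p _ hX _ := linear_tau_conj_mem_E hN w φ hX γ a b h p
  exists_conj_mem φ M γ a b h hφ _ := linear_exists_conj_mem hN φ M γ a b h hφ
  E_inf_relGL_le J hJ := (linearBruhat N).E_inf_relGL_le hJ

end Linear

/-! ### The alternating form and symplectic transvections. -/

section SymplecticForm

variable {m : ℕ} {B : Type*} [CommRing B]

theorem neg_one_pow_swap (a : Fin (2 * m)) : (-1 : B) ^ (swap a : ℕ) = -(-1) ^ (a : ℕ) := by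
  rw [swap_val]
  split_ifs with h
  · rw [pow_succ, mul_neg_one]
  · obtain ⟨k, hk⟩ : ∃ k, (a : ℕ) = k + 1 := ⟨a - 1, by omega⟩
    rw [hk, Nat.add_sub_cancel, pow_succ, mul_neg_one, neg_neg]

theorem neg_one_pow_mul_self (n : ℕ) : (-1 : B) ^ n * (-1) ^ n = 1 := by
  rw [← mul_pow, neg_mul_neg, one_mul, one_pow]

theorem swap_eq_iff {a b : Fin (2 * m)} : swap a = b ↔ a = swap b :=
  ⟨fun h => by rw [← h, swap_swap], fun h => by rw [h, swap_swap]⟩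

/-- The vector dual to `v` with respect to the standard alternating form. -/
def sympDual (v : Fin (2 * m) → B) : Fin (2 * m) → B :=
  fun j => (-1) ^ (swap j : ℕ) * v (swap j)

open Matrix in
theorem mul_chi_apply {n : Type*} (M : Matrix n (Fin (2 * m)) B) (i : n) (j : Fin (2 * m)) :
    (M * chi m B) i j = (-1) ^ (swap j : ℕ) * M i (swap j) := by
  rw [mul_apply, Finset.sum_eq_single (swap j)]
  · simp [chi, swap_swap, mul_comm]
  · intro k _ hk
    have : j ≠ swap k := fun e => hk (by rw [e, swap_swap])
    simp [chi, this]
  · simp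

open Matrix in
theorem chi_mul_apply {n : Type*} (M : Matrix (Fin (2 * m)) n B) (i : Fin (2 * m)) (j : n) :
    (chi m B * M) i j = (-1) ^ (i : ℕ) * M (swap i) j := by
  rw [mul_apply, Finset.sum_eq_single (swap i)]
  · simp [chi]
  · intro k _ hk
    simp [chi, hk]
  · simp

open Matrix in
theorem vecMul_chi (v : Fin (2 * m) → B) : v ᵥ* chi m B = sympDual v := by
  ext j
  exact mul_chi_apply (fun (_ : Unit) => v) () j

open Matrix in
theorem chi_mulVec (v : Fin (2 * m) → B) : chi m B *ᵥ v = -sympDual v := by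
  ext j
  have := chi_mul_apply (fun i (_ : Unit) => v i) j ()
  rw [Pi.neg_apply, sympDual, neg_one_pow_swap, neg_mul, neg_neg]
  exact this

theorem chi_mul_chi : chi m B * chi m B = -1 := by
  ext i j
  rw [chi_mul_apply, chi, Matrix.of_apply, swap_swap, neg_one_pow_swap, Matrix.neg_apply,
    Matrix.one_apply]
  rcases eq_or_ne i j with rfl | h
  · rw [if_pos rfl, if_pos rfl, mul_neg, neg_one_pow_mul_self]
  · rw [if_neg h.symm, if_neg h, mul_zero, neg_zero]

open Matrix in
theorem mem_Sp_iff {g : GL (Fin (2 * m)) B} : g ∈ Sp m B ↔ g.1ᵀ * chi m B * g.1 = chi m B :=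
  Iff.rfl

open Matrix in
theorem transpose_mul_chi_mul_apply (M : Matrix (Fin (2 * m)) (Fin (2 * m)) B)
    (a b : Fin (2 * m)) : (Mᵀ * chi m B * M) a b =
      ∑ l, (-1) ^ (swap l : ℕ) * M (swap l) a * M l b := by
  rw [mul_apply]
  exact Finset.sum_congr rfl fun l _ => by rw [mul_chi_apply, transpose_apply]

theorem mem_Sp_iff_sum {g : GL (Fin (2 * m)) B} : g ∈ Sp m B ↔ ∀ a b,
    ∑ l, (-1) ^ (swap l : ℕ) * g.1 (swap l) a * g.1 l b = chi m B a b := by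
  rw [mem_Sp_iff, ← Matrix.ext_iff]
  simp only [transpose_mul_chi_mul_apply]

open Matrix in
/-- The transpose of a symplectic matrix is symplectic. -/
theorem mul_chi_mul_transpose {g : GL (Fin (2 * m)) B} (hg : g ∈ Sp m B) :
    g.1 * chi m B * g.1ᵀ = chi m B := by
  have h : (-(chi m B * g.1ᵀ * chi m B)) * g.1 = 1 := by
    rw [neg_mul, Matrix.mul_assoc, Matrix.mul_assoc, ← Matrix.mul_assoc g.1ᵀ, mem_Sp_iff.mp hg,
      chi_mul_chi, neg_neg]
  have h := mul_eq_one_comm.mp h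
  calc g.1 * chi m B * g.1ᵀ = g.1 * (-(chi m B * g.1ᵀ * chi m B)) * chi m B := by
        simp only [mul_neg, neg_mul, Matrix.mul_assoc, chi_mul_chi, neg_neg, mul_one]
    _ = chi m B := by rw [h, one_mul]

open Matrix in
theorem sympDual_mulVec {g : GL (Fin (2 * m)) B} (hg : g ∈ Sp m B) (v : Fin (2 * m) → B) :
    sympDual (g.1 *ᵥ v) = sympDual v ᵥ* (g⁻¹).1 := by
  have h : v ᵥ* (g.1ᵀ * chi m B) = v ᵥ* (chi m B * (g⁻¹).1) := by
    rw [← mem_Sp_iff.mp hg, Matrix.mul_assoc _ g.1, ← Units.val_mul, mul_inv_cancel,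
      Units.val_one, mul_one, mem_Sp_iff.mp hg]
  rw [← vecMul_chi, ← vecMul_chi, vecMul_vecMul, ← h, ← vecMul_vecMul, vecMul_transpose]

theorem sympDual_add (v w : Fin (2 * m) → B) : sympDual (v + w) = sympDual v + sympDual w := by
  ext j
  simp [sympDual, mul_add]

theorem sympDual_smul (c : B) (v : Fin (2 * m) → B) : sympDual (c • v) = c • sympDual v := by
  ext j
  simp [sympDual, mul_left_comm]

theorem sympDual_single (a : Fin (2 * m)) (c : B) :
    sympDual (Pi.single a c) = Pi.single (swap a) ((-1) ^ (a : ℕ) * c) := by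
  ext j
  rcases eq_or_ne (swap j) a with rfl | h
  · simp [sympDual, swap_swap]
  · have h' : j ≠ swap a := fun e => h (swap_eq_iff.mpr e)
    simp [sympDual, h, h']

open Matrix in
theorem sympDual_dotProduct_swap (v w : Fin (2 * m) → B) :
    sympDual v ⬝ᵥ w = -(sympDual w ⬝ᵥ v) := by
  rw [← neg_dotProduct, ← chi_mulVec, ← vecMul_chi, ← dotProduct_mulVec, dotProduct_comm]

open Matrix in
theorem sympDual_dotProduct_self (v : Fin (2 * m) → B) : sympDual v ⬝ᵥ v = 0 := by
  refine Finset.sum_involution (fun i _ => swap i) (fun i _ => ?_)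
    (fun i _ _ => swap_ne i) (fun i _ => Finset.mem_univ _) (fun i _ => swap_swap i)
  rw [sympDual, sympDual, swap_swap, neg_one_pow_swap]
  ring

/-- The symplectic transvection `1 + c v v*`. -/
def sympTrans (v : Fin (2 * m) → B) (c : B) : Matrix (Fin (2 * m)) (Fin (2 * m)) B :=
  1 + Matrix.vecMulVec v (c • sympDual v)

/-- The Eichler transformation `1 + c (v w* + w v*)`. -/
def sympTrans₂ (v w : Fin (2 * m) → B) (c : B) : Matrix (Fin (2 * m)) (Fin (2 * m)) B :=
  1 + (Matrix.vecMulVec v (c • sympDual w) + Matrix.vecMulVec w (c • sympDual v))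

open Matrix in
theorem sympTrans_isSymp (v : Fin (2 * m) → B) (c : B) :
    (sympTrans v c)ᵀ * chi m B * sympTrans v c = chi m B := by
  have h : (c • sympDual v) ⬝ᵥ v = 0 := by
    rw [smul_dotProduct, sympDual_dotProduct_self, smul_zero]
  have h' : vecMulVec (c • sympDual v) v * chi m B = vecMulVec (c • sympDual v) (sympDual v) := by
    rw [vecMulVec_mul, vecMul_chi]
  rw [sympTrans, transpose_add, transpose_one, transpose_vecMulVec, add_mul, one_mul, h', add_mul,
    mul_add, mul_one, mul_vecMulVec, chi_mulVec, mul_add, mul_one, vecMulVec_mul_vecMulVec,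
    sympDual_dotProduct_self, zero_smul, vecMulVec_zero, add_zero, neg_vecMulVec, vecMulVec_smul,
    smul_vecMulVec]
  abel

open Matrix in
theorem sympTrans_mul (v : Fin (2 * m) → B) (c d : B) :
    sympTrans v c * sympTrans v d = sympTrans v (c + d) := by
  rw [sympTrans, sympTrans, one_add_vecMulVec_mul_right, ← add_smul]
  · rfl
  · rw [smul_dotProduct, sympDual_dotProduct_self, smul_zero]

theorem sympTrans_smul (v : Fin (2 * m) → B) (c d : B) :
    sympTrans (c • v) d = sympTrans v (c ^ 2 * d) := by
  rw [sympTrans, sympTrans, sympDual_smul, Matrix.smul_vecMulVec, ← Matrix.vecMulVec_smul,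
    smul_smul, smul_smul]
  congr 3
  ring

theorem sympTrans₂_smul (v w : Fin (2 * m) → B) (c d : B) :
    sympTrans₂ v (c • w) d = sympTrans₂ v w (c * d) := by
  rw [sympTrans₂, sympTrans₂, sympDual_smul, Matrix.smul_vecMulVec, ← Matrix.vecMulVec_smul,
    smul_smul, smul_smul, mul_comm d]

theorem sympTrans₂_comm (v w : Fin (2 * m) → B) (c : B) :
    sympTrans₂ v w c = sympTrans₂ w v c := by
  rw [sympTrans₂, sympTrans₂, add_comm (Matrix.vecMulVec _ _)]

open Matrix in
-- Polarization of the quadratic expression `v ↦ c v v*`; orthogonality makes all cross products of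
-- the factors vanish.
theorem sympTrans_add {v w : Fin (2 * m) → B} (h : sympDual v ⬝ᵥ w = 0) (c : B) :
    sympTrans (v + w) c = sympTrans v c * sympTrans w c * sympTrans₂ v w c := by
  have h' : sympDual w ⬝ᵥ v = 0 := by rw [sympDual_dotProduct_swap, h, neg_zero]
  simp only [sympTrans, sympTrans₂, mul_add, add_mul, mul_one, one_mul, vecMulVec_mul_vecMulVec,
    smul_dotProduct, h, h', sympDual_dotProduct_self, smul_zero, zero_smul, vecMulVec_zero,
    add_zero, sympDual_add, add_vecMulVec, vecMulVec_add, smul_add]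
  abel

open Matrix in
theorem sympTrans₂_add {v w w' : Fin (2 * m) → B} (h : sympDual v ⬝ᵥ w = 0)
    (h' : sympDual v ⬝ᵥ w' = 0) (c : B) : sympTrans₂ v (w + w') c =
      sympTrans₂ v w c * sympTrans₂ v w' c * sympTrans v (-(c ^ 2 * (sympDual w ⬝ᵥ w'))) := by
  have h₁ : sympDual w ⬝ᵥ v = 0 := by rw [sympDual_dotProduct_swap, h, neg_zero]
  have h₂ : sympDual w' ⬝ᵥ v = 0 := by rw [sympDual_dotProduct_swap, h', neg_zero]
  simp only [sympTrans, sympTrans₂, mul_add, add_mul, mul_one, one_mul, vecMulVec_mul_vecMulVec,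
    smul_dotProduct, h', h₁, h₂, sympDual_dotProduct_self, zero_smul, vecMulVec_zero,
    add_zero, sympDual_add, add_vecMulVec, vecMulVec_add, smul_add, smul_eq_mul, mul_zero,
    zero_mul, smul_smul]
  rw [show c * (sympDual w ⬝ᵥ w') * c = c ^ 2 * (sympDual w ⬝ᵥ w') by ring, neg_smul, vecMulVec_neg]
  abel

open Matrix in
theorem conj_sympTrans {g : GL (Fin (2 * m)) B} (hg : g ∈ Sp m B) (v : Fin (2 * m) → B) (c : B) :
    g.1 * sympTrans v c * (g⁻¹).1 = sympTrans (g.1 *ᵥ v) c := by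
  rw [sympTrans, conj_one_add_vecMulVec, sympTrans, sympDual_mulVec hg, smul_vecMul]

open Matrix in
theorem symElemMatrix_swap (a : Fin (2 * m)) (c : B) :
    symElemMatrix a (swap a) c = transvection a (swap a) c := by
  rw [symElemMatrix, if_pos (swap_swap a).symm, transvection]

open Matrix in
theorem symElemMatrix_eq_mul {a b : Fin (2 * m)} (h : a ≠ swap b) (c : B) :
    symElemMatrix a b c = transvection a b c *
      transvection (swap b) (swap a) (-((-1) ^ ((a : ℕ) + (b : ℕ)) * c)) := by
  rw [symElemMatrix, if_neg h, transvection, transvection, mul_add, mul_one, add_mul, one_mul,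
    single_mul_single_of_ne _ _ _ _ (swap_ne b).symm, add_zero, sub_eq_add_neg, single_neg]

open Matrix in
theorem sympTrans_single (a : Fin (2 * m)) (c : B) :
    sympTrans (Pi.single a 1) c = symElemMatrix a (swap a) ((-1) ^ (a : ℕ) * c) := by
  rw [symElemMatrix_swap, transvection_eq_one_add, sympTrans, sympDual_single, mul_one,
    ← Pi.single_smul, smul_eq_mul, mul_comm c]

open Matrix in
theorem sympTrans₂_single {a b : Fin (2 * m)} (h : a ≠ b) (c : B) :
    sympTrans₂ (Pi.single a 1) (Pi.single b 1) c =
      symElemMatrix a (swap b) ((-1) ^ (b : ℕ) * c) := by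
  have h₁ := transvection_eq_one_add a (swap b) ((-1) ^ (b : ℕ) * c)
  have h₂ := transvection_eq_one_add b (swap a) ((-1) ^ (a : ℕ) * c)
  rw [transvection, add_right_inj] at h₁ h₂
  rw [symElemMatrix, swap_swap, if_neg h, sympTrans₂, sympDual_single, sympDual_single, mul_one,
    mul_one, ← Pi.single_smul, ← Pi.single_smul, smul_eq_mul, smul_eq_mul, mul_comm c, mul_comm c,
    ← h₁, ← h₂, pow_add, neg_one_pow_swap, ← add_assoc, sub_eq_add_neg, single_neg]
  congr 2
  linear_combination (-(-1) ^ (a : ℕ) * c) * neg_one_pow_mul_self (B := B) (b : ℕ)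

end SymplecticForm

/-! ### Symplectic transvections are elementary. -/

theorem MatMem.of_mul_right {N : ℕ} {B : Type*} [CommRing B] {H : Subgroup (GL (Fin N) B)}
    {M M' : Matrix (Fin N) (Fin N) B} (h : MatMem H (M * M')) (h' : MatMem H M') : MatMem H M := by
  obtain ⟨g, hg, e⟩ := h
  obtain ⟨g', hg', rfl⟩ := h'
  refine ⟨g * g'⁻¹, mul_mem hg (inv_mem hg'), ?_⟩
  rw [Units.val_mul, e, mul_assoc, ← Units.val_mul, mul_inv_cancel, Units.val_one, mul_one]

theorem MatMem.of_mul_left {N : ℕ} {B : Type*} [CommRing B] {H : Subgroup (GL (Fin N) B)}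
    {M M' : Matrix (Fin N) (Fin N) B} (h : MatMem H (M * M')) (h' : MatMem H M) : MatMem H M' := by
  obtain ⟨g, hg, e⟩ := h
  obtain ⟨g', hg', rfl⟩ := h'
  refine ⟨g'⁻¹ * g, mul_mem (inv_mem hg') hg, ?_⟩
  rw [Units.val_mul, e, ← mul_assoc, ← Units.val_mul, inv_mul_cancel, Units.val_one, one_mul]

section Symplectic

variable {m : ℕ}

theorem symElemMatrix_add {B : Type*} [CommRing B] {a b : Fin (2 * m)} (h : a ≠ b) (c d : B) :
    symElemMatrix a b (c + d) = symElemMatrix a b c * symElemMatrix a b d := by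
  have h1 : swap a ≠ swap b := fun e => h (by rw [← swap_swap a, e, swap_swap])
  have h2 := swap_ne a
  have h3 := swap_ne b
  unfold symElemMatrix
  split_ifs
  · simp [mul_add, add_mul, h.symm, Matrix.single_add, add_assoc]
  · simp [mul_add, add_mul, mul_sub, sub_mul, h.symm, h1, h2, h3.symm, Matrix.single_add]
    abel

/-- The elementary symplectic matrices as root elements. -/
def sympRoots (m : ℕ) : RootElements.{u} (2 * m) where
  x a b h c := symElem a b h c
  x_add a b h c d := Units.ext (symElemMatrix_add h c d)
  x_map φ a b h c := by
    ext k l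
    change φ (symElemMatrix a b c k l) = symElemMatrix a b (φ c) k l
    unfold symElemMatrix
    split_ifs <;>
      simp [Matrix.add_apply, Matrix.sub_apply, Matrix.one_apply, Matrix.single_apply, apply_ite φ]

open Matrix in
theorem sympDual_single_dotProduct {B : Type*} [CommRing B] (a : Fin (2 * m))
    (w : Fin (2 * m) → B) : sympDual (Pi.single a 1) ⬝ᵥ w = (-1) ^ (a : ℕ) * w (swap a) := by
  rw [sympDual_single, single_dotProduct, mul_one]

theorem symElemMatrix_eq_sympTrans {B : Type*} [CommRing B] (a : Fin (2 * m)) (c : B) :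
    symElemMatrix a (swap a) c = sympTrans (Pi.single a 1) ((-1) ^ (a : ℕ) * c) := by
  rw [sympTrans_single, ← mul_assoc, neg_one_pow_mul_self, one_mul]

theorem symElemMatrix_eq_sympTrans₂ {B : Type*} [CommRing B] {a b : Fin (2 * m)} (h : a ≠ swap b)
    (c : B) : symElemMatrix a b c =
      sympTrans₂ (Pi.single a 1) (Pi.single (swap b) 1) ((-1) ^ (swap b : ℕ) * c) := by
  rw [sympTrans₂_single h, ← mul_assoc, neg_one_pow_mul_self, one_mul, swap_swap]

open Matrix in
theorem sympDual_single_single {B : Type*} [CommRing B] {a b : Fin (2 * m)} (h : a ≠ b) :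
    sympDual (Pi.single a (1 : B)) ⬝ᵥ Pi.single (swap b) 1 = 0 := by
  have : swap a ≠ swap b := fun e => h (by rw [← swap_swap a, e, swap_swap])
  rw [sympDual_single_dotProduct, Pi.single_eq_of_ne this, mul_zero]

theorem sympTrans_zero {B : Type*} [CommRing B] (v : Fin (2 * m) → B) : sympTrans v 0 = 1 := by
  simp [sympTrans]

theorem sympTrans₂_zero {B : Type*} [CommRing B] (v : Fin (2 * m) → B) (c : B) :
    sympTrans₂ v 0 c = 1 := by
  have : sympDual (0 : Fin (2 * m) → B) = 0 := by ext; simp [sympDual]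
  simp [sympTrans₂, this]

open Matrix in
theorem sympTrans₂_eq {B : Type*} [CommRing B] {v w : Fin (2 * m) → B} (h : sympDual v ⬝ᵥ w = 0)
    (c : B) : sympTrans₂ v w c = sympTrans w (-c) * sympTrans v (-c) * sympTrans (v + w) c := by
  have h₁ : ∀ u : Fin (2 * m) → B, sympTrans u (-c) * sympTrans u c = 1 := fun u => by
    rw [sympTrans_mul, neg_add_cancel, sympTrans_zero]
  rw [sympTrans_add h, ← mul_assoc, ← mul_assoc, mul_assoc (sympTrans w (-c)), h₁, mul_one, h₁,
    one_mul]

open Matrix in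
theorem symElem_mem_Sp {B : Type*} [CommRing B] (a b : Fin (2 * m)) (h : a ≠ b) (c : B) :
    symElem a b h c ∈ Sp m B := by
  have key : ∀ M M' : Matrix (Fin (2 * m)) (Fin (2 * m)) B, Mᵀ * chi m B * M = chi m B →
      M'ᵀ * chi m B * M' = chi m B → (M * M')ᵀ * chi m B * (M * M') = chi m B := by
    intro M M' h h'
    rw [transpose_mul, Matrix.mul_assoc, Matrix.mul_assoc, ← Matrix.mul_assoc (chi m B),
      ← Matrix.mul_assoc Mᵀ, ← Matrix.mul_assoc Mᵀ, h, ← Matrix.mul_assoc, h']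
  rw [mem_Sp_iff]
  change (symElemMatrix a b c)ᵀ * chi m B * symElemMatrix a b c = _
  by_cases hab : a = swap b
  · rw [← swap_eq_iff.mpr hab, symElemMatrix_eq_sympTrans]
    exact sympTrans_isSymp _ _
  · rw [symElemMatrix_eq_sympTrans₂ hab, sympTrans₂_eq (sympDual_single_single h)]
    exact key _ _ (key _ _ (sympTrans_isSymp _ _) (sympTrans_isSymp _ _)) (sympTrans_isSymp _ _)

section Transvections

variable {B : Type u} [CommRing B] {J : Ideal B}

theorem matMem_sympTrans_single (a : Fin (2 * m)) {c : B} (hc : c ∈ J) :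
    MatMem ((sympRoots m).relE B J) (sympTrans (Pi.single a 1) c) := by
  rw [sympTrans_single]
  exact ⟨_, (sympRoots m).x_mem_relE a (swap a) (swap_ne a).symm (J.mul_mem_left _ hc), rfl⟩

theorem matMem_sympTrans₂_single {a b : Fin (2 * m)} (h : a ≠ b) (h' : a ≠ swap b) {c : B}
    (hc : c ∈ J) :
    MatMem ((sympRoots m).relE B J) (sympTrans₂ (Pi.single a 1) (Pi.single b 1) c) := by
  rw [sympTrans₂_single h]
  exact ⟨_, (sympRoots m).x_mem_relE a (swap b) h' (J.mul_mem_left _ hc), rfl⟩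

open Matrix in
-- Expand `w` in unit vectors. Each term is a root element, and the correction in `sympTrans₂_add`
-- is a transvection along `e_i`, again a root element.
theorem matMem_sympTrans₂_single_left {i : Fin (2 * m)} {w : Fin (2 * m) → B} (hi : w i = 0)
    (hi' : w (swap i) = 0) {c : B} (hc : c ∈ J) :
    MatMem ((sympRoots m).relE B J) (sympTrans₂ (Pi.single i 1) w c) := by
  rw [← Finset.univ_sum_single w]
  have h₀ : ∀ k, sympDual (Pi.single i 1) ⬝ᵥ Pi.single k (w k) = 0 := fun k => by
    rw [sympDual_single_dotProduct]
    rcases eq_or_ne (swap i) k with rfl | h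
    · rw [hi', Pi.single_zero, Pi.zero_apply, mul_zero]
    · rw [Pi.single_eq_of_ne h, mul_zero]
  generalize (Finset.univ : Finset (Fin (2 * m))) = s
  induction s using Finset.induction_on with
  | empty => rw [Finset.sum_empty, sympTrans₂_zero]; exact matMem_one
  | insert k s hk ih =>
    rw [Finset.sum_insert hk, sympTrans₂_add (h₀ k)
      (by rw [dotProduct_sum]; exact Finset.sum_eq_zero fun k _ => h₀ k)]
    refine (MatMem.mul ?_ ih).mul (matMem_sympTrans_single i (neg_mem (J.mul_mem_right _
      (J.pow_mem_of_mem hc 2 two_pos))))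
    by_cases h : i = k
    · rw [← h, hi, Pi.single_zero, sympTrans₂_zero]
      exact matMem_one
    by_cases h' : i = swap k
    · rw [← swap_eq_iff.mpr h', hi', Pi.single_zero, sympTrans₂_zero]
      exact matMem_one
    have e : (Pi.single k (w k) : Fin (2 * m) → B) = w k • Pi.single k 1 := by
      ext; simp [Pi.single_apply]
    rw [e, sympTrans₂_smul]
    exact matMem_sympTrans₂_single h h' (J.mul_mem_left _ hc)

theorem sympRoots_E_le_Sp : (sympRoots m).E B ≤ Sp m B :=
  (sympRoots m).E_le symElem_mem_Sp

open Matrix in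
-- An elementary Eichler transformation moves `e_j` to `e_j + u`, so the transvection along `e_j +
-- u` is a conjugate of a root element. Polarization leaves the one along `u`, up to elementary
-- factors.
theorem matMem_sympTrans_of_eq_zero {u : Fin (2 * m) → B} {j : Fin (2 * m)} (hj : u j = 0)
    (hj' : u (swap j) = 0) {c : B} (hc : c ∈ J) :
    MatMem ((sympRoots m).relE B J) (sympTrans u c) := by
  obtain ⟨γ, hγ, e⟩ := matMem_sympTrans₂_single_left (J := ⊤) (i := swap j)
    (w := (-1) ^ (swap j : ℕ) • u) (c := 1) (by simp [hj']) (by simp [swap_swap, hj]) trivial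
  rw [RootElements.relE_top] at hγ
  have hγj : γ.1 *ᵥ Pi.single j 1 = Pi.single j 1 + u := by
    have h₁ : sympDual ((-1) ^ (swap j : ℕ) • u) ⬝ᵥ Pi.single j 1 = 0 := by
      rw [dotProduct_single, sympDual, Pi.smul_apply, hj']
      simp
    rw [e, sympTrans₂, add_mulVec, one_mulVec, add_mulVec, vecMulVec_mulVec, vecMulVec_mulVec,
      one_smul, one_smul, h₁, sympDual_single_dotProduct, swap_swap, Pi.single_eq_same]
    ext k
    simp [mul_right_comm _ (u k), neg_one_pow_mul_self]
  obtain ⟨g, hg, e'⟩ := matMem_sympTrans_single j hc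
  have h₁ : MatMem ((sympRoots m).relE B J) (sympTrans (Pi.single j 1 + u) c) := by
    refine ⟨γ * g * γ⁻¹, (sympRoots m).relE_conj hγ hg, ?_⟩
    rw [Units.val_mul, Units.val_mul, e', conj_sympTrans (sympRoots_E_le_Sp hγ), hγj]
  rw [sympTrans_add (by rw [sympDual_single_dotProduct, hj', mul_zero])] at h₁
  exact (h₁.of_mul_right (matMem_sympTrans₂_single_left hj hj' hc)).of_mul_left
    (matMem_sympTrans_single j hc)

open Matrix in
/-- Symplectic transvections are elementary. -/
theorem matMem_sympTrans (hm : 2 ≤ m) (v : Fin (2 * m) → B) {c : B} (hc : c ∈ J) :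
    MatMem ((sympRoots m).relE B J) (sympTrans v c) := by
  set i : Fin (2 * m) := ⟨0, by omega⟩
  obtain ⟨j, hji, hji'⟩ := exists_ne_ne (by omega) i (swap i)
  have hij := swap_ne i
  have hsj : swap j ≠ i := fun e => hji' (swap_eq_iff.mp e)
  have hsj' : swap j ≠ swap i := fun e => hji (by rw [← swap_swap j, e, swap_swap])
  -- Split off the hyperbolic plane of `i`: the remainder `u` vanishes on that plane, while `w`
  -- vanishes on the plane of `j`, which exists since `m ≥ 2`.
  set w : Fin (2 * m) → B := v i • Pi.single i 1 + v (swap i) • Pi.single (swap i) 1 with hw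
  have hwj : w j = 0 := by simp [hw, hji, hji']
  have hwj' : w (swap j) = 0 := by simp [hw, hsj, hsj']
  set u := v - w with hu
  have hui : u i = 0 := by simp [hu, hw, hij.symm]
  have hui' : u (swap i) = 0 := by simp [hu, hw, hij]
  have hv : v = u + w := by rw [hu, sub_add_cancel]
  have h₁ : sympDual u ⬝ᵥ (v i • Pi.single i 1) = 0 := by
    rw [dotProduct_smul, dotProduct_single, sympDual, hui']
    simp
  have h₂ : sympDual u ⬝ᵥ (v (swap i) • Pi.single (swap i) 1) = 0 := by
    rw [dotProduct_smul, dotProduct_single, sympDual, swap_swap, hui]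
    simp
  have h₃ : sympDual u ⬝ᵥ w = 0 := by rw [hw, dotProduct_add, h₁, h₂, add_zero]
  have h₄ : ∀ c ∈ J, MatMem ((sympRoots m).relE B J) (sympTrans u c) := fun c hc =>
    matMem_sympTrans_of_eq_zero hui hui' hc
  rw [hv, sympTrans_add h₃, hw, sympTrans₂_add h₁ h₂, ← hw]
  refine ((h₄ c hc).mul (matMem_sympTrans_of_eq_zero hwj hwj' hc)).mul ((MatMem.mul ?_ ?_).mul
    (h₄ _ (neg_mem (J.mul_mem_right _ (J.pow_mem_of_mem hc 2 two_pos)))))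
  · rw [sympTrans₂_smul, sympTrans₂_comm]
    exact matMem_sympTrans₂_single_left hui hui' (J.mul_mem_left _ hc)
  · rw [sympTrans₂_smul, sympTrans₂_comm]
    exact matMem_sympTrans₂_single_left hui' (by rw [swap_swap, hui]) (J.mul_mem_left _ hc)

end Transvections

end Symplectic

/-! ### The symplectic group and its diagonal matrices. -/

section SymplecticGroup

variable {m : ℕ}

theorem symElemMatrix_apply {B : Type*} [CommRing B] (a b : Fin (2 * m)) (c : B)
    (k l : Fin (2 * m)) : symElemMatrix a b c k l = (1 : Matrix (Fin (2 * m)) (Fin (2 * m)) B) k l +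
      (if k = a ∧ l = b then c else 0) - if a ≠ swap b ∧ k = swap b ∧ l = swap a then
        (-1) ^ ((a : ℕ) + (b : ℕ)) * c else 0 := by
  have e : ∀ i j (z : B), Matrix.single i j z k l = if k = i ∧ l = j then z else 0 := fun i j z => by
    rw [Matrix.single_apply]
    simp only [eq_comm]
  unfold symElemMatrix
  by_cases h : a = swap b
  · have h' : ¬ (a ≠ swap b ∧ k = swap b ∧ l = swap a) := fun h' => h'.1 h
    rw [if_pos h, Matrix.add_apply, e, if_neg h', sub_zero]
  · rw [if_neg h, Matrix.sub_apply, Matrix.add_apply, e, e]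
    simp only [ne_eq, h, not_false_eq_true, true_and]

open Matrix in
-- The form pairs column `i`, a multiple of `e_i`, with column `b`, so only the entry in row `swap
-- i` survives.
theorem sp_clear_left {B : Type*} [CommRing B] {g : GL (Fin (2 * m)) B} (hg : g ∈ Sp m B)
    {i : Fin (2 * m)} (h : ∀ k, k ≠ i → g.1 k i = 0) (b : Fin (2 * m)) :
    g.1 i i * g.1 (swap i) b = if b = swap i then 1 else 0 := by
  have e := mem_Sp_iff_sum.mp hg i b
  rw [Finset.sum_eq_single (swap i) (fun l _ hl => by
    rw [h _ fun e => hl (swap_eq_iff.mp e), mul_zero, zero_mul]) (by simp), swap_swap, chi,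
    of_apply] at e
  calc _ = (-1) ^ (i : ℕ) * ((-1) ^ (i : ℕ) * g.1 i i * g.1 (swap i) b) := by
        rw [← mul_assoc, ← mul_assoc, neg_one_pow_mul_self, one_mul]
    _ = _ := by rw [e, mul_ite, neg_one_pow_mul_self, mul_zero]

open Matrix in
theorem sp_clear_right {B : Type*} [CommRing B] {g : GL (Fin (2 * m)) B} (hg : g ∈ Sp m B)
    {i : Fin (2 * m)} (h : ∀ l, l ≠ i → g.1 i l = 0) (b : Fin (2 * m)) :
    g.1 i i * g.1 b (swap i) = if b = swap i then 1 else 0 := by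
  have e := congrFun (congrFun (mul_chi_mul_transpose hg) i) b
  rw [mul_apply, Finset.sum_eq_single (swap i) (fun l _ hl => by
    rw [mul_chi_apply, h _ fun e => hl (swap_eq_iff.mp e), mul_zero, zero_mul]) (by simp),
    mul_chi_apply, swap_swap, chi, of_apply, transpose_apply] at e
  calc _ = (-1) ^ (i : ℕ) * ((-1) ^ (i : ℕ) * g.1 i i * g.1 b (swap i)) := by
        rw [← mul_assoc, ← mul_assoc, neg_one_pow_mul_self, one_mul]
    _ = _ := by rw [e, mul_ite, neg_one_pow_mul_self, mul_zero]

theorem eq_zero_of_mul_eq_ite {B : Type*} [CommRing B] {p : B} {i : Fin (2 * m)}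
    {f : Fin (2 * m) → B} (h : ∀ b, p * f b = if b = i then 1 else 0) {b : Fin (2 * m)}
    (hb : b ≠ i) : f b = 0 := by
  have h₁ := h i
  have h₂ := h b
  rw [if_pos rfl] at h₁
  rw [if_neg hb] at h₂
  linear_combination (-(f b)) * h₁ + f i * h₂

/-- Diagonal entries at partner indices are inverse to each other, so one factor `diag(u, u⁻¹)` at
`i` and `swap i` trivializes both. -/
theorem symp_diag_mem {B : Type u} [CommRing B] {J : Ideal B} (s : Finset (Fin (2 * m))) :
    ∀ g : GL (Fin (2 * m)) B, (∀ a b, a ≠ b → g.1 a b = 0) → g ∈ relGL (2 * m) B J → g ∈ Sp m B →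
    (∀ i, i ∉ s → swap i ∉ s → g.1 i i = 1) → g ∈ (sympRoots m).relE B J := by
  induction s using Finset.induction_on with
  | empty =>
    intro g hg _ _ h1
    have : g = 1 := by
      ext a b
      rcases eq_or_ne a b with rfl | hab
      · rw [h1 a (by simp) (by simp), Units.val_one, Matrix.one_apply_eq]
      · rw [hg a b hab, Units.val_one, Matrix.one_apply_ne hab]
    rw [this]
    exact one_mem _
  | insert i s his ih =>
    intro g hg hJ hSp h1
    have hu : g.1 i i * g.1 (swap i) (swap i) = 1 := by
      rw [sp_clear_left hSp (fun k hk => hg k i hk), if_pos rfl]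
    set u : Bˣ := ⟨g.1 (swap i) (swap i), g.1 i i, by rw [mul_comm]; exact hu, hu⟩ with hu'
    have huJ : (u : B) - 1 ∈ J := by
      have := mem_relGL.mp hJ (swap i) (swap i)
      rwa [Matrix.one_apply_eq] at this
    have hii : i ≠ swap i := (swap_ne i).symm
    have hp : diagPair hii u ∈ (sympRoots m).relE B J :=
      (sympRoots m).diagPair_mem_relE hii (fun c => symElemMatrix_swap i c) (fun c => by
        have := symElemMatrix_swap (swap i) c
        rwa [swap_swap] at this) huJ
    have hpv : (diagPair hii u).1 = Matrix.diagonal fun k =>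
        if k = i then (u : B) else if k = swap i then ((u⁻¹ : Bˣ) : B) else 1 := blk_diagonal hii _ _
    have hgp : ∀ a b, (g * diagPair hii u).1 a b = g.1 a b *
        (if b = i then (u : B) else if b = swap i then ((u⁻¹ : Bˣ) : B) else 1) := fun a b => by
      rw [Units.val_mul, hpv, Matrix.mul_diagonal]
    have := ih (g * diagPair hii u)
      (fun a b hab => by rw [hgp, hg a b hab, zero_mul])
      (mul_mem hJ ((sympRoots m).relE_le_relGL _ hp))
      (mul_mem hSp (sympRoots_E_le_Sp ((sympRoots m).relE_le_E _ hp)))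
      (fun j hj hj' => by
        rw [hgp]
        by_cases hji : j = i
        · subst hji
          rw [if_pos rfl]
          exact hu
        · by_cases hji' : j = swap i
          · subst hji'
            rw [if_neg hji, if_pos rfl]
            exact (mul_comm _ _).trans hu
          · rw [if_neg hji, if_neg hji', mul_one]
            refine h1 j (by simp [hji, hj]) ?_
            rw [Finset.mem_insert, not_or]
            exact ⟨fun e => hji' (swap_eq_iff.mp e), hj'⟩)
    have := mul_mem this (inv_mem hp)
    rwa [mul_inv_cancel_right] at this

open Matrix in
/-- The symplectic group with the elementary symplectic matrices. -/
def sympGroup (m : ℕ) : ElementaryGroup.{u} (2 * m) where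
  toRootElements := sympRoots m
  σ := swap
  σ_σ := swap_swap
  G B _ := Sp m B
  x_mem_G := symElem_mem_Sp
  map_mem_G φ g hg := by
    rw [mem_Sp_iff_sum] at hg ⊢
    intro a b
    have := congrArg φ (hg a b)
    simpa [chi, apply_ite φ] using this
  mem_G_of_map φ ψ h g h₁ h₂ := by
    rw [mem_Sp_iff_sum] at h₁ h₂ ⊢
    intro a b
    refine sub_eq_zero.mp (h _ ?_ ?_)
    · rw [map_sub, sub_eq_zero]
      simpa [chi, apply_ite φ] using h₁ a b
    · rw [map_sub, sub_eq_zero]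
      simpa [chi, apply_ite ψ] using h₂ a b
  x_row a b h c l := by
    change symElemMatrix a b c a l = _
    rw [symElemMatrix_apply]
    have : ¬ (a ≠ swap b ∧ a = swap b ∧ l = swap a) := fun e => e.1 e.2.1
    simp [this]
  x_row_ne a b h c k l hk hk' := by
    change symElemMatrix a b c k l = _
    rw [symElemMatrix_apply]
    simp [hk, hk' (swap_ne b)]
  x_col a b h c k := by
    change symElemMatrix a b c k b = _
    rw [symElemMatrix_apply]
    have : ¬ (a ≠ swap b ∧ k = swap b ∧ b = swap a) := fun e => e.1 (swap_eq_iff.mp e.2.2.symm)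
    simp [this]
  x_col_ne a b h c k l hl hl' := by
    change symElemMatrix a b c k l = _
    rw [symElemMatrix_apply]
    simp [hl, hl' (swap_ne a)]
  G_clear hg i h₁ h₂ k hk := ⟨eq_zero_of_mul_eq_ite (sp_clear_left hg h₂) hk,
    eq_zero_of_mul_eq_ite (f := fun b => _) (sp_clear_right hg h₁) hk⟩
  diag_mem J g hg hd hJ := symp_diag_mem Finset.univ g hd hJ hg
    fun i hi => absurd (Finset.mem_univ i) hi

end SymplecticGroup

/-! ### Bruhat decomposition of the symplectic group. -/

theorem blk_mul_comm {N : ℕ} {B : Type*} [CommRing B] {a b c d : Fin N} (hac : a ≠ c) (had : a ≠ d)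
    (hbc : b ≠ c) (hbd : b ≠ d) (p q r s p' q' r' s' : B) :
    blk a b p q r s * blk c d p' q' r' s' = blk c d p' q' r' s' * blk a b p q r s := by
  simp only [blk, mul_add, add_mul, mul_one, one_mul,
    Matrix.single_mul_single_of_ne _ _ _ _ hac, Matrix.single_mul_single_of_ne _ _ _ _ hac.symm,
    Matrix.single_mul_single_of_ne _ _ _ _ had, Matrix.single_mul_single_of_ne _ _ _ _ had.symm,
    Matrix.single_mul_single_of_ne _ _ _ _ hbc, Matrix.single_mul_single_of_ne _ _ _ _ hbc.symm,
    Matrix.single_mul_single_of_ne _ _ _ _ hbd, Matrix.single_mul_single_of_ne _ _ _ _ hbd.symm]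
  abel

section SymplecticBruhat

variable {m : ℕ}

/-- The position of an index in the order in which the members of each pair are symmetric with
respect to the centre. -/
def sympPos (a : Fin (2 * m)) : ℕ :=
  if (a : ℕ) % 2 = 0 then (a : ℕ) / 2 else 2 * m - 1 - (a : ℕ) / 2

theorem sympPos_lt (a : Fin (2 * m)) : sympPos a < 2 * m := by
  have := a.2
  unfold sympPos
  split_ifs <;> omega

theorem sympPos_swap (a : Fin (2 * m)) : sympPos (swap a) = 2 * m - 1 - sympPos a := by
  have := a.2
  unfold sympPos
  rw [swap_val]
  split_ifs <;> omega

theorem sympPos_injective : Function.Injective (sympPos (m := m)) := by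
  intro a b h
  have := a.2
  have := b.2
  unfold sympPos at h
  apply Fin.ext
  split_ifs at h <;> omega

theorem exists_sympPos {p : ℕ} (hp : p < 2 * m) : ∃ a : Fin (2 * m), sympPos a = p := by
  have : Function.Surjective fun a : Fin (2 * m) => (⟨sympPos a, sympPos_lt a⟩ : Fin (2 * m)) :=
    Finite.surjective_of_injective fun a b h => sympPos_injective (congrArg Fin.val h)
  obtain ⟨a, ha⟩ := this ⟨p, hp⟩
  exact ⟨a, congrArg Fin.val ha⟩

theorem swap_ne_swap {a b : Fin (2 * m)} (h : a ≠ b) : swap a ≠ swap b :=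
  fun e => h (by rw [← swap_swap a, e, swap_swap])

theorem symElem_val_eq_blk {B : Type*} [CommRing B] {a b : Fin (2 * m)} (h : a ≠ b)
    (h' : a ≠ swap b) (c : B) : (symElem a b h c).1 =
      blk a b 1 c 0 1 * blk (swap b) (swap a) 1 (-(-1) ^ ((a : ℕ) + (b : ℕ)) * c) 0 1 := by
  change symElemMatrix a b c = _
  rw [symElemMatrix_eq_mul h', ← transvection_eq_blk, ← transvection_eq_blk, neg_mul]

theorem symElem_val_eq_blk' {B : Type*} [CommRing B] {a b : Fin (2 * m)} (h : b ≠ a)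
    (h' : b ≠ swap a) (c : B) : (symElem b a h c).1 =
      blk a b 1 0 c 1 * blk (swap b) (swap a) 1 0 (-(-1) ^ ((a : ℕ) + (b : ℕ)) * c) 1 := by
  change symElemMatrix b a c = _
  rw [symElemMatrix_eq_mul h', ← transvection_eq_blk', ← transvection_eq_blk', neg_mul,
    add_comm (b : ℕ)]

/-- A short root element is a product of two commuting two-by-two blocks, so its reflection is
computed in each block separately. -/
theorem symp_weylElement_short {B : Type u} [CommRing B] {a b : Fin (2 * m)} (h : a ≠ b)
    (h' : a ≠ swap b) (c : Bˣ) : ((sympRoots m).weylElement a b h c).1 =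
      blk a b 0 (-((c⁻¹ : Bˣ) : B)) c 0 *
        blk (swap b) (swap a) 0 (-(((-(-1) ^ ((a : ℕ) + (b : ℕ)) * c)⁻¹ : Bˣ) : B))
          ((-(-1) ^ ((a : ℕ) + (b : ℕ)) * c : Bˣ) : B) 0 := by
  have hba : b ≠ swap a := fun e => h' (swap_eq_iff.mp e.symm)
  have hs := swap_ne_swap h
  set ε : Bˣ := -(-1) ^ ((a : ℕ) + (b : ℕ)) with hε
  have hε' : -(-1) ^ ((a : ℕ) + (b : ℕ)) = (ε : B) := by simp [hε]
  have hεε : (ε : B) * ε = 1 := by rw [← hε', neg_mul_neg, neg_one_pow_mul_self]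
  have hεi : ε⁻¹ = ε := inv_eq_of_mul_eq_one_right (Units.ext hεε)
  have hcomm : ∀ p q r s p' q' r' s' : B,
      Commute (blk (swap b) (swap a) p' q' r' s') (blk a b p q r s) :=
    fun p q r s p' q' r' s' => (blk_mul_comm h' (swap_ne a).symm (swap_ne b).symm hba ..).symm
  have hc := c.mul_inv
  have hu : (((ε * c)⁻¹ : Bˣ) : B) = ε * ((c⁻¹ : Bˣ) : B) := by
    rw [mul_inv, hεi, Units.val_mul]
  change (symElem a b h _ * symElem b a h.symm _ * symElem a b h _).1 = _
  rw [Units.val_mul, Units.val_mul, symElem_val_eq_blk h h', symElem_val_eq_blk' h.symm hba, hε', hu,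
    (hcomm ..).mul_mul_mul_comm, blk_mul h, blk_mul hs.symm, (hcomm ..).mul_mul_mul_comm, blk_mul h,
    blk_mul hs.symm, Units.val_mul]
  have hεc : (ε : B) * ((c⁻¹ : Bˣ) : B) * (ε * c) = 1 := by
    linear_combination (c : B) * ((c⁻¹ : Bˣ) : B) * hεε + hc
  congr 2
  all_goals first
    | ring1
    | linear_combination -hc
    | linear_combination ((c⁻¹ : Bˣ) : B) * hc
    | linear_combination -hεc
    | linear_combination (ε * ((c⁻¹ : Bˣ) : B)) * hεc

/-- The representatives of the simple reflections of the symplectic group are monomial. -/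
theorem symp_weyl {B : Type u} [CommRing B] (a b : Fin (2 * m)) (h : a ≠ b) (c : Bˣ) :
    ∃ π v, IsMonomial π v ((sympRoots m).weylElement a b h c).1 ∧ π a = b ∧ π b = a ∧
      π (swap a) = swap b ∧ π (swap b) = swap a ∧
      ∀ k, k ≠ a → k ≠ b → k ≠ swap a → k ≠ swap b → π k = k := by
  by_cases hab : a = swap b
  · obtain rfl := swap_eq_iff.mpr hab
    refine ⟨_, fun k => if k = a then c else if k = swap a then -c⁻¹ else 1, ?_,
      Equiv.swap_apply_left a (swap a), Equiv.swap_apply_right _ _, ?_, ?_, ?_⟩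
    · rw [RootElements.weylElement_val _ h (fun c => symElemMatrix_swap a c) (fun c => by
        have := symElemMatrix_swap (swap a) c
        rwa [swap_swap] at this)]
      exact isMonomial_blk h c (-c⁻¹)
    · rw [swap_swap, Equiv.swap_apply_right]
    · rw [swap_swap, Equiv.swap_apply_left]
    · exact fun k h₁ h₂ _ _ => Equiv.swap_apply_of_ne_of_ne h₁ h₂
  · have hba : b ≠ swap a := fun e => hab (swap_eq_iff.mp e.symm)
    have hs := swap_ne_swap h
    have h₁ := isMonomial_blk h c (-c⁻¹)
    have h₂ := isMonomial_blk hs.symm (-(-1) ^ ((a : ℕ) + (b : ℕ)) * c)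
      (-(-(-1) ^ ((a : ℕ) + (b : ℕ)) * c)⁻¹)
    refine ⟨_, _, by rw [symp_weylElement_short h hab]; exact h₁.mul h₂, ?_, ?_, ?_, ?_, ?_⟩
    · rw [Equiv.Perm.mul_apply, Equiv.swap_apply_of_ne_of_ne hab (swap_ne a).symm,
        Equiv.swap_apply_left]
    · rw [Equiv.Perm.mul_apply, Equiv.swap_apply_of_ne_of_ne (swap_ne b).symm hba,
        Equiv.swap_apply_right]
    · rw [Equiv.Perm.mul_apply, Equiv.swap_apply_right,
        Equiv.swap_apply_of_ne_of_ne (Ne.symm hab) (swap_ne b)]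
    · rw [Equiv.Perm.mul_apply, Equiv.swap_apply_left,
        Equiv.swap_apply_of_ne_of_ne (swap_ne a) (Ne.symm hba)]
    · intro k h₁ h₂ h₃ h₄
      rw [Equiv.Perm.mul_apply, Equiv.swap_apply_of_ne_of_ne h₄ h₃,
        Equiv.swap_apply_of_ne_of_ne h₁ h₂]

/-- Monomial symplectic matrices permute the pairs of indices. -/
theorem symp_monomial {B : Type*} [CommRing B] [Nontrivial B] {n : GL (Fin (2 * m)) B}
    {π : Equiv.Perm (Fin (2 * m))} {v : Fin (2 * m) → Bˣ} (hn : n ∈ Sp m B)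
    (h : IsMonomial π v n.1) (a : Fin (2 * m)) : π (swap a) = swap (π a) ∧
      (v a * v (swap a) : B) = (-1) ^ (a : ℕ) * (-1) ^ (π a : ℕ) := by
  have e := mem_Sp_iff_sum.mp hn a (swap a)
  rw [Finset.sum_eq_single (swap (π a)) (fun l _ hl => by
    rw [h _ a, if_neg fun e => hl (swap_eq_iff.mp e), mul_zero, zero_mul]) (by simp), swap_swap,
    h _ a, if_pos rfl, h, chi, Matrix.of_apply, if_pos rfl] at e
  have hne : (-1 : B) ^ (a : ℕ) ≠ 0 := fun h => by
    have := neg_one_pow_mul_self (B := B) (a : ℕ)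
    rw [h, mul_zero] at this
    exact zero_ne_one this
  split_ifs at e with hπ
  · refine ⟨hπ.symm, ?_⟩
    linear_combination (-1) ^ (π a : ℕ) * e -
      (v a * v (swap a) : B) * neg_one_pow_mul_self (B := B) (π a : ℕ)
  · rw [mul_zero] at e
    exact absurd e.symm hne

theorem symp_monomial_mul {B : Type u} [CommRing B] {n : GL (Fin (2 * m)) B}
    {π : Equiv.Perm (Fin (2 * m))} {v : Fin (2 * m) → Bˣ} (hn : n ∈ Sp m B)
    (hv : IsMonomial π v n.1) (a b : Fin (2 * m)) (h : a ≠ b) (c : B) :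
    n * symElem a b h c =
      symElem (π a) (π b) (π.injective.ne h) (((v a * (v b)⁻¹ : Bˣ) : B) * c) * n := by
  rcases subsingleton_or_nontrivial B with hB | hB
  · exact Units.ext (Subsingleton.elim _ _)
  apply Units.ext
  change n.1 * symElemMatrix a b c = symElemMatrix (π a) (π b) _ * n.1
  by_cases hab : a = swap b
  · obtain rfl := swap_eq_iff.mpr hab
    rw [symElemMatrix_swap, hv.mul_transvection, (symp_monomial hn hv a).1, symElemMatrix_swap]
  · have hab' : π a ≠ swap (π b) := by
      rw [← (symp_monomial hn hv b).1]
      exact π.injective.ne hab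
    rw [symElemMatrix_eq_mul hab, symElemMatrix_eq_mul hab', ← mul_assoc, hv.mul_transvection,
      mul_assoc, hv.mul_transvection, mul_assoc, (symp_monomial hn hv a).1,
      (symp_monomial hn hv b).1]
    congr 3
    have ha := (symp_monomial hn hv a).2
    have hb := (symp_monomial hn hv b).2
    have hs := fun k : Fin (2 * m) => neg_one_pow_mul_self (B := B) (k : ℕ)
    have ha' : (((v (swap a))⁻¹ : Bˣ) : B) = (-1) ^ (a : ℕ) * (-1) ^ (π a : ℕ) * v a := by
      linear_combination (-((-1) ^ (a : ℕ) * (-1) ^ (π a : ℕ)) * ((v (swap a))⁻¹ : Bˣ)) * ha +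
        ((-1) ^ (a : ℕ) * (-1) ^ (π a : ℕ) * v a) * (v (swap a)).inv_mul -
        (((v (swap a))⁻¹ : Bˣ) * ((-1) ^ (π a : ℕ) * (-1) ^ (π a : ℕ))) * hs a -
        ((v (swap a))⁻¹ : Bˣ) * hs (π a)
    have hb' : (v (swap b) : B) = (-1) ^ (b : ℕ) * (-1) ^ (π b : ℕ) * ((v b)⁻¹ : Bˣ) := by
      linear_combination (-(v (swap b) : B)) * (v b).mul_inv + ((v b)⁻¹ : Bˣ) * hb
    rw [Units.val_mul, Units.val_mul, ha', hb', pow_add, pow_add]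
    linear_combination (-((-1) ^ (π a : ℕ) * (-1) ^ (π b : ℕ) * v a * ((v b)⁻¹ : Bˣ) * c) *
      ((-1) ^ (b : ℕ) * (-1) ^ (b : ℕ))) * hs a -
      ((-1) ^ (π a : ℕ) * (-1) ^ (π b : ℕ) * v a * ((v b)⁻¹ : Bˣ) * c) * hs b

/-- For a short root the conjugation is done by two commuting transvections in turn, each of which
needs its own superdiagonal coordinate to vanish. -/
theorem symp_conj_unitri {B : Type*} [CommRing B] {a b : Fin (2 * m)} (h : b ≠ a)
    (hab : sympPos b = sympPos a + 1) {g : GL (Fin (2 * m)) B} (hg : g ∈ Sp m B)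
    (hu : Unitri sympPos g.1) (h0 : g.1 a b = 0) (c : B) :
    Unitri sympPos (symElem b a h c * g * symElem b a h (-c)).1 ∧
      (symElem b a h c * g * symElem b a h (-c)).1 a b = 0 := by
  change Unitri sympPos (symElemMatrix b a c * g.1 * symElemMatrix b a (-c)) ∧
      (symElemMatrix b a c * g.1 * symElemMatrix b a (-c)) a b = 0
  by_cases hba : b = swap a
  · subst hba
    have e := fun c : B => symElemMatrix_swap (swap a) c
    rw [swap_swap] at e
    rw [e, e]
    refine ⟨unitri_transvection_conj sympPos_injective hab hu h0 c, ?_⟩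
    rw [transvection_conj_apply h0, h0, if_neg h.symm, if_neg h]
    ring
  have hab' : a ≠ swap b := fun e => hba (swap_eq_iff.mp e.symm)
  have hs := swap_ne_swap h
  have hpa := sympPos_swap a
  have hpb := sympPos_swap b
  have hlt := sympPos_lt b
  set d := -((-1) ^ ((b : ℕ) + (a : ℕ)) * c) with hd
  set M := Matrix.transvection (swap a) (swap b) d * g.1 *
    Matrix.transvection (swap a) (swap b) (-d) with hM
  have e : symElemMatrix b a c * g.1 * symElemMatrix b a (-c) =
      Matrix.transvection b a c * M * Matrix.transvection b a (-c) := by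
    have e₁ : symElemMatrix b a (-c) =
        Matrix.transvection (swap a) (swap b) (-d) * Matrix.transvection b a (-c) := by
      rw [symElemMatrix_eq_mul hba, transvection_eq_blk b a, transvection_eq_blk (swap a) (swap b),
        blk_mul_comm hba (swap_ne b).symm (swap_ne a).symm hab', hd, mul_neg,
        transvection_eq_blk (swap a) (swap b)]
    rw [e₁, symElemMatrix_eq_mul hba, ← hd, hM]
    simp only [mul_assoc]
  -- Only two terms survive in the form of the columns `b` and `swap a`; this equates the mirrored
  -- coordinate with `g a b` up to sign.
  have h0' : g.1 (swap b) (swap a) = 0 := by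
    have e := mem_Sp_iff_sum.mp hg b (swap a)
    rw [← Finset.sum_subset (Finset.subset_univ {swap a, swap b}), Finset.sum_pair hs.symm,
      swap_swap, swap_swap, h0, hu.2 b, chi, Matrix.of_apply, if_neg hs.symm] at e
    · linear_combination (-1) ^ (b : ℕ) * e -
        g.1 (swap b) (swap a) * neg_one_pow_mul_self (B := B) (b : ℕ)
    · intro k _ hk
      simp only [Finset.mem_insert, Finset.mem_singleton, not_or] at hk
      have h₁ := sympPos_injective.ne hk.1
      have h₂ := sympPos_injective.ne hk.2
      have h₃ := sympPos_swap k
      rcases lt_or_gt_of_ne h₁ with h₄ | h₄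
      · rw [hu.1 (swap k) b (by omega), mul_zero, zero_mul]
      · rw [hu.1 k (swap a) h₄, mul_zero]
  have hM' : Unitri sympPos M :=
    unitri_transvection_conj sympPos_injective (by omega) hu h0' d
  have hM0 : M a b = 0 := by
    rw [hM, transvection_conj_apply h0', h0, if_neg (swap_ne a).symm, if_neg (swap_ne b).symm]
    ring
  rw [e]
  refine ⟨unitri_transvection_conj sympPos_injective hab hM' hM0 c, ?_⟩
  rw [transvection_conj_apply hM0, hM0, if_neg h.symm, if_neg h]
  ring

/-- Conjugation by simple reflections brings any pair of indices to adjacent positions, shortening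
the distance at each step. -/
theorem symp_mem_of_adjacent {B : Type u} [CommRing B] (H : Subgroup (GL (Fin (2 * m)) B))
    (hH : ∀ (a b : Fin (2 * m)) (h : a ≠ b) (c : B),
      (sympPos b = sympPos a + 1 ∨ sympPos a = sympPos b + 1) → symElem a b h c ∈ H) (n : ℕ) :
    ∀ (a b : Fin (2 * m)) (h : a ≠ b), sympPos a < sympPos b → sympPos b ≤ sympPos a + n →
      ∀ c : B, symElem a b h c ∈ H ∧ symElem b a h.symm c ∈ H := by
  have step : ∀ p q : Fin (2 * m), sympPos q = sympPos p + 1 → ∃ π : Equiv.Perm (Fin (2 * m)),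
      π p = q ∧ π q = p ∧ π (swap p) = swap q ∧ π (swap q) = swap p ∧
      (∀ k, k ≠ p → k ≠ q → k ≠ swap p → k ≠ swap q → π k = k) ∧
      ∀ (a b : Fin (2 * m)) (h : a ≠ b),
        (∀ c : B, symElem (π a) (π b) (π.injective.ne h) c ∈ H ∧
          symElem (π b) (π a) (π.injective.ne h.symm) c ∈ H) →
        ∀ c : B, symElem a b h c ∈ H ∧ symElem b a h.symm c ∈ H := by
    intro p q hpq
    have hne : p ≠ q := fun e => by rw [e] at hpq; omega
    obtain ⟨π, v, hv, h₁, h₂, h₃, h₄, h₅⟩ := symp_weyl p q hne (1 : Bˣ)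
    have hwH : (sympRoots m).weylElement p q hne (1 : Bˣ) ∈ H :=
      mul_mem (mul_mem (hH p q hne _ (Or.inl hpq)) (hH q p hne.symm _ (Or.inr hpq)))
        (hH p q hne _ (Or.inl hpq))
    have hwS : (sympRoots m).weylElement p q hne (1 : Bˣ) ∈ Sp m B :=
      mul_mem (mul_mem (symElem_mem_Sp p q hne _) (symElem_mem_Sp q p hne.symm _))
        (symElem_mem_Sp p q hne _)
    refine ⟨π, h₁, h₂, h₃, h₄, h₅, fun a b h hc c => ⟨?_, ?_⟩⟩
    · have := mul_mem (inv_mem hwH) (mul_mem (hc (((v a * (v b)⁻¹ : Bˣ) : B) * c)).1 hwH)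
      rwa [← symp_monomial_mul hwS hv a b h c, inv_mul_cancel_left] at this
    · have := mul_mem (inv_mem hwH) (mul_mem (hc (((v b * (v a)⁻¹ : Bˣ) : B) * c)).2 hwH)
      rwa [← symp_monomial_mul hwS hv b a h.symm c, inv_mul_cancel_left] at this
  induction n with
  | zero => exact fun a b h h₁ h₂ => absurd h₁ (by omega)
  | succ n ih =>
    intro a b h h₁ h₂
    by_cases hadj : sympPos b = sympPos a + 1
    · exact fun c => ⟨hH _ _ _ _ (Or.inl hadj), hH _ _ _ _ (Or.inr hadj)⟩
    have hb := sympPos_lt b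
    have hpa := sympPos_swap a
    have hpb := sympPos_swap b
    obtain ⟨k, hk⟩ := exists_sympPos (m := m) (p := sympPos a + 1) (by omega)
    have hpk := sympPos_swap k
    -- The reflection in `(a, k)` would move `b = swap k` to `swap a` and keep the distance; here
    -- `b` is lowered by one position instead, with `a` fixed.
    by_cases hbk : b = swap k
    · subst hbk
      obtain ⟨l, hl⟩ := exists_sympPos (m := m) (p := sympPos (swap k) - 1) (by omega)
      have hpl := sympPos_swap l
      obtain ⟨π, -, hπ, -, -, hπ', hs⟩ := step l (swap k) (by omega)
      have hπa : π a = a := hπ' a (fun e => by rw [e] at h₁ hk; omega) h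
        (fun e => by rw [e] at h₁ hk; omega) (fun e => by rw [e, swap_swap] at hk; omega)
      refine hs a _ h ?_
      simp only [hπ, hπa]
      exact ih a l _ (by omega) (by omega)
    · obtain ⟨π, hπ, -, hπs, -, hπ', hs⟩ := step a k (by omega)
      refine hs a b h ?_
      by_cases hba : b = swap a
      · subst hba
        simp only [hπ, hπs]
        exact ih _ _ _ (by omega) (by omega)
      · have hπb : π b = b := hπ' b h.symm (fun e => by rw [e] at hadj; omega) hba hbk
        simp only [hπ, hπb]
        exact ih _ _ _ (by omega) (by omega)

/-- The Bruhat decomposition of the symplectic group. -/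
def sympBruhat (m : ℕ) : BruhatData (sympGroup.{u} m) where
  pos := sympPos
  pos_injective := sympPos_injective
  x_unitri a b h c hab := by
    change Unitri _ (symElemMatrix a b c)
    have hpa := sympPos_swap a
    have hpb := sympPos_swap b
    have hlt := sympPos_lt b
    refine ⟨fun k l hkl => ?_, fun k => ?_⟩
    · have h1 : k ≠ l := fun e => by rw [e] at hkl; omega
      have h2 : ¬ (k = a ∧ l = b) := fun e => by rw [e.1, e.2] at hkl; omega
      have h3 : ¬ (a ≠ swap b ∧ k = swap b ∧ l = swap a) := fun e => by
        rw [e.2.1, e.2.2] at hkl; omega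
      rw [symElemMatrix_apply, if_neg h2, if_neg h3, Matrix.one_apply_ne h1, add_zero, sub_zero]
    · have h2 : ¬ (k = a ∧ k = b) := fun e => h (e.1.symm.trans e.2)
      have h3 : ¬ (a ≠ swap b ∧ k = swap b ∧ k = swap a) := fun e =>
        swap_ne_swap h (e.2.2.symm.trans e.2.1)
      rw [symElemMatrix_apply, if_neg h2, if_neg h3, Matrix.one_apply_eq, add_zero, sub_zero]
  conj_unitri a b h c g hab hg hu h0 := symp_conj_unitri h hab hg hu h0 c
  weyl a b h c _ := by
    obtain ⟨π, v, h₁, h₂, h₃, -⟩ := symp_weyl a b h c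
    exact ⟨π, v, h₁, h₂, h₃⟩
  monomial_mul_x := symp_monomial_mul
  E_le {B} _ := by
    refine (sympRoots m).E_le fun a b h c => ?_
    have key := symp_mem_of_adjacent (Subgroup.closure
      {g | ∃ (a b : Fin (2 * m)) (h : a ≠ b) (c : B), (sympPos b = sympPos a + 1 ∨
        sympPos a = sympPos b + 1) ∧ g = (sympGroup m).x a b h c})
      (fun a b h c hab => Subgroup.subset_closure ⟨a, b, h, c, hab, rfl⟩) (2 * m)
    have ha := sympPos_lt a
    have hb := sympPos_lt b
    rcases lt_or_gt_of_ne (sympPos_injective.ne h) with hab | hab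
    · exact (key a b h hab (by omega) c).1
    · exact (key b a h.symm hab (by omega) c).2

end SymplecticBruhat

/-! ### The symplectic group as an elementary system, and the conclusion. -/

section SymplecticSystem

variable {m : ℕ}

theorem sympTrans_apply {B : Type*} [CommRing B] (v : Fin (2 * m) → B) (c : B) (k l : Fin (2 * m)) :
    sympTrans v c k l = (1 : Matrix (Fin (2 * m)) (Fin (2 * m)) B) k l +
      v k * (c * ((-1) ^ (swap l : ℕ) * v (swap l))) := rfl

open Matrix in
/-- Conjugates of elementary symplectic matrices are products of symplectic transvections. -/
theorem symp_conj_mem {B : Type*} [CommRing B] {H : Subgroup (GL (Fin (2 * m)) B)}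
    {γ : GL (Fin (2 * m)) B} (hγ : γ ∈ Sp m B) (a b : Fin (2 * m)) (h : a ≠ b) (c : B)
    (hH : ∀ p q n : ℤ, MatMem H (sympTrans (fun k => p * γ.1 k a + q * γ.1 k (swap b)) (n * c))) :
    γ * symElem a b h c * γ⁻¹ ∈ H := by
  have key : ∀ p q n : ℤ, MatMem H (γ.1 * sympTrans ((p : B) • Pi.single a 1 +
      (q : B) • Pi.single (swap b) 1) (n * c) * (γ⁻¹).1) := fun p q n => by
    rw [conj_sympTrans hγ]
    convert hH p q n using 2
    ext k
    rw [mulVec_add, mulVec_smul, mulVec_smul]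
    simp
  apply MatMem.mem
  rw [Units.val_mul, Units.val_mul]
  change MatMem H (γ.1 * symElemMatrix a b c * (γ⁻¹).1)
  by_cases hab : a = swap b
  · rw [← swap_eq_iff.mpr hab, symElemMatrix_eq_sympTrans]
    simpa using key 1 0 ((-1) ^ (a : ℕ))
  · rw [symElemMatrix_eq_sympTrans₂ hab, sympTrans₂_eq (sympDual_single_single h)]
    have h₁ := key 0 1 (-(-1) ^ (swap b : ℕ))
    have h₂ := key 1 0 (-(-1) ^ (swap b : ℕ))
    have h₃ := key 1 1 ((-1) ^ (swap b : ℕ))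
    simp only [Int.cast_zero, Int.cast_one, zero_smul, one_smul, zero_add, add_zero, Int.cast_neg,
      Int.cast_pow, neg_mul] at h₁ h₂ h₃
    have := (h₁.mul h₂).mul h₃
    simpa only [mul_assoc, Units.inv_mul_cancel_left] using this

/-- A transvection is quadratic in its vector, so the common denominator `s` of the entries of `γ`
enters as `s²`. No coordinate has to vanish, since all symplectic transvections are elementary. -/
theorem symp_exists_conj_mem (hm : 2 ≤ m) {R L : Type u} [CommRing R] [CommRing L]
    (φ : R →+* L) (M : Submonoid R) (γ : GL (Fin (2 * m)) L) (a b : Fin (2 * m)) (h : a ≠ b)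
    (hφ : HasDenominators φ M) (hγ : γ ∈ Sp m L) : ∃ s ∈ M, ∀ (J : Ideal R), ∀ r ∈ J,
      γ * symElem a b h (φ (s * r)) * γ⁻¹ ∈
        ((sympRoots m).relE R J).map (GeneralLinearGroup.map φ) := by
  obtain ⟨s, hs, v, hv⟩ := hφ.exists_common fun x : Fin (2 * m) × Fin (2 * m) => γ.1 x.1 x.2
  refine ⟨s * s, mul_mem hs hs, fun J r hr => symp_conj_mem hγ a b h _ fun p q n => ?_⟩
  have key := (matMem_sympTrans (J := J) hm (fun k => p * v (k, a) + q * v (k, swap b)) (c := n * r)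
    (J.mul_mem_left _ hr)).map φ
  convert key using 1
  ext k l
  simp only [Matrix.map_apply, sympTrans_apply, map_add, map_mul, hv, map_intCast, map_pow, map_neg,
    map_one]
  congr 1
  · simp [Matrix.one_apply, apply_ite φ]
  · ring

/-- The twist of the transvection of `V` with parameter `n X p` is the transvection with parameter
`n p` along `V` multiplied by `X` at the coordinates with `w k = true`; the dual vector receives the
complementary factors because `w` is complemented by `swap`. -/
theorem symp_tau_conj_mem_E (hm : 2 ≤ m) {P L : Type u} [CommRing P] [CommRing L]
    (w : Fin (2 * m) → Bool) (hw : ∀ i, w (swap i) = !w i) (φ : P →+* L) {X : P} {t : Lˣ}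
    (hX : φ X = t) (γ : GL (Fin (2 * m)) P) (a b : Fin (2 * m)) (h : a ≠ b) (p : P)
    (hγ : γ ∈ Sp m P) :
    tau w t * GeneralLinearGroup.map φ (γ * symElem a b h (X * p) * γ⁻¹) * (tau w t)⁻¹ ∈
      ((sympRoots m).E P).map (GeneralLinearGroup.map φ) := by
  suffices γ * symElem a b h (X * p) * γ⁻¹ ∈
      (((sympRoots m).E P).map (GeneralLinearGroup.map φ)).comap
        ((MulAut.conj (tau w t)).toMonoidHom.comp (GeneralLinearGroup.map φ)) from this
  refine symp_conj_mem hγ a b h _ fun i j n => ?_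
  generalize (fun k => (i : P) * γ.1 k a + j * γ.1 k (swap b)) = V
  obtain ⟨g, -, hge⟩ := matMem_sympTrans (J := ⊤) hm V (c := n * (X * p)) trivial
  obtain ⟨g', hg', hge'⟩ := matMem_sympTrans (J := ⊤) hm (fun k => (if w k then X else 1) * V k)
    (c := n * p) trivial
  rw [RootElements.relE_top] at hg'
  refine ⟨g, ⟨g', hg', ?_⟩, hge⟩
  ext k l
  change φ (g'.1 k l) = (tau w t * GeneralLinearGroup.map φ g * (tau w t)⁻¹).1 k l
  rw [tau_conj_apply]
  change _ = _ * φ (g.1 k l) * _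
  rw [hge, hge']
  simp only [sympTrans_apply, map_add, map_mul, Matrix.one_apply, apply_ite φ, map_one, map_zero,
    hX, tauUnit, map_intCast, map_pow, map_neg, hw l]
  have ht := t.mul_inv
  by_cases hkl : k = l
  · subst hkl
    by_cases hk : w k <;> simp only [hk, if_true, if_false, Bool.false_eq_true, inv_one,
      Units.val_one, Bool.not_true, Bool.not_false]
    · linear_combination -(1 + φ (V k) * (n * (t * φ p) * ((-1) ^ (swap k : ℕ) *
        φ (V (swap k))))) * ht
    · ring
  · by_cases hk : w k <;> by_cases hl : w l <;> simp only [hkl, hk, hl, if_true, if_false,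
      Bool.false_eq_true, inv_one, Units.val_one, Bool.not_true, Bool.not_false]
    · linear_combination -(φ (V k) * (n * (t * φ p) * ((-1) ^ (swap l : ℕ) * φ (V (swap l))))) * ht
    · ring
    · linear_combination -(φ (V k) * (n * φ p * ((-1) ^ (swap l : ℕ) * φ (V (swap l))))) * ht
    · ring

theorem tauUnit_swap {B : Type*} [CommRing B] {w : Fin (2 * m) → Bool}
    (hw : ∀ i, w (swap i) = !w i) (t : Bˣ) (i : Fin (2 * m)) :
    tauUnit w t (swap i) = t * (tauUnit w t i)⁻¹ := by
  unfold tauUnit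
  rw [hw]
  cases w i <;> simp

/-- `tau w t` is a similitude of the form with multiplier `t`, so conjugation by it preserves the
symplectic group. -/
theorem symp_tau_conj_mem {B : Type*} [CommRing B] {w : Fin (2 * m) → Bool}
    (hw : ∀ i, w (swap i) = !w i) (t : Bˣ) {g : GL (Fin (2 * m)) B} (hg : g ∈ Sp m B) :
    tau w t * g * (tau w t)⁻¹ ∈ Sp m B := by
  rw [mem_Sp_iff_sum] at hg ⊢
  intro a b
  have hU : ∀ l, (tauUnit w t (swap l) : B) * tauUnit w t l = t := fun l => by
    rw [tauUnit_swap hw, ← Units.val_mul, inv_mul_cancel_right]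
  calc _ = t * ((tauUnit w t a)⁻¹ : Bˣ) * ((tauUnit w t b)⁻¹ : Bˣ) *
        ∑ l, (-1) ^ (swap l : ℕ) * g.1 (swap l) a * g.1 l b := by
        rw [Finset.mul_sum]
        refine Finset.sum_congr rfl fun l _ => ?_
        rw [tau_conj_apply, tau_conj_apply]
        linear_combination ((-1) ^ (swap l : ℕ) * g.1 (swap l) a * g.1 l b *
          ((tauUnit w t a)⁻¹ : Bˣ) * ((tauUnit w t b)⁻¹ : Bˣ)) * hU l
    _ = chi m B a b := by
        rw [hg, chi, Matrix.of_apply]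
        split_ifs with h
        · have := hU a
          rw [← h] at this
          have h₁ := (tauUnit w t a).mul_inv
          have h₂ := (tauUnit w t b).mul_inv
          rw [← this]
          linear_combination ((-1) ^ (a : ℕ) * (tauUnit w t b : B) * ((tauUnit w t b)⁻¹ : Bˣ)) * h₁ +
            (-1) ^ (a : ℕ) * h₂
        · rw [mul_zero]

theorem symp_tau_conj_x {B : Type*} [CommRing B] {w : Fin (2 * m) → Bool}
    (hw : ∀ i, w (swap i) = !w i) (t : Bˣ) (a b : Fin (2 * m)) (h : a ≠ b) (c : B) :
    tau w t * symElem a b h c * (tau w t)⁻¹ =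
      symElem a b h (((tauUnit w t a * (tauUnit w t b)⁻¹ : Bˣ) : B) * c) := by
  ext k l
  rw [tau_conj_apply]
  change _ * symElemMatrix a b c k l * _ = symElemMatrix a b _ k l
  rw [symElemMatrix_apply, symElemMatrix_apply]
  have h₁ : (tauUnit w t k : B) * (1 : Matrix (Fin (2 * m)) (Fin (2 * m)) B) k l *
      ((tauUnit w t l)⁻¹ : Bˣ) = (1 : Matrix (Fin (2 * m)) (Fin (2 * m)) B) k l := by
    rcases eq_or_ne k l with rfl | hkl
    · simp
    · simp [hkl]
  have h₂ : (tauUnit w t k : B) * (if k = a ∧ l = b then c else 0) * ((tauUnit w t l)⁻¹ : Bˣ) =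
      if k = a ∧ l = b then ((tauUnit w t a * (tauUnit w t b)⁻¹ : Bˣ) : B) * c else 0 := by
    split_ifs with hkl
    · rw [hkl.1, hkl.2, Units.val_mul]
      ring
    · ring
  have h₃ : (tauUnit w t k : B) * (if a ≠ swap b ∧ k = swap b ∧ l = swap a then
      (-1) ^ ((a : ℕ) + (b : ℕ)) * c else 0) * ((tauUnit w t l)⁻¹ : Bˣ) =
      if a ≠ swap b ∧ k = swap b ∧ l = swap a then (-1) ^ ((a : ℕ) + (b : ℕ)) *
        (((tauUnit w t a * (tauUnit w t b)⁻¹ : Bˣ) : B) * c) else 0 := by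
    split_ifs with hkl
    · have e : tauUnit w t (swap b) * (tauUnit w t (swap a))⁻¹ =
          tauUnit w t a * (tauUnit w t b)⁻¹ := by
        rw [tauUnit_swap hw, tauUnit_swap hw, mul_inv, inv_inv, mul_mul_mul_comm, mul_inv_cancel,
          one_mul, mul_comm]
      rw [hkl.2.1, hkl.2.2, ← e, Units.val_mul]
      ring
    · ring
  linear_combination h₁ + h₂ - h₃

open Matrix in
theorem sympTrans_mul_sympTrans₂ {B : Type*} [CommRing B] {v w : Fin (2 * m) → B}
    (h : sympDual v ⬝ᵥ w = 0) (c d : B) :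
    sympTrans w c * sympTrans₂ v w d = sympTrans₂ v w d * sympTrans w c := by
  have h' : sympDual w ⬝ᵥ v = 0 := by rw [sympDual_dotProduct_swap, h, neg_zero]
  simp only [sympTrans, sympTrans₂, mul_add, add_mul, mul_one, one_mul, vecMulVec_mul_vecMulVec,
    smul_dotProduct, h, h', sympDual_dotProduct_self, smul_zero, zero_smul, vecMulVec_zero,
    add_zero]
  abel

open Matrix in
/-- The commutator relation between a short and a long root element. -/
theorem symp_commutator {B : Type u} [CommRing B] {a k : Fin (2 * m)} (h : a ≠ k) (h' : k ≠ swap a)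
    (s y : B) : symElem a k h s * symElem k (swap k) (swap_ne k).symm y * symElem a k h (-s) *
      symElem k (swap k) (swap_ne k).symm (-y) =
    symElem a (swap a) (swap_ne a).symm (((-1) ^ (a : ℕ) * (-1) ^ (k : ℕ)) * (s ^ 2 * y)) *
      symElem k (swap a) h' (((-1) ^ (a : ℕ) * (-1) ^ (k : ℕ)) * (s * y)) := by
  have hinv : symElem a k h (-s) = (symElem a k h s)⁻¹ := (sympRoots m).x_neg a k h s
  have hinv' : symElem k (swap k) (swap_ne k).symm (-y) =
    (symElem k (swap k) (swap_ne k).symm y)⁻¹ := (sympRoots m).x_neg k (swap k) (swap_ne k).symm y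
  rw [hinv, hinv', mul_inv_eq_iff_eq_mul]
  apply Units.ext
  simp only [Units.val_mul]
  change _ * symElemMatrix k (swap k) y * _ =
    symElemMatrix a (swap a) _ * symElemMatrix k (swap a) _ * symElemMatrix k (swap k) y
  have hv : (symElem a k h s).1 *ᵥ Pi.single k 1 = s • Pi.single a 1 + Pi.single k 1 := by
    ext l
    rw [mulVec_single_one]
    refine ((sympGroup m).x_col a k h s l).trans ?_
    simp [Matrix.one_apply, Pi.single_apply, add_comm]
  have h0 : sympDual (Pi.single a (1 : B)) ⬝ᵥ Pi.single k 1 = 0 := by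
    rw [sympDual_single_dotProduct, Pi.single_eq_of_ne h'.symm, mul_zero]
  have h0' : sympDual (s • (Pi.single a 1 : Fin (2 * m) → B)) ⬝ᵥ Pi.single k 1 = 0 := by
    rw [sympDual_smul, smul_dotProduct, h0, smul_zero]
  have e₁ : (-1 : B) ^ (a : ℕ) * ((-1) ^ (a : ℕ) * (-1) ^ (k : ℕ) * (s ^ 2 * y)) =
      s ^ 2 * ((-1) ^ (k : ℕ) * y) := by
    linear_combination ((-1) ^ (k : ℕ) * s ^ 2 * y) * neg_one_pow_mul_self (B := B) (a : ℕ)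
  have e₂ : (-1 : B) ^ (a : ℕ) * ((-1) ^ (a : ℕ) * (-1) ^ (k : ℕ) * (s * y)) =
      s * ((-1) ^ (k : ℕ) * y) := by
    linear_combination ((-1) ^ (k : ℕ) * s * y) * neg_one_pow_mul_self (B := B) (a : ℕ)
  rw [symElemMatrix_eq_sympTrans, conj_sympTrans (symElem_mem_Sp _ _ _ _), hv,
    symElemMatrix_eq_sympTrans, symElemMatrix_eq_sympTrans₂ (by rwa [swap_swap, ne_comm]), swap_swap,
    e₁, e₂, ← sympTrans_smul, ← sympTrans₂_smul, sympTrans_add h0',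
    mul_assoc, sympTrans_mul_sympTrans₂ h0', sympTrans₂_comm, ← mul_assoc]

/-- The commutator of a short and a long root element is a long element with parameter `± s² y`
times a short one with parameter `± s y`. Cancelling the short factor gives all long elements; the
same relation with `1` in place of `s` and `s² y` in place of `y` gives the short ones. As `H` has
no inverses, both signs are carried along. -/
theorem symp_sq_mul_mem (hm : 2 ≤ m) {B : Type u} [CommRing B]
    {H : Submonoid (GL (Fin (2 * m)) B)} {s y : B}
    (hH : ∀ z, z = 1 ∨ z = s ∨ z = y ∨ z = s * y → ∀ (a b : Fin (2 * m)) (h : a ≠ b),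
      symElem a b h z ∈ H ∧ symElem a b h (-z) ∈ H) (a b : Fin (2 * m)) (h : a ≠ b) :
    symElem a b h (s ^ 2 * y) ∈ H := by
  have hη : ∀ a k : Fin (2 * m), (-1 : B) ^ (a : ℕ) * (-1) ^ (k : ℕ) = 1 ∨
      (-1 : B) ^ (a : ℕ) * (-1) ^ (k : ℕ) = -1 := fun a k => by
    rw [← pow_add]
    exact neg_one_pow_eq_or B _
  have key : ∀ (a b : Fin (2 * m)) (h : a ≠ b) (c d : B), symElem a b h (c + d) =
    symElem a b h c * symElem a b h d := (sympRoots m).x_add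
  have key' : ∀ (a b : Fin (2 * m)) (h : a ≠ b) (c : B), symElem a b h (-c) =
    (symElem a b h c)⁻¹ := (sympRoots m).x_neg
  have hlong : ∀ (a : Fin (2 * m)),
      symElem a (swap a) (swap_ne a).symm (s ^ 2 * y) ∈ H ∧
        symElem a (swap a) (swap_ne a).symm (-(s ^ 2 * y)) ∈ H := by
    intro a
    obtain ⟨k, hka, hks⟩ := exists_ne_ne (by omega) a (swap a)
    have h₁ := hH s (by simp) a k hka.symm
    have h₂ := hH y (by simp) k (swap k) (swap_ne k).symm
    have h₃ := hH (s * y) (by simp) k (swap a) hks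
    have c₁ := symp_commutator hka.symm hks s y
    have c₂ := symp_commutator hka.symm hks s (-y)
    rw [neg_neg, mul_neg, mul_neg, mul_neg, mul_neg] at c₂
    have m₁ := mul_mem (mul_mem (mul_mem h₁.1 h₂.1) h₁.2) h₂.2
    have m₂ := mul_mem (mul_mem (mul_mem h₁.1 h₂.2) h₁.2) h₂.1
    rw [c₁] at m₁
    rw [c₂] at m₂
    rcases hη a k with e | e
    · rw [e, one_mul, one_mul] at m₁ m₂
      have m₁ := mul_mem m₁ h₃.2
      have m₂ := mul_mem m₂ h₃.1
      rw [key', mul_inv_cancel_right] at m₁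
      rw [key' k, inv_mul_cancel_right] at m₂
      exact ⟨m₁, m₂⟩
    · rw [e, neg_one_mul, neg_one_mul] at m₁ m₂
      rw [neg_neg, neg_neg] at m₂
      have m₁ := mul_mem m₁ h₃.1
      have m₂ := mul_mem m₂ h₃.2
      rw [key' k, inv_mul_cancel_right] at m₁
      rw [key', mul_inv_cancel_right] at m₂
      exact ⟨m₂, m₁⟩
  obtain ⟨d, rfl⟩ : ∃ d, b = swap d := ⟨swap b, (swap_swap b).symm⟩
  by_cases hda : d = a
  · subst hda
    exact (hlong d).1
  have h₁ := hH 1 (by simp) d a hda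
  have h₂ := hlong a
  have h₃ := hlong d
  have c₁ := symp_commutator hda h 1 (s ^ 2 * y)
  have c₂ := symp_commutator hda h 1 (-(s ^ 2 * y))
  rw [neg_neg, mul_neg, mul_neg, mul_neg, mul_neg, one_pow, one_mul] at c₂
  rw [one_pow, one_mul] at c₁
  have m₁ := mul_mem (mul_mem (mul_mem h₁.1 h₂.1) h₁.2) h₂.2
  have m₂ := mul_mem (mul_mem (mul_mem h₁.1 h₂.2) h₁.2) h₂.1
  rw [c₁] at m₁
  rw [c₂] at m₂
  rcases hη d a with e | e
  · rw [e, one_mul] at m₁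
    have m₁ := mul_mem h₃.2 m₁
    rwa [key', inv_mul_cancel_left] at m₁
  · rw [e, neg_one_mul, neg_neg] at m₂
    have m₂ := mul_mem h₃.2 m₂
    rwa [key', inv_mul_cancel_left] at m₂

/-- The symplectic group as an elementary system. -/
def sympSystem (hm : 2 ≤ m) : ElementarySystem.{u} (2 * m) where
  toElementaryGroup := sympGroup m
  sq_mul_mem H s y hH a b h := by
    exact symp_sq_mul_mem hm hH a b h
  W := {w | ∀ i, w (swap i) = !w i}
  W_compl w hw i := congrArg Bool.not (hw i)
  W_sep a b h := by
    have hs := swap_ne_swap h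
    -- Besides `a` and `b`, their partners are prescribed with the complementary values; elsewhere
    -- parity is a default that `swap` complements.
    refine ⟨fun c => if c = a ∨ c = swap b then true else if c = b ∨ c = swap a then false else
      decide ((c : ℕ) % 2 = 0), fun c => ?_, by simp, ?_⟩
    · have h₁ : swap c = a ↔ c = swap a := swap_eq_iff
      have h₂ : swap c = b ↔ c = swap b := swap_eq_iff
      have h₃ : swap c = swap a ↔ c = a := by rw [swap_eq_iff, swap_swap]
      have h₄ : swap c = swap b ↔ c = b := by rw [swap_eq_iff, swap_swap]
      have h₅ : ((swap c : ℕ) % 2 = 0) ↔ ¬ ((c : ℕ) % 2 = 0) := by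
        rw [swap_val]
        split_ifs <;> omega
      simp only [h₁, h₂, h₃, h₄, h₅]
      simp only [or_comm (a := c = swap a), or_comm (a := c = swap b)]
      have hdisj : c = a ∨ c = swap b → ¬ (c = b ∨ c = swap a) := by
        rintro (e | e) (e' | e')
        · exact h (e.symm.trans e')
        · exact swap_ne a (e'.symm.trans e)
        · exact swap_ne b (e.symm.trans e')
        · exact hs (e'.symm.trans e)
      by_cases e₁ : c = a ∨ c = swap b
      · simp [e₁, hdisj e₁]
      · by_cases e₂ : c = b ∨ c = swap a
        · simp [e₁, e₂]
        · simp only [e₁, e₂, if_false, decide_not]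
    · simp [h.symm, (swap_ne b).symm]
  tau_conj_mem_G w t g hw hg := symp_tau_conj_mem hw t hg
  tau_conj_x w t a b h c hw := symp_tau_conj_x hw t a b h c
  tau_conj_mem_E w φ X t γ a b h p hw hX hγ :=
    symp_tau_conj_mem_E hm w hw φ hX γ a b h p (sympRoots_E_le_Sp hγ)
  exists_conj_mem φ M γ a b h hφ hγ :=
    symp_exists_conj_mem hm φ M γ a b h hφ (sympRoots_E_le_Sp hγ)
  E_inf_relGL_le J hJ := (sympBruhat m).E_inf_relGL_le hJ

end SymplecticSystem

end RelativeElementary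

theorem mainTheorem9 {R : Type*} [CommRing R] [IsNoetherianRing R] (I : Ideal R) :
    (∀ n : ℕ, n ≠ 2 →
      ∀ α ∈ RelativeElementary.relSL n (Polynomial R) (RelativeElementary.polyIdeal I),
        (∃ f : Polynomial R, f.Monic ∧
          RelativeElementary.locAway f α ∈ RelativeElementary.relE n (Localization.Away f)
            (RelativeElementary.polyIdealAway I f)) →
        α ∈ RelativeElementary.relE n (Polynomial R) (RelativeElementary.polyIdeal I)) ∧
    (∀ m : ℕ, 4 ≤ 2 * m →
      ∀ α ∈ RelativeElementary.relSp m (Polynomial R) (RelativeElementary.polyIdeal I),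
        (∃ f : Polynomial R, f.Monic ∧
          RelativeElementary.locAway f α ∈ RelativeElementary.relESp m (Localization.Away f)
            (RelativeElementary.polyIdealAway I f)) →
        α ∈ RelativeElementary.relESp m (Polynomial R) (RelativeElementary.polyIdeal I)) := by
  refine ⟨fun n hn α hα ⟨f, hf, hαf⟩ => ?_, fun m hm α hα ⟨f, hf, hαf⟩ => ?_⟩
  · by_cases hn3 : 3 ≤ n
    · exact (RelativeElementary.linearSystem hn3).mem_relE_of_monic I hα.2 hα.1 hf hαf
    -- For `n ≤ 1` determinant `1` leaves only the identity matrix.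
    · have hα1 : α = 1 := by
        apply Units.ext
        have hdet := congrArg Units.val (MonoidHom.mem_ker.mp hα.2)
        interval_cases n
        · exact Subsingleton.elim _ _
        · rw [Matrix.GeneralLinearGroup.val_det_apply, Matrix.det_fin_one] at hdet
          ext i j
          rw [Subsingleton.elim i 0, Subsingleton.elim j 0, hdet]
          simp
        · exact absurd rfl hn
      rw [hα1]
      exact one_mem _
  · exact (RelativeElementary.sympSystem (by omega)).mem_relE_of_monic I hα.2 hα.1 hf hαf
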